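/- A \emph{positive hypergraph} $S$ consists of finite sets $S_k$ ($k\in\omega$) of faces, only finitely many of them non-empty, functions $\gamma:S_{k+1}\to S_k$ and total relations $\delta:S_{k+1}\to S_k$ (so $\delta(a)\subseteq S_k$ is a non-empty set), where $\delta:S_1\to S_0$ is a function. Write $\delta\delta(a)=\bigcup_{y\in\delta(a)}\delta(y)$, $\gamma\delta(a)=\{\gamma(y):y\in\delta(a)\}$ and $\iota(a)=\gamma\delta(a)\cap\delta\delta(a)$. Let $<^-$ on $S_k$ ($k>0$) be the transitive closure of the relation $\gamma(a)\in\delta(b)$, and $<^+$ on $S_k$ ($k\ge 0$) the transitive closure of the relation "$a\in\delta(\alpha)$ and $\gamma(\alpha)=b$ for some $\alpha\in S_{k+1}$"; let $\perp^{\pm}$ denote comparability in $<^{\pm}$. $S$ is a \emph{positive opetopic cardinal} if $S_0\ne\emptyset$ and: (globularity) $\{\gamma\gamma(a)\}=\gamma\delta(a)-\delta\delta(a)$ and $\delta\gamma(a)=\delta\delta(a)-\gamma\delta(a)$ for every face $a$ of dimension $\ge 2$; (strictness) every $<^+$ is a strict order, and it is linear on $S_0$; (disjointness) $\perp^-\cap\perp^+=\emptyset$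 on $S_k$ for $k>0$; (pencil linearity) for $k>0$ and $x\in S_{k-1}$ the sets $\{a\in S_k: \gamma(a)=x\}$ and $\{a\in S_k:x\in\delta(a)\}$ are linearly ordered by $<^+$. It is a \emph{positive opetope} if moreover $|S_l-\delta(S_{l+1})|\le 1$ for all $l$. For a face $q$ of dimension $l$, $\gamma^{(k)}(q)$ is $q$ if $l\le k$ and otherwise the $k$-face obtained by applying $\gamma$ to $q$ repeatedly. A \emph{contraction map} $h:Q\to P$ of positive opetopes is a function between their sets of all faces with $\dim h(q)\le\dim q$ for all $q$ such that, with $\ker h=\{q:\dim h(q)<\dim q\}$, for all $k\ge0$ and $q\in Q_{k+1}$: $h(\gamma^{(k)}(q))=\gamma^{(k)}(h(q))$; if $\dim h(q)=\dim q$, then $h$ restricts to a bijection $\delta(q)-\ker h\to\delta(h(q))$; if $\dim h(q)=\dim q-1$, then $h$ restricts to a bijection $\delta(q)-\ker h\to\{h(q)\}$; if $\dim h(q)<\dim q-1$, then $\delta(q)\subseteq\ker h$. Positive opetopes and contraction maps form the category $\mathbf{pOpe}_\iota$. Let $\omega\mathbf{Cat}$ be the category of (small) strict $\omega$-categories and strict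 $\omega$-functors. For a positive opetope $T$, the $n$-cells of $T^*$ are the pairs $(S,n)$ where $S\subseteq T$ is a sub-hypergraph (closed under $\gamma$ and $\delta$) that is itself a positive opetopic cardinal, with $S_l=\emptyset$ for $l>n$. For $k<n$ the $k$-domain and $k$-codomain of $(S,n)$ are $(d^{(k)}S,k)$ and $(c^{(k)}S,k)$, where both are empty in dimensions $>k$; $(d^{(k)}S)_k=S_k-\gamma(S_{k+1})$ and $(d^{(k)}S)_l=S_l$ for $l<k$; $(c^{(k)}S)_k=S_k-\delta(S_{k+1})$, $(c^{(k)}S)_{k-1}=S_{k-1}-\iota(S_{k+1})$ if $k\ge1$, and $(c^{(k)}S)_l=S_l$ for $l<k-1$. The identity on $(S,n)$ is $(S,n+1)$, and when $d^{(k)}S=c^{(k)}S'$ the composite of $(S,n)$ and $(S',n)$ along $k$-cells is $(S\cup S',n)$. For a contraction map $h:Q\to P$ put $h^*(S,n)=(h(S),n)$, where $h(S)$ is the set-theoretic image. The \emph{generators} of $T^*$ are the cells $(T[x],n)$, for $x\in T_n$, where $T[x]$ is the least sub-hypergraph of $T$ containing $x$. An $\omega$-category $C$ with sets $E_n$ of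 $n$-cells is a \emph{polygraph} with generators $E_n$ if all $0$-cells are in $E_0$ and, for every $m$, the $(m+1)$-truncation of $C$ is freely generated over its $m$-truncation by $E_{m+1}$; it is \emph{positive-to-one} if the codomain of each generator in $E_{n+1}$ is a generator in $E_n$ and the domain of each generator in $E_{n+2}$ is not an identity. \textbf{Theorem.} These data define strict $\omega$-categories $T^*$ and strict $\omega$-functors $h^*$, giving a functor $$(-)^*:\mathbf{pOpe}_\iota\longrightarrow\omega\mathbf{Cat}.$$ For each positive opetope $T$, the $\omega$-category $T^*$ is a positive-to-one polygraph with the generators above. The functor $(-)^*$ is faithful and conservative (it reflects isomorphisms). It is full on those $\omega$-functors that send generators to generators or to (possibly iterated) identities on generators of smaller dimension: each such $\omega$-functor $f:Q^*\to P^*$ is $h^*$ for some contraction map $h:Q\to P$. It is full on isomorphisms: each isomorphism $f:Q^*\to P^*$ in $\omega\mathbf{Cat}$ is $h^*$ for some isomorphism $h:Q\to P$ in $\mathbf{pOpe}_\iota$. -/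

import Mathlib

open CategoryTheory

universe u

namespace PositiveOpetopes

/-! ## Positive hypergraphs -/

/-- A positive hypergraph: finite sets of `k`-faces, almost all of them empty, codomain functions
`γ`, and total domain relations `δ` (here: `δ a` is the nonempty set of faces related to `a`),
where `δ` on `1`-faces is a function. -/
structure PosHypergraph where
  face : ℕ → Type u
  γ : ∀ {k : ℕ}, face (k + 1) → face k
  δ : ∀ {k : ℕ}, face (k + 1) → Set (face k)
  finite_face : ∀ k, Finite (face k)
  δ_nonempty : ∀ {k : ℕ} (a : face (k + 1)), (δ a).Nonempty
  δ_function : ∀ a : face (0 + 1), ∃ x, δ a = {x}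
  bounded : ∃ N : ℕ, ∀ k, N ≤ k → IsEmpty (face k)

namespace PosHypergraph

variable (S : PosHypergraph.{u})

/-- `δδ(a) = ⋃_{y ∈ δ(a)} δ(y)`. -/
def δδ {k : ℕ} (a : S.face (k + 2)) : Set (S.face k) := {x | ∃ y ∈ S.δ a, x ∈ S.δ y}

/-- `γδ(a) = {γ(y) | y ∈ δ(a)}`. -/
def γδ {k : ℕ} (a : S.face (k + 2)) : Set (S.face k) := {x | ∃ y ∈ S.δ a, S.γ y = x}

/-- The internal faces `ι(a) = γδ(a) ∩ δδ(a)`. -/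
def ι {k : ℕ} (a : S.face (k + 2)) : Set (S.face k) := S.γδ a ∩ S.δδ a

/-- The lower order `<^-` on faces of positive dimension. -/
def lowLt {k : ℕ} : S.face (k + 1) → S.face (k + 1) → Prop :=
  Relation.TransGen fun a b => S.γ a ∈ S.δ b

/-- The upper order `<^+`. -/
def upLt {k : ℕ} : S.face k → S.face k → Prop :=
  Relation.TransGen fun a b => ∃ α : S.face (k + 1), a ∈ S.δ α ∧ S.γ α = b

/-- `a ⊥^- b`. -/
def lowPerp {k : ℕ} (a b : S.face (k + 1)) : Prop := S.lowLt a b ∨ S.lowLt b a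

/-- `a ⊥^+ b`. -/
def upPerp {k : ℕ} (a b : S.face k) : Prop := S.upLt a b ∨ S.upLt b a

/-- Positive opetopic cardinals. As `<^+` is transitive by definition, strictness amounts to
irreflexivity, and linearity to comparability of distinct elements. -/
structure IsOpetopicCardinal : Prop where
  nonempty : Nonempty (S.face 0)
  globular_γ : ∀ (k : ℕ) (a : S.face (k + 2)), {S.γ (S.γ a)} = S.γδ a \ S.δδ a
  globular_δ : ∀ (k : ℕ) (a : S.face (k + 2)), S.δ (S.γ a) = S.δδ a \ S.γδ a
  strict : ∀ (k : ℕ) (a : S.face k), ¬ S.upLt a a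
  linear_zero : ∀ a b : S.face 0, a ≠ b → S.upPerp a b
  disjoint : ∀ (k : ℕ) (a b : S.face (k + 1)), ¬ (S.lowPerp a b ∧ S.upPerp a b)
  pencil_γ : ∀ (k : ℕ) (x : S.face k) (a b : S.face (k + 1)),
    S.γ a = x → S.γ b = x → a ≠ b → S.upPerp a b
  pencil_δ : ∀ (k : ℕ) (x : S.face k) (a b : S.face (k + 1)),
    x ∈ S.δ a → x ∈ S.δ b → a ≠ b → S.upPerp a b

/-- `size(S)_l = |S_l - δ(S_{l+1})|`. -/
noncomputable def size (l : ℕ) : ℕ :=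
  Set.ncard {x : S.face l | ¬ ∃ a : S.face (l + 1), x ∈ S.δ a}

/-- The set `|S|` of all faces of `S`. -/
def Face : Type u := Σ k, S.face k

variable {S}

/-- The dimension of a face. -/
def Face.dim (x : S.Face) : ℕ := x.1

/-- `δ(x)` as a set of faces (empty for a face of dimension `0`). -/
def Face.δ : S.Face → Set S.Face
  | ⟨0, _⟩ => ∅
  | ⟨_ + 1, x⟩ => {y | ∃ z ∈ S.δ x, y = ⟨_, z⟩}

/-- The iterated codomain for a face given with its dimension. -/
def γIterAux (k : ℕ) : ∀ l : ℕ, S.face l → S.Face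
  | 0, x => ⟨0, x⟩
  | l + 1, x => if k < l + 1 then γIterAux k l (S.γ x) else ⟨l + 1, x⟩

/-- The iterated codomain `γ^{(k)}`: apply `γ` until the dimension is at most `k`. -/
def Face.γIter (k : ℕ) (x : S.Face) : S.Face := γIterAux k x.1 x.2

theorem Face.γIter_of_le {k : ℕ} (x : S.Face) (h : x.dim ≤ k) : x.γIter k = x := by
  obtain ⟨l, x⟩ := x
  cases l with
  | zero => rfl
  | succ l =>
    have h' : ¬ k < l + 1 := by simpa [Face.dim] using h
    simp only [Face.γIter, γIterAux, h']
    rfl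

variable (S)

/-- A sub-hypergraph: a family of sets of faces closed under `γ` and `δ`. -/
structure Sub where
  carrier : ∀ k, Set (S.face k)
  γ_mem : ∀ {k : ℕ} (a : S.face (k + 1)), a ∈ carrier (k + 1) → S.γ a ∈ carrier k
  δ_mem : ∀ {k : ℕ} (a : S.face (k + 1)), a ∈ carrier (k + 1) → S.δ a ⊆ carrier k

variable {S}

/-- A sub-hypergraph as a positive hypergraph in its own right. -/
def Sub.toHypergraph (A : S.Sub) : PosHypergraph.{u} where
  face k := {x : S.face k // x ∈ A.carrier k}
  γ a := ⟨S.γ a.1, A.γ_mem a.1 a.2⟩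
  δ a := {x | x.1 ∈ S.δ a.1}
  finite_face k := by
    have := S.finite_face k
    infer_instance
  δ_nonempty a := by
    obtain ⟨x, hx⟩ := S.δ_nonempty a.1
    exact ⟨⟨x, A.δ_mem a.1 a.2 hx⟩, hx⟩
  δ_function a := by
    obtain ⟨x, hx⟩ := S.δ_function a.1
    have hxa : x ∈ S.δ a.1 := by rw [hx]; rfl
    refine ⟨⟨x, A.δ_mem a.1 a.2 hxa⟩, ?_⟩
    ext y
    simp [hx, Subtype.ext_iff]
  bounded := by
    obtain ⟨N, hN⟩ := S.bounded
    exact ⟨N, fun k hk => ⟨fun x => (hN k hk).false x.1⟩⟩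

/-- The least sub-hypergraph `S[x]` containing the face `x`. -/
def gen {n : ℕ} (x : S.face n) : S.Sub where
  carrier k := {y | ∀ A : S.Sub, x ∈ A.carrier n → y ∈ A.carrier k}
  γ_mem a ha A hA := A.γ_mem a (ha A hA)
  δ_mem a ha _ hy A hA := A.δ_mem a (ha A hA) hy

/-- The faces of the iterated domain `d^{(k)}(A)`. -/
def Sub.domFaces (A : S.Sub) (k l : ℕ) : Set (S.face l) :=
  {x | x ∈ A.carrier l ∧ l ≤ k ∧ (l = k → ¬ ∃ a ∈ A.carrier (l + 1), S.γ a = x)}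

/-- The faces of the iterated codomain `c^{(k)}(A)`. -/
def Sub.codFaces (A : S.Sub) (k l : ℕ) : Set (S.face l) :=
  {x | x ∈ A.carrier l ∧ l ≤ k ∧ (l = k → ¬ ∃ a ∈ A.carrier (l + 1), x ∈ S.δ a) ∧
    (l + 1 = k → ¬ ∃ a ∈ A.carrier (l + 2), x ∈ S.ι a)}

end PosHypergraph

open PosHypergraph

/-! ## Contraction morphisms and the category of positive opetopes -/

/-- The kernel of a map on faces: the faces whose dimension is lowered. -/
def faceKer {Q P : PosHypergraph.{u}} (h : Q.Face → P.Face) : Set Q.Face :=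
  {q | (h q).dim < q.dim}

/-- Contraction morphisms (`ι`-maps). -/
@[ext]
structure Contraction (Q P : PosHypergraph.{u}) where
  toFun : Q.Face → P.Face
  dim_le : ∀ q, (toFun q).dim ≤ q.dim
  map_γ : ∀ (k : ℕ) (q : Q.Face), q.dim = k + 1 → toFun (q.γIter k) = (toFun q).γIter k
  map_δ_zero : ∀ (k : ℕ) (q : Q.Face), q.dim = k + 1 → (toFun q).dim = q.dim →
    Set.BijOn toFun (q.δ \ faceKer toFun) (toFun q).δ
  map_δ_one : ∀ (k : ℕ) (q : Q.Face), q.dim = k + 1 → (toFun q).dim + 1 = q.dim →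
    Set.BijOn toFun (q.δ \ faceKer toFun) {toFun q}
  map_δ_two : ∀ (k : ℕ) (q : Q.Face), q.dim = k + 1 → (toFun q).dim + 1 < q.dim →
    q.δ ⊆ faceKer toFun

namespace Contraction

/-- The identity contraction. -/
def id (Q : PosHypergraph.{u}) : Contraction Q Q where
  toFun q := q
  dim_le _ := le_rfl
  map_γ _ _ _ := rfl
  map_δ_zero k q hq _ := by
    have : faceKer (fun q : Q.Face => q) = ∅ := by ext; simp [faceKer]
    rw [this, Set.sdiff_empty]
    exact Set.bijOn_id _
  map_δ_one k q hq h := by omega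
  map_δ_two k q hq h := by omega

theorem faceKer_comp {Q P R : PosHypergraph.{u}} (h : Contraction Q P) (g : Contraction P R)
    (q : Q.Face) : q ∉ faceKer (fun x => g.toFun (h.toFun x)) ↔
      q ∉ faceKer h.toFun ∧ h.toFun q ∉ faceKer g.toFun := by
  have h1 := h.dim_le q
  have h2 := g.dim_le (h.toFun q)
  simp only [faceKer, Set.mem_ofPred_eq]
  omega

theorem bijOn_comp {Q P R : PosHypergraph.{u}} (h : Contraction Q P) (g : Contraction P R)
    {s : Set Q.Face} {t : Set P.Face} {r : Set R.Face}
    (h1 : Set.BijOn h.toFun (s \ faceKer h.toFun) t)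
    (h2 : Set.BijOn g.toFun (t \ faceKer g.toFun) r) :
    Set.BijOn (fun x => g.toFun (h.toFun x))
      (s \ faceKer (fun x => g.toFun (h.toFun x))) r := by
  refine ⟨?_, ?_, ?_⟩
  · rintro x ⟨hx, hk⟩
    rw [faceKer_comp] at hk
    exact h2.mapsTo ⟨h1.mapsTo ⟨hx, hk.1⟩, hk.2⟩
  · rintro x ⟨hx, hk⟩ y ⟨hy, hk'⟩ e
    rw [faceKer_comp] at hk hk'
    exact h1.injOn ⟨hx, hk.1⟩ ⟨hy, hk'.1⟩
      (h2.injOn ⟨h1.mapsTo ⟨hx, hk.1⟩, hk.2⟩ ⟨h1.mapsTo ⟨hy, hk'.1⟩, hk'.2⟩ e)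
  · intro z hz
    obtain ⟨y, ⟨hy, hyk⟩, rfl⟩ := h2.surjOn hz
    obtain ⟨x, ⟨hx, hxk⟩, rfl⟩ := h1.surjOn hy
    refine ⟨x, ⟨hx, ?_⟩, rfl⟩
    rw [faceKer_comp]
    exact ⟨hxk, hyk⟩

/-- Composition of contractions, `h` followed by `g`. -/
def comp {Q P R : PosHypergraph.{u}} (h : Contraction Q P) (g : Contraction P R) :
    Contraction Q R where
  toFun q := g.toFun (h.toFun q)
  dim_le q := (g.dim_le _).trans (h.dim_le q)
  map_γ k q hq := by
    rw [h.map_γ k q hq]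
    have h1 := h.dim_le q
    have h2 := g.dim_le (h.toFun q)
    by_cases hd : (h.toFun q).dim = k + 1
    · exact g.map_γ k _ hd
    · rw [Face.γIter_of_le _ (by omega), Face.γIter_of_le _ (by omega)]
  map_δ_zero k q hq hd := by
    have h1 := h.dim_le q
    have h2 := g.dim_le (h.toFun q)
    exact bijOn_comp h g (h.map_δ_zero k q hq (by omega))
      (g.map_δ_zero k _ (by omega) (by omega))
  map_δ_one k q hq hd := by
    have h1 := h.dim_le q
    have h2 := g.dim_le (h.toFun q)
    by_cases hq' : (h.toFun q).dim = q.dim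
    · exact bijOn_comp h g (h.map_δ_zero k q hq hq') (g.map_δ_one k _ (by omega) (by omega))
    · refine bijOn_comp h g (h.map_δ_one k q hq (by omega)) ?_
      have hk : h.toFun q ∉ faceKer g.toFun := by
        simp only [faceKer, Set.mem_ofPred_eq]; omega
      rw [sdiff_eq_left.mpr (Set.disjoint_singleton_left.mpr hk)]
      exact Set.bijOn_singleton.mpr rfl
  map_δ_two k q hq hd x hx := by
    by_contra hxk
    rw [faceKer_comp] at hxk
    have h1 := h.dim_le q
    have h2 := g.dim_le (h.toFun q)
    by_cases hq0 : (h.toFun q).dim = q.dim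
    · have := (h.map_δ_zero k q hq hq0).mapsTo ⟨hx, hxk.1⟩
      by_cases hq2 : (g.toFun (h.toFun q)).dim + 1 < (h.toFun q).dim
      · exact hxk.2 (g.map_δ_two k _ (by omega) hq2 this)
      · omega
    · by_cases hq1 : (h.toFun q).dim + 1 = q.dim
      · have hx' : h.toFun x = h.toFun q := (h.map_δ_one k q hq hq1).mapsTo ⟨hx, hxk.1⟩
        refine hxk.2 ?_
        rw [hx']
        simp only [faceKer, Set.mem_ofPred_eq]
        omega
      · exact hxk.1 (h.map_δ_two k q hq (by omega) hx)

end Contraction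

/-- A positive opetope: a positive opetopic cardinal all of whose sizes are at most `1`. -/
structure POpe where
  hg : PosHypergraph.{u}
  isCardinal : hg.IsOpetopicCardinal
  size_le_one : ∀ l, hg.size l ≤ 1

/-- The category `pOpe_ι` of positive opetopes and contraction morphisms. -/
instance : Category POpe.{u} where
  Hom Q P := Contraction Q.hg P.hg
  id Q := Contraction.id Q.hg
  comp h g := Contraction.comp h g

/-! ## Strict `ω`-categories -/

/-- The operations of an `ω`-category: `dom h x` and `cod h x` (`h : k < n`) are the
`k`-dimensional domain and codomain of the `n`-cell `x`, `idt x` is the identity `(n+1)`-cell on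
`x`, and `cmp h x y _` is the composite of `n`-cells `x` and `y` along a `k`-cell with
`dom h x = cod h y` (first `y`, then `x`). -/
structure OmegaData where
  cell : ℕ → Type u
  dom : ∀ {k n : ℕ}, k < n → cell n → cell k
  cod : ∀ {k n : ℕ}, k < n → cell n → cell k
  idt : ∀ {n : ℕ}, cell n → cell (n + 1)
  cmp : ∀ {k n : ℕ} (h : k < n) (x y : cell n), dom h x = cod h y → cell n

/-- The iterated identity `n`-cell on a `k`-cell, for `k ≤ n`. -/
def OmegaData.idIter (C : OmegaData.{u}) {k n : ℕ} (h : k ≤ n) (x : C.cell k) : C.cell n :=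
  Nat.leRec (motive := fun n _ => C.cell n) x (fun _ _ y => C.idt y) h

/-- Strict `ω`-categories. In the laws that mention several composites, the hypotheses say that
all of these composites are defined. -/
structure OmegaCat extends OmegaData.{u} where
  dom_dom : ∀ {j k n : ℕ} (h : j < k) (h' : k < n) (x : cell n),
    dom h (dom h' x) = dom (h.trans h') x
  dom_cod : ∀ {j k n : ℕ} (h : j < k) (h' : k < n) (x : cell n),
    dom h (cod h' x) = dom (h.trans h') x
  cod_dom : ∀ {j k n : ℕ} (h : j < k) (h' : k < n) (x : cell n),
    cod h (dom h' x) = cod (h.trans h') x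
  cod_cod : ∀ {j k n : ℕ} (h : j < k) (h' : k < n) (x : cell n),
    cod h (cod h' x) = cod (h.trans h') x
  dom_idt : ∀ {n : ℕ} (x : cell n), dom (Nat.lt_succ_self n) (idt x) = x
  cod_idt : ∀ {n : ℕ} (x : cell n), cod (Nat.lt_succ_self n) (idt x) = x
  dom_cmp_self : ∀ {k n : ℕ} (h : k < n) (x y : cell n) (e : dom h x = cod h y),
    dom h (cmp h x y e) = dom h y
  cod_cmp_self : ∀ {k n : ℕ} (h : k < n) (x y : cell n) (e : dom h x = cod h y),
    cod h (cmp h x y e) = cod h x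
  dom_cmp : ∀ {k l n : ℕ} (h : k < l) (h' : l < n) (x y : cell n)
    (e : dom (h.trans h') x = cod (h.trans h') y) (e' : dom h (dom h' x) = cod h (dom h' y)),
    dom h' (cmp (h.trans h') x y e) = cmp h (dom h' x) (dom h' y) e'
  cod_cmp : ∀ {k l n : ℕ} (h : k < l) (h' : l < n) (x y : cell n)
    (e : dom (h.trans h') x = cod (h.trans h') y) (e' : dom h (cod h' x) = cod h (cod h' y)),
    cod h' (cmp (h.trans h') x y e) = cmp h (cod h' x) (cod h' y) e'
  cmp_idt : ∀ {k n : ℕ} (h : k < n) (x : cell n)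
    (e : dom h x = cod h (toOmegaData.idIter h.le (dom h x))),
    cmp h x (toOmegaData.idIter h.le (dom h x)) e = x
  idt_cmp : ∀ {k n : ℕ} (h : k < n) (x : cell n)
    (e : dom h (toOmegaData.idIter h.le (cod h x)) = cod h x),
    cmp h (toOmegaData.idIter h.le (cod h x)) x e = x
  cmp_assoc : ∀ {k n : ℕ} (h : k < n) (x y z : cell n) (e₁ : dom h x = cod h y)
    (e₂ : dom h y = cod h z) (e₃ : dom h (cmp h x y e₁) = cod h z)
    (e₄ : dom h x = cod h (cmp h y z e₂)),
    cmp h (cmp h x y e₁) z e₃ = cmp h x (cmp h y z e₂) e₄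
  interchange : ∀ {j k n : ℕ} (h : j < k) (h' : k < n) (x y z w : cell n)
    (e₁ : dom h' x = cod h' y) (e₂ : dom h' z = cod h' w)
    (e₃ : dom (h.trans h') (cmp h' x y e₁) = cod (h.trans h') (cmp h' z w e₂))
    (e₄ : dom (h.trans h') x = cod (h.trans h') z) (e₅ : dom (h.trans h') y = cod (h.trans h') w)
    (e₆ : dom h' (cmp (h.trans h') x z e₄) = cod h' (cmp (h.trans h') y w e₅)),
    cmp (h.trans h') (cmp h' x y e₁) (cmp h' z w e₂) e₃ =
      cmp h' (cmp (h.trans h') x z e₄) (cmp (h.trans h') y w e₅) e₆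
  idt_of_cmp : ∀ {k n : ℕ} (h : k < n) (x y : cell n) (e : dom h x = cod h y)
    (e' : dom (h.trans (Nat.lt_succ_self n)) (idt x) = cod (h.trans (Nat.lt_succ_self n)) (idt y)),
    idt (cmp h x y e) = cmp (h.trans (Nat.lt_succ_self n)) (idt x) (idt y) e'

/-- Strict `ω`-functors. -/
@[ext]
structure OmegaFunctor (C D : OmegaCat.{u}) where
  map : ∀ n : ℕ, C.cell n → D.cell n
  map_dom : ∀ {k n : ℕ} (h : k < n) (x : C.cell n), map k (C.dom h x) = D.dom h (map n x)
  map_cod : ∀ {k n : ℕ} (h : k < n) (x : C.cell n), map k (C.cod h x) = D.cod h (map n x)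
  map_idt : ∀ {n : ℕ} (x : C.cell n), map (n + 1) (C.idt x) = D.idt (map n x)
  map_cmp : ∀ {k n : ℕ} (h : k < n) (x y : C.cell n) (e : C.dom h x = C.cod h y)
    (e' : D.dom h (map n x) = D.cod h (map n y)),
    map n (C.cmp h x y e) = D.cmp h (map n x) (map n y) e'

/-- The category of strict `ω`-categories and strict `ω`-functors. -/
instance : Category OmegaCat.{u} where
  Hom C D := OmegaFunctor C D
  id C :=
    { map := fun _ x => x
      map_dom := fun _ _ => rfl
      map_cod := fun _ _ => rfl
      map_idt := fun _ => rfl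
      map_cmp := fun _ _ _ _ _ => rfl }
  comp F G :=
    { map := fun n x => G.map n (F.map n x)
      map_dom := fun h x => by rw [F.map_dom, G.map_dom]
      map_cod := fun h x => by rw [F.map_cod, G.map_cod]
      map_idt := fun x => by rw [F.map_idt, G.map_idt]
      map_cmp := fun h x y e e' => by
        rw [F.map_cmp h x y e (by rw [← F.map_dom, ← F.map_cod, e]), G.map_cmp] }

/-! ## Polygraphs -/

/-- A functor between the truncations of two `ω`-categories to dimensions at most `m`, that is,
an `m`-functor. -/
structure TruncFunctor (m : ℕ) (C D : OmegaCat.{u}) where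
  map : ∀ n : ℕ, n ≤ m → C.cell n → D.cell n
  map_dom : ∀ {k n : ℕ} (h : k < n) (hn : n ≤ m) (x : C.cell n),
    map k (h.le.trans hn) (C.dom h x) = D.dom h (map n hn x)
  map_cod : ∀ {k n : ℕ} (h : k < n) (hn : n ≤ m) (x : C.cell n),
    map k (h.le.trans hn) (C.cod h x) = D.cod h (map n hn x)
  map_idt : ∀ {n : ℕ} (hn : n + 1 ≤ m) (x : C.cell n),
    map (n + 1) hn (C.idt x) = D.idt (map n (n.le_succ.trans hn) x)
  map_cmp : ∀ {k n : ℕ} (h : k < n) (hn : n ≤ m) (x y : C.cell n) (e : C.dom h x = C.cod h y)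
    (e' : D.dom h (map n hn x) = D.cod h (map n hn y)),
    map n hn (C.cmp h x y e) = D.cmp h (map n hn x) (map n hn y) e'

/-- `C` is a polygraph with sets of generators `E n`: every `0`-cell is a generator, and for each
`m` the `(m+1)`-truncation of `C` is freely generated over its `m`-truncation by the cells in
`E (m+1)`. -/
structure IsPolygraph (C : OmegaCat.{u}) (E : ∀ n, Set (C.cell n)) : Prop where
  zero : E 0 = Set.univ
  free : ∀ (m : ℕ) (D : OmegaCat.{u}) (F : TruncFunctor m C D)
    (φ : E (m + 1) → D.cell (m + 1)),
    (∀ x, D.dom (Nat.lt_succ_self m) (φ x) = F.map m le_rfl (C.dom (Nat.lt_succ_self m) x.1)) →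
    (∀ x, D.cod (Nat.lt_succ_self m) (φ x) = F.map m le_rfl (C.cod (Nat.lt_succ_self m) x.1)) →
    ∃! G : TruncFunctor (m + 1) C D,
      (∀ (n : ℕ) (hn : n ≤ m) (x : C.cell n), G.map n (hn.trans m.le_succ) x = F.map n hn x) ∧
      ∀ x : E (m + 1), G.map (m + 1) le_rfl x.1 = φ x

/-- A polygraph is positive-to-one if codomains of generators are generators and domains of
generators are not identities. -/
structure IsPositiveToOnePolygraph (C : OmegaCat.{u}) (E : ∀ n, Set (C.cell n)) : Prop
    extends IsPolygraph C E where
  cod_mem : ∀ (n : ℕ) (x : C.cell (n + 1)), x ∈ E (n + 1) → C.cod (Nat.lt_succ_self n) x ∈ E n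
  dom_ne_idt : ∀ (n : ℕ) (x : C.cell (n + 2)), x ∈ E (n + 2) →
    ∀ y : C.cell n, C.dom (Nat.lt_succ_self (n + 1)) x ≠ C.idt y

/-- An `ω`-functor sends generators to generators or to (iterated) identities on generators of
smaller dimension; the case `m = n` is that of a generator. -/
def SendsGenerators {C D : OmegaCat.{u}} (E : ∀ n, Set (C.cell n)) (E' : ∀ n, Set (D.cell n))
    (f : C ⟶ D) : Prop :=
  ∀ (n : ℕ) (x : C.cell n), x ∈ E n →
    ∃ (m : ℕ) (h : m ≤ n) (y : D.cell m), y ∈ E' m ∧ OmegaFunctor.map f n x = D.idIter h y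

/-! ## The `ω`-category of a positive opetope -/

/-- The `n`-cells of `T^*`: sub-opetopic cardinals of `T` of dimension at most `n`. -/
def StarCell (T : POpe.{u}) (n : ℕ) : Type u :=
  {A : T.hg.Sub // A.toHypergraph.IsOpetopicCardinal ∧ ∀ k, n < k → A.carrier k = ∅}

/-- The set of `k`-faces of a cell of `T^*`. -/
def StarCell.faces {T : POpe.{u}} {n : ℕ} (A : StarCell T n) (k : ℕ) : Set (T.hg.face k) :=
  A.1.carrier k

/-- `F` is the functor `(-)^*`: through the bijections `e`, the `n`-cells of `F.obj T` are the
sub-opetopic cardinals of `T` of dimension at most `n`, domains and codomains are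
given by `d^{(k)}` and `c^{(k)}`, identities do not change the underlying cardinal, composites are
unions, and contractions act by taking set-theoretic images. -/
structure IsStar (F : POpe.{u} ⥤ OmegaCat.{u})
    (e : ∀ (T : POpe.{u}) (n : ℕ), (F.obj T).cell n ≃ StarCell T n) : Prop where
  dom_faces : ∀ (T : POpe.{u}) {k n : ℕ} (h : k < n) (x : (F.obj T).cell n) (l : ℕ),
    (e T k ((F.obj T).dom h x)).faces l = (e T n x).1.domFaces k l
  cod_faces : ∀ (T : POpe.{u}) {k n : ℕ} (h : k < n) (x : (F.obj T).cell n) (l : ℕ),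
    (e T k ((F.obj T).cod h x)).faces l = (e T n x).1.codFaces k l
  idt_faces : ∀ (T : POpe.{u}) {n : ℕ} (x : (F.obj T).cell n) (l : ℕ),
    (e T (n + 1) ((F.obj T).idt x)).faces l = (e T n x).faces l
  cmp_faces : ∀ (T : POpe.{u}) {k n : ℕ} (h : k < n) (x y : (F.obj T).cell n)
    (hxy : (F.obj T).dom h x = (F.obj T).cod h y) (l : ℕ),
    (e T n ((F.obj T).cmp h x y hxy)).faces l = (e T n x).faces l ∪ (e T n y).faces l
  map_faces : ∀ {Q P : POpe.{u}} (h : Q ⟶ P) (n : ℕ) (x : (F.obj Q).cell n) (l : ℕ),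
    (e P n (OmegaFunctor.map (F.map h) n x)).faces l =
      {p | ∃ (j : ℕ) (q : Q.hg.face j), q ∈ (e Q n x).faces j ∧
        Contraction.toFun h ⟨j, q⟩ = ⟨l, p⟩}

/-- The generating `n`-cells of `T^*`: the cells `(T[x], n)` for `n`-faces `x` of `T`. -/
def starGenerators {F : POpe.{u} ⥤ OmegaCat.{u}}
    (e : ∀ (T : POpe.{u}) (n : ℕ), (F.obj T).cell n ≃ StarCell T n) (T : POpe.{u}) (n : ℕ) :
    Set ((F.obj T).cell n) :=
  {c | ∃ x : T.hg.face n, (e T n c).1 = gen x}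

end PositiveOpetopes

open PositiveOpetopes

open PositiveOpetopes

namespace PositiveOpetopes
open PosHypergraph Relation

/-! ## Families of faces and the relative upper order -/

/-! The proof studies sub-opetopic cardinals through their minimal faces for the upper order. A
family of faces closed under `γ` and `δ` is an opetopic cardinal exactly when it is a cell
(`Fam.IsCell`): it is nonempty, it has at most one minimal `0`-face, and distinct minimal faces of
positive dimension share neither their codomain nor a face of their domains. The pencil conditions
then follow by descending induction on dimension (`Fam.IsCell.pencil`), and the remaining axioms are
inherited from the ambient cardinal.

Composition is governed by cuts. A cut at level `k` splits a cell into a lower and an upper part,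
which are again cells (`Fam.IsCell.low`, `Fam.IsCell.high`); iterated domains and codomains are the
two extreme cases. Conversely, if `A` and `B` are composable, then they meet only in their common
boundary, their union is a cell, and `B` is a cut of it whose parts are `B` and `A`
(`isCut_of_composable`, `low_of_composable`, `high_of_composable`). This rests on
`Fam.IsCell.eq_of_le`: faces of a cell in its top dimension are incomparable even in the ambient
order. Composites become unions, so associativity and interchange are identities between sets.

For freeness, a cell with a face in its top dimension is either generated by that face or has a
nontrivial cut (`eq_genFam_or_exists_cut`). Hence every cell is an expression in generators and
identities, and a candidate extension assigns it a value. Values are unique by induction on the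
number of faces. Decompositions at different levels are compared by interchange
(`Val.confluence_of_lt`). At one level they are compared through the union of the two cuts by
associativity, or through a cut at a lower level if one exists (`Val.confluence`).

Images under a contraction are computed first on generators, where the conditions on `γ` and `δ`
identify the image of `T[x]` with the cell generated by the image of `x`, and then on composites
(`goodImage_aux`). This gives the functor and its faithfulness. For fullness, the non-collapsed top
faces of a cell correspond bijectively to the top faces of its value (`bijOn_of_map`); applied to
the domain of a generator, this is the condition on `δ`. Isomorphisms are covered because generators
are exactly the indecomposable cells (`isIndecomposable_iff`). -/

/-- A family of sets of faces. -/
abbrev Fam (T : PosHypergraph.{u}) := ∀ k, Set (T.face k)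

namespace Fam

variable {T : PosHypergraph.{u}}

/-- One step of the upper order, through a face of `A`. -/
def Step (A : Fam T) {k : ℕ} (a b : T.face k) : Prop := ∃ α ∈ A (k + 1), a ∈ T.δ α ∧ T.γ α = b

/-- The strict upper order computed in `A`. -/
def Lt (A : Fam T) {k : ℕ} (a b : T.face k) : Prop := TransGen A.Step a b

/-- The reflexive upper order computed in `A`. -/
def Le (A : Fam T) {k : ℕ} (a b : T.face k) : Prop := ReflTransGen A.Step a b

/-- Closure under `γ` and `δ`. -/
structure Closed (A : Fam T) : Prop where
  γ_mem : ∀ {k : ℕ} {a : T.face (k + 1)}, a ∈ A (k + 1) → T.γ a ∈ A k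
  δ_mem : ∀ {k : ℕ} {a : T.face (k + 1)} {x : T.face k}, a ∈ A (k + 1) → x ∈ T.δ a → x ∈ A k

/-- The faces of `A` that are not codomains of faces of `A`. -/
def Bot (A : Fam T) {k : ℕ} (a : T.face k) : Prop := a ∈ A k ∧ ∀ α ∈ A (k + 1), T.γ α ≠ a

/-- The faces of `A` that are not in the domain of a face of `A`. -/
def Top (A : Fam T) {k : ℕ} (a : T.face k) : Prop := a ∈ A k ∧ ∀ α ∈ A (k + 1), a ∉ T.δ α

theorem Lt.le {A : Fam T} {k : ℕ} {a b : T.face k} (h : A.Lt a b) : A.Le a b := h.to_reflTransGen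

theorem Le.trans {A : Fam T} {k : ℕ} {a b c : T.face k} (h : A.Le a b) (h' : A.Le b c) :
    A.Le a c := ReflTransGen.trans h h'

theorem Le.trans_lt {A : Fam T} {k : ℕ} {a b c : T.face k} (h : A.Le a b) (h' : A.Lt b c) :
    A.Lt a c := TransGen.trans_right h h'

theorem Lt.trans_le {A : Fam T} {k : ℕ} {a b c : T.face k} (h : A.Lt a b) (h' : A.Le b c) :
    A.Lt a c := TransGen.trans_left h h'

theorem Le.eq_or_lt {A : Fam T} {k : ℕ} {a b : T.face k} (h : A.Le a b) : a = b ∨ A.Lt a b := by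
  rcases reflTransGen_iff_eq_or_transGen.1 h with h | h
  · exact Or.inl h.symm
  · exact Or.inr h

theorem lt_γ {A : Fam T} {k : ℕ} {α : T.face (k + 1)} (hα : α ∈ A (k + 1)) {a : T.face k}
    (h : a ∈ T.δ α) : A.Lt a (T.γ α) := TransGen.single ⟨α, hα, h, rfl⟩

theorem Step.mono {A B : Fam T} {k : ℕ} (h : A (k + 1) ⊆ B (k + 1)) {a b : T.face k}
    (hab : A.Step a b) : B.Step a b := by
  obtain ⟨α, hα, h1, h2⟩ := hab
  exact ⟨α, h hα, h1, h2⟩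

theorem Le.mono {A B : Fam T} {k : ℕ} (h : A (k + 1) ⊆ B (k + 1)) {a b : T.face k}
    (hab : A.Le a b) : B.Le a b := ReflTransGen.mono (fun _ _ => Step.mono h) _ _ hab

theorem Lt.up {A : Fam T} {k : ℕ} {a b : T.face k} (hab : A.Lt a b) : T.upLt a b :=
  TransGen.mono (fun _ _ ⟨α, _, h⟩ => ⟨α, h⟩) _ _ hab

theorem Le.eq_or_up {A : Fam T} {k : ℕ} {a b : T.face k} (hab : A.Le a b) :
    a = b ∨ T.upLt a b := hab.eq_or_lt.imp_right Lt.up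

theorem Top.not_lt {A : Fam T} {k : ℕ} {a b : T.face k} (ha : A.Top a) : ¬ A.Lt a b := by
  intro h
  obtain ⟨c, ⟨α, hα, h, _⟩, _⟩ := (TransGen.head'_iff.1 h)
  exact ha.2 α hα h

theorem Bot.not_lt {A : Fam T} {k : ℕ} {a b : T.face k} (ha : A.Bot a) : ¬ A.Lt b a := by
  intro h
  obtain ⟨c, _, ⟨α, hα, _, h⟩⟩ := (TransGen.tail'_iff.1 h)
  exact ha.2 α hα h

theorem Top.eq_of_le {A : Fam T} {k : ℕ} {a b : T.face k} (ha : A.Top a) (h : A.Le a b) : a = b :=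
  h.eq_or_lt.resolve_right ha.not_lt

end Fam

/-! ## Consequences of the axioms in an opetopic cardinal -/

namespace PosHypergraph.IsOpetopicCardinal

variable {T : PosHypergraph.{u}} (hT : T.IsOpetopicCardinal)
include hT

/-- Strict orders on finite sets are well-founded in both directions; this and `up_wf'` drive the
inductions towards minimal and maximal faces. -/
theorem up_wf (k : ℕ) : WellFounded (T.upLt (k := k)) := by
  have := T.finite_face k
  have : IsTrans (T.face k) T.upLt := ⟨fun _ _ _ => TransGen.trans⟩
  have : Std.Irrefl (T.upLt (k := k)) := ⟨hT.strict k⟩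
  exact Finite.wellFounded_of_trans_of_irrefl _

theorem up_wf' (k : ℕ) : WellFounded (fun a b : T.face k => T.upLt b a) := by
  have := T.finite_face k
  have : IsTrans (T.face k) (fun a b => T.upLt b a) := ⟨fun _ _ _ h h' => TransGen.trans h' h⟩
  have : Std.Irrefl (fun a b : T.face k => T.upLt b a) := ⟨hT.strict k⟩
  exact Finite.wellFounded_of_trans_of_irrefl _

theorem not_lt_of_le {A B : Fam T} {k : ℕ} {a b : T.face k} (h : A.Le a b) (h' : B.Lt b a) :
    False := by
  rcases h.eq_or_up with rfl | h
  · exact hT.strict _ _ h'.up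
  · exact hT.strict _ _ (TransGen.trans h h'.up)

theorem le_antisymm {A B : Fam T} {k : ℕ} {a b : T.face k} (h : A.Le a b) (h' : B.Le b a) :
    a = b := by
  rcases h'.eq_or_lt with h' | h'
  · exact h'.symm
  · exact (hT.not_lt_of_le h h').elim

theorem γγ_mem {k : ℕ} (α : T.face (k + 2)) : ∃ a ∈ T.δ α, T.γ a = T.γ (T.γ α) := by
  have : T.γ (T.γ α) ∈ T.γδ α \ T.δδ α := by rw [← hT.globular_γ k α]; rfl
  exact this.1

theorem γγ_notMem {k : ℕ} (α : T.face (k + 2)) {a : T.face (k + 1)} (ha : a ∈ T.δ α) :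
    T.γ (T.γ α) ∉ T.δ a := by
  have : T.γ (T.γ α) ∈ T.γδ α \ T.δδ α := by rw [← hT.globular_γ k α]; rfl
  exact fun h => this.2 ⟨a, ha, h⟩

theorem γ_eq_or {k : ℕ} {α : T.face (k + 2)} {a : T.face (k + 1)} (ha : a ∈ T.δ α) :
    T.γ a = T.γ (T.γ α) ∨ T.γ a ∈ T.ι α := by
  by_cases h : T.γ a ∈ T.δδ α
  · exact Or.inr ⟨⟨a, ha, rfl⟩, h⟩
  · left
    have : T.γ a ∈ T.γδ α \ T.δδ α := ⟨⟨a, ha, rfl⟩, h⟩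
    rwa [← hT.globular_γ k α] at this

theorem mem_δ_or {k : ℕ} {α : T.face (k + 2)} {a : T.face (k + 1)} (ha : a ∈ T.δ α) {x : T.face k}
    (hx : x ∈ T.δ a) : x ∈ T.δ (T.γ α) ∨ x ∈ T.ι α := by
  by_cases h : x ∈ T.γδ α
  · exact Or.inr ⟨h, ⟨a, ha, hx⟩⟩
  · left
    rw [hT.globular_δ k α]
    exact ⟨⟨a, ha, hx⟩, h⟩

theorem mem_δγ {k : ℕ} {α : T.face (k + 2)} {x : T.face k} (hx : x ∈ T.δ (T.γ α)) :
    (∃ a ∈ T.δ α, x ∈ T.δ a) ∧ ∀ a ∈ T.δ α, T.γ a ≠ x := by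
  rw [hT.globular_δ k α] at hx
  exact ⟨hx.1, fun a ha h => hx.2 ⟨a, ha, h⟩⟩

/-- Disjointness in the form used below: a single lower step already excludes upper comparability.
-/
theorem low_irrefl {k : ℕ} (a b : T.face (k + 1)) (h : T.upPerp a b) : ¬ T.γ a ∈ T.δ b :=
  fun h' => hT.disjoint k a b ⟨Or.inl (TransGen.single h'), h⟩

theorem γ_notMem_δ {k : ℕ} (a : T.face (k + 1)) : T.γ a ∉ T.δ a := fun h =>
  hT.strict _ _ (TransGen.single ⟨a, h, rfl⟩)

/-- Elements of the domain of a face are incomparable. -/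
theorem not_upLt_of_mem_δ {k : ℕ} {α : T.face (k + 1)} {a b : T.face k} (ha : a ∈ T.δ α)
    (hb : b ∈ T.δ α) : ¬ T.upLt a b := by
  intro h
  obtain ⟨c, ⟨β, h1, h2⟩, h3⟩ := TransGen.head'_iff.1 h
  -- An upper path from `γ β` to a face of `δ α` is also a lower path from `β` to `α`. But `β` and
  -- `α` share `a` in their domains, so they are equal or comparable for `<^+`, which strictness and
  -- disjointness forbid.
  have key : ∀ {c d : T.face k}, ReflTransGen (fun a b => ∃ α : T.face (k + 1), a ∈ T.δ α ∧
      T.γ α = b) c d → d ∈ T.δ α → ∀ β, T.γ β = c → T.lowLt β α := by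
    intro c d hcd hd
    induction hcd using ReflTransGen.head_induction_on with
    | refl => rintro β rfl; exact TransGen.single hd
    | head h _ ih =>
      rintro β rfl
      obtain ⟨β', h1, h2⟩ := h
      exact TransGen.head h1 (ih β' h2)
  have hl := key h3 hb β h2
  by_cases e : α = β
  · subst e
    have : T.upLt b b := by
      have hb' : T.upLt b (T.γ α) := TransGen.single ⟨α, hb, rfl⟩
      rw [h2] at hb'
      exact TransGen.trans_left hb' h3
    exact hT.strict _ _ this
  · exact hT.disjoint _ β α ⟨Or.inl hl, (hT.pencil_δ k a α β ha h1 e).symm⟩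

theorem eq_of_mem_δ_of_γ {k : ℕ} {α : T.face (k + 2)} {a b : T.face (k + 1)} (ha : a ∈ T.δ α)
    (hb : b ∈ T.δ α) (h : T.γ a = T.γ b) : a = b := by
  by_contra hne
  rcases hT.pencil_γ k _ a b h rfl hne with h | h
  · exact hT.not_upLt_of_mem_δ ha hb h
  · exact hT.not_upLt_of_mem_δ hb ha h

theorem eq_of_mem_δ_of_δ {k : ℕ} {α : T.face (k + 2)} {a b : T.face (k + 1)} (ha : a ∈ T.δ α)
    (hb : b ∈ T.δ α) {x : T.face k} (h : x ∈ T.δ a) (h' : x ∈ T.δ b) : a = b := by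
  by_contra hne
  rcases hT.pencil_δ k _ a b h h' hne with h | h
  · exact hT.not_upLt_of_mem_δ ha hb h
  · exact hT.not_upLt_of_mem_δ hb ha h

/-- Every face in the domain of a face of `δ α` lies above a face in the domain of `γ α`. -/
theorem exists_le_of_mem_δ {A : Fam T} (hA : A.Closed) {k : ℕ} {α : T.face (k + 2)}
    (hα : α ∈ A (k + 2)) : ∀ (x : T.face k) (a : T.face (k + 1)), a ∈ T.δ α → x ∈ T.δ a →
      ∃ y ∈ T.δ (T.γ α), A.Le y x := by
  intro x
  induction x using (hT.up_wf k).induction with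
  | _ x ih =>
    intro a ha hx
    rcases hT.mem_δ_or ha hx with h | ⟨⟨b, hb, rfl⟩, _⟩
    · exact ⟨x, h, ReflTransGen.refl⟩
    · obtain ⟨z, hz⟩ := T.δ_nonempty b
      have hlt := Fam.lt_γ (hA.δ_mem hα hb) hz
      obtain ⟨y, hy, hyz⟩ := ih z hlt.up b hb hz
      exact ⟨y, hy, hyz.trans hlt.le⟩

/-- An internal codomain `γ a` lies in the domain of some `b ∈ δ α`, so one climbs to `γ b`; by
finiteness the climb stops, and `γ (γ α)` is the only codomain that is not internal. -/
theorem γ_le_γγ {A : Fam T} (hA : A.Closed) {k : ℕ} {α : T.face (k + 2)}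
    (hα : α ∈ A (k + 2)) : ∀ (x : T.face k) (a : T.face (k + 1)), a ∈ T.δ α → T.γ a = x →
      A.Le x (T.γ (T.γ α)) := by
  intro x
  induction x using (hT.up_wf' k).induction with
  | _ x ih =>
    rintro a ha rfl
    rcases hT.γ_eq_or ha with h | ⟨_, b, hb, h⟩
    · rw [h]; exact ReflTransGen.refl
    · have hlt := Fam.lt_γ (hA.δ_mem hα hb) h
      exact hlt.le.trans (ih _ hlt.up b hb rfl)

theorem γ_le {A : Fam T} (hA : A.Closed) {k : ℕ} {a b : T.face (k + 1)} (h : A.Le a b) :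
    A.Le (T.γ a) (T.γ b) := by
  induction h with
  | refl => exact ReflTransGen.refl
  | tail _ h ih =>
    obtain ⟨α, hα, h, rfl⟩ := h
    exact ih.trans (hT.γ_le_γγ hA hα _ _ h rfl)

theorem exists_δ_le {A : Fam T} (hA : A.Closed) {k : ℕ} {a b : T.face (k + 1)} (h : A.Le a b) :
    ∀ x ∈ T.δ a, ∃ y ∈ T.δ b, A.Le y x := by
  induction h with
  | refl => exact fun x hx => ⟨x, hx, ReflTransGen.refl⟩
  | tail _ h ih =>
    obtain ⟨α, hα, h, rfl⟩ := h
    intro x hx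
    obtain ⟨y, hy, hyx⟩ := ih x hx
    obtain ⟨z, hz, hzy⟩ := hT.exists_le_of_mem_δ hA hα y _ h hy
    exact ⟨z, hz, hzy.trans hyx⟩

/-- Along the upper order, the codomain stays the same or becomes internal. -/
theorem γ_eq_or_ι {A : Fam T} {k : ℕ} {a b : T.face (k + 1)} (h : A.Le a b) :
    T.γ a = T.γ b ∨ ∃ α ∈ A (k + 2), A.Le (T.γ α) b ∧ T.γ a ∈ T.ι α := by
  induction h with
  | refl => exact Or.inl rfl
  | tail _ h ih =>
    obtain ⟨α, hα, h, rfl⟩ := h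
    rcases ih with e | ⟨β, hβ, h1, h2⟩
    · rcases hT.γ_eq_or h with h | h
      · exact Or.inl (e.trans h)
      · exact Or.inr ⟨α, hα, ReflTransGen.refl, e ▸ h⟩
    · exact Or.inr ⟨β, hβ, h1.trans (Fam.lt_γ hα h).le, h2⟩

theorem δ_mem_or_ι {A : Fam T} {k : ℕ} {a b : T.face (k + 1)} (h : A.Le a b) {x : T.face k}
    (hx : x ∈ T.δ a) : x ∈ T.δ b ∨ ∃ α ∈ A (k + 2), A.Le (T.γ α) b ∧ x ∈ T.ι α := by
  induction h with
  | refl => exact Or.inl hx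
  | tail _ h ih =>
    obtain ⟨α, hα, h, rfl⟩ := h
    rcases ih with e | ⟨β, hβ, h1, h2⟩
    · rcases hT.mem_δ_or h e with h | h
      · exact Or.inl h
      · exact Or.inr ⟨α, hα, ReflTransGen.refl, h⟩
    · exact Or.inr ⟨β, hβ, h1.trans (Fam.lt_γ hα h).le, h2⟩

/-- If `x = γ z` with `z ∈ δ a` is not internal to `a`, then `x = γ (γ a)`, and `γ a` takes over the
role of `z` in another face of `δ α`. The climb cannot reach `γ (γ α)`, since `x` would then lie in
no domain of a face of `δ (γ α)`. With `ι_subset_ι_γ`, this makes `ι (γ α)` the union of the sets `ι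
a` over `a ∈ δ α`. -/
theorem ι_γ_subset {k : ℕ} (α : T.face (k + 3)) {x : T.face k} (hx : x ∈ T.ι (T.γ α)) :
    ∃ a ∈ T.δ α, x ∈ T.ι a := by
  obtain ⟨⟨y', hy', hxy'⟩, y, hy, hxy⟩ := hx
  obtain ⟨⟨a, ha, hya⟩, -⟩ := hT.mem_δγ hy'
  have key : ∀ (z : T.face (k + 1)) (a : T.face (k + 2)), a ∈ T.δ α → z ∈ T.δ a → T.γ z = x →
      ∃ a ∈ T.δ α, x ∈ T.ι a := by
    intro z
    induction z using (hT.up_wf' _).induction with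
    | _ z ih =>
      rintro a ha hz rfl
      rcases hT.γ_eq_or hz with h | h
      · rcases hT.γ_eq_or ha with h' | ⟨-, b, hb, h'⟩
        · exfalso
          rw [h'] at h
          rw [h] at hxy
          exact hT.γγ_notMem (T.γ α) hy hxy
        · exact ih (T.γ a) (TransGen.single ⟨a, hz, rfl⟩) b hb h' h.symm
      · exact ⟨a, ha, h⟩
  exact key y' a ha hya hxy'

/-- A witness `z` outside `δ (γ α)` is some `γ b` with `b ∈ δ α`. Globularity of `b` supplies a
lower witness in `δ b` with the same codomain, or with the same face in its domain, and the descent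
ends in `δ (γ α)`. -/
theorem ι_subset_ι_γ {k : ℕ} (α : T.face (k + 3)) {a : T.face (k + 2)} (ha : a ∈ T.δ α)
    {x : T.face k} (hx : x ∈ T.ι a) : x ∈ T.ι (T.γ α) := by
  obtain ⟨⟨y', hy', hxy'⟩, y, hy, hxy⟩ := hx
  constructor
  · have key : ∀ (z : T.face (k + 1)) (a : T.face (k + 2)), a ∈ T.δ α → z ∈ T.δ a → T.γ z = x →
        ∃ z ∈ T.δ (T.γ α), T.γ z = x := by
      intro z
      induction z using (hT.up_wf _).induction with
      | _ z ih =>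
        rintro a ha hz rfl
        rcases hT.mem_δ_or ha hz with h | ⟨⟨b, hb, rfl⟩, -⟩
        · exact ⟨z, h, rfl⟩
        · obtain ⟨w, hw, e⟩ := hT.γγ_mem b
          exact ih w (TransGen.single ⟨b, hw, rfl⟩) b hb hw e
    exact key y' a ha hy' hxy'
  · have key : ∀ (z : T.face (k + 1)) (a : T.face (k + 2)), a ∈ T.δ α → z ∈ T.δ a → x ∈ T.δ z →
        ∃ z ∈ T.δ (T.γ α), x ∈ T.δ z := by
      intro z
      induction z using (hT.up_wf _).induction with
      | _ z ih =>
        intro a ha hz hxz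
        rcases hT.mem_δ_or ha hz with h | ⟨⟨b, hb, rfl⟩, -⟩
        · exact ⟨z, h, hxz⟩
        · obtain ⟨⟨w, hw, e⟩, -⟩ := hT.mem_δγ hxz
          exact ih w (TransGen.single ⟨b, hw, rfl⟩) b hb hw e
    exact key y a ha hy hxy

end PosHypergraph.IsOpetopicCardinal


/-! ## Sub-opetopic cardinals in terms of minimal faces -/

namespace Fam

variable {T : PosHypergraph.{u}}

/-- Closed families whose minimal faces are well formed. -/
structure IsCell (A : Fam T) : Prop extends Closed A where
  nonempty : (A 0).Nonempty
  bot_zero : ∀ {x y : T.face 0}, A.Bot x → A.Bot y → x = y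
  bot_γ : ∀ {k : ℕ} {a b : T.face (k + 1)}, A.Bot a → A.Bot b → T.γ a = T.γ b → a = b
  bot_δ : ∀ {k : ℕ} {a b : T.face (k + 1)} {x : T.face k}, A.Bot a → A.Bot b → x ∈ T.δ a →
    x ∈ T.δ b → a = b

/-- Faces of dimension `k + 1` sharing their codomain or a face of their domain are comparable. -/
def Pencil (A : Fam T) (k : ℕ) : Prop := ∀ a ∈ A (k + 1), ∀ b ∈ A (k + 1),
  (T.γ a = T.γ b ∨ ∃ x, x ∈ T.δ a ∧ x ∈ T.δ b) → A.Le a b ∨ A.Le b a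

end Fam

section

variable {T : PosHypergraph.{u}} (hT : T.IsOpetopicCardinal) {A : Fam T}
include hT

theorem exists_bot (hA : A.Closed) {k : ℕ} (a : T.face k) (ha : a ∈ A k) :
    ∃ b, A.Bot b ∧ A.Le b a := by
  induction a using (hT.up_wf k).induction with
  | _ a ih =>
    by_cases h : A.Bot a
    · exact ⟨a, h, ReflTransGen.refl⟩
    · simp only [Fam.Bot, not_and, not_forall, not_not] at h
      obtain ⟨α, hα, rfl⟩ := h ha
      obtain ⟨c, hc⟩ := T.δ_nonempty α
      have hlt := Fam.lt_γ hα hc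
      obtain ⟨b, hb, hbc⟩ := ih c hlt.up (hA.δ_mem hα hc)
      exact ⟨b, hb, hbc.trans hlt.le⟩

theorem exists_top (hA : A.Closed) {k : ℕ} (a : T.face k) (ha : a ∈ A k) :
    ∃ b, A.Top b ∧ A.Le a b := by
  induction a using (hT.up_wf' k).induction with
  | _ a ih =>
    by_cases h : A.Top a
    · exact ⟨a, h, ReflTransGen.refl⟩
    · simp only [Fam.Top, not_and, not_forall, not_not] at h
      obtain ⟨α, hα, hc⟩ := h ha
      have hlt := Fam.lt_γ hα hc
      obtain ⟨b, hb, hbc⟩ := ih _ hlt.up (hA.γ_mem hα)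
      exact ⟨b, hb, hlt.le.trans hbc⟩

/-- Descending from `γ α` to `δ α` can preserve the codomain, because `γ (γ α)` is the codomain of
some face of `δ α`. In `exists_bot_δ` a chosen face of the domain is preserved for the analogous
reason. -/
theorem exists_bot_γ (hA : A.Closed) {k : ℕ} (a : T.face (k + 1)) (ha : a ∈ A (k + 1)) :
    ∃ b, A.Bot b ∧ A.Le b a ∧ T.γ b = T.γ a := by
  induction a using (hT.up_wf _).induction with
  | _ a ih =>
    by_cases h : A.Bot a
    · exact ⟨a, h, ReflTransGen.refl, rfl⟩
    · simp only [Fam.Bot, not_and, not_forall, not_not] at h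
      obtain ⟨α, hα, rfl⟩ := h ha
      obtain ⟨c, hc, e⟩ := hT.γγ_mem α
      have hlt := Fam.lt_γ hα hc
      obtain ⟨b, hb, hbc, e'⟩ := ih c hlt.up (hA.δ_mem hα hc)
      exact ⟨b, hb, hbc.trans hlt.le, e'.trans e⟩

theorem exists_bot_δ (hA : A.Closed) {k : ℕ} (a : T.face (k + 1)) (ha : a ∈ A (k + 1))
    {x : T.face k} (hx : x ∈ T.δ a) :
    ∃ b, A.Bot b ∧ A.Le b a ∧ x ∈ T.δ b := by
  induction a using (hT.up_wf _).induction with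
  | _ a ih =>
    by_cases h : A.Bot a
    · exact ⟨a, h, ReflTransGen.refl, hx⟩
    · simp only [Fam.Bot, not_and, not_forall, not_not] at h
      obtain ⟨α, hα, rfl⟩ := h ha
      obtain ⟨⟨c, hc, e⟩, -⟩ := hT.mem_δγ hx
      have hlt := Fam.lt_γ hα hc
      obtain ⟨b, hb, hbc, e'⟩ := ih c hlt.up (hA.δ_mem hα hc) e
      exact ⟨b, hb, hbc.trans hlt.le, e'⟩

/-- The first steps of two paths from `a` go through faces having `a` in their domains. The pencil
condition compares these faces, monotonicity of `γ` compares the ends of the steps, and induction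
upwards from the lower end finishes. -/
theorem linear_of_pencil (hA : A.Closed) {k : ℕ} (hp : A.Pencil k) {a b c : T.face k}
    (hb : A.Le a b) (hc : A.Le a c) : A.Le b c ∨ A.Le c b := by
  have hloc : ∀ α ∈ A (k + 1), ∀ β ∈ A (k + 1), ∀ x, x ∈ T.δ α → x ∈ T.δ β →
      A.Le (T.γ α) (T.γ β) ∨ A.Le (T.γ β) (T.γ α) := by
    intro α hα β hβ x h1 h2
    exact (hp α hα β hβ (Or.inr ⟨x, h1, h2⟩)).imp (hT.γ_le hA) (hT.γ_le hA)
  induction a using (hT.up_wf' k).induction generalizing b c with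
  | _ a ih =>
    rcases ReflTransGen.cases_head hb with rfl | ⟨b', ⟨α, hα, h1, rfl⟩, h2⟩
    · exact Or.inl hc
    rcases ReflTransGen.cases_head hc with rfl | ⟨c', ⟨β, hβ, h3, rfl⟩, h4⟩
    · exact Or.inr hb
    rcases hloc α hα β hβ a h1 h3 with h | h
    · exact ih _ (Fam.lt_γ hα h1).up h2 (h.trans h4)
    · exact ih _ (Fam.lt_γ hβ h3).up (h.trans h2) h4

/-- Two faces of a pencil lie above minimal faces of the same pencil. These coincide in a cell, and
the faces above a given one are linearly ordered once pencils one dimension higher are. -/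
theorem Fam.IsCell.pencil (hA : A.IsCell) (k : ℕ) : A.Pencil k := by
  obtain ⟨N, hN⟩ := T.bounded
  -- The induction descends from the bound `N`, from which on there are no faces.
  have key : ∀ j k, N ≤ k + j → A.Pencil k := by
    intro j
    induction j with
    | zero =>
      intro k hk a
      exact ((hN (k + 1) (by omega)).false a).elim
    | succ j ih =>
      intro k hk a ha b hb h
      have hp := ih (k + 1) (by omega)
      rcases h with h | ⟨x, h1, h2⟩
      · obtain ⟨a', h1, h2, h3⟩ := exists_bot_γ hT hA.toClosed a ha
        obtain ⟨b', h1', h2', h3'⟩ := exists_bot_γ hT hA.toClosed b hb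
        obtain rfl := hA.bot_γ h1 h1' (by rw [h3, h3', h])
        exact linear_of_pencil hT hA.toClosed hp h2 h2'
      · obtain ⟨a', h3, h4, h5⟩ := exists_bot_δ hT hA.toClosed a ha h1
        obtain ⟨b', h3', h4', h5'⟩ := exists_bot_δ hT hA.toClosed b hb h2
        obtain rfl := hA.bot_δ h3 h3' h5 h5'
        exact linear_of_pencil hT hA.toClosed hp h4 h4'
  exact key N k (by omega)

theorem Fam.IsCell.linear (hA : A.IsCell) {k : ℕ} {a b c : T.face k}
    (hb : A.Le a b) (hc : A.Le a c) : A.Le b c ∨ A.Le c b :=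
  linear_of_pencil hT hA.toClosed (hA.pencil hT k) hb hc

theorem Fam.IsCell.linear_zero (hA : A.IsCell) {a b : T.face 0} (ha : a ∈ A 0) (hb : b ∈ A 0) :
    A.Le a b ∨ A.Le b a := by
  obtain ⟨a', h1, h2⟩ := exists_bot hT hA.toClosed a ha
  obtain ⟨b', h1', h2'⟩ := exists_bot hT hA.toClosed b hb
  obtain rfl := hA.bot_zero h1 h1'
  exact hA.linear hT h2 h2'

theorem Fam.IsCell.top_zero (hA : A.IsCell) {a b : T.face 0} (ha : A.Top a) (hb : A.Top b) :
    a = b := by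
  rcases hA.linear_zero hT ha.1 hb.1 with h | h
  · exact ha.eq_of_le h
  · exact (hb.eq_of_le h).symm

theorem Fam.IsCell.top_γ (hA : A.IsCell) {k : ℕ} {a b : T.face (k + 1)} (ha : A.Top a)
    (hb : A.Top b) (h : T.γ a = T.γ b) : a = b := by
  rcases hA.pencil hT k a ha.1 b hb.1 (Or.inl h) with h | h
  · exact ha.eq_of_le h
  · exact (hb.eq_of_le h).symm

theorem Fam.IsCell.top_δ (hA : A.IsCell) {k : ℕ} {a b : T.face (k + 1)} (ha : A.Top a)
    (hb : A.Top b) {x : T.face k} (h : x ∈ T.δ a) (h' : x ∈ T.δ b) : a = b := by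
  rcases hA.pencil hT k a ha.1 b hb.1 (Or.inr ⟨x, h, h'⟩) with h | h
  · exact ha.eq_of_le h
  · exact (hb.eq_of_le h).symm

end

/-! ### Comparison with the order of the sub-hypergraph -/

section

variable {T : PosHypergraph.{u}} (A : T.Sub)

theorem PosHypergraph.Sub.closed : Fam.Closed A.carrier :=
  ⟨fun h => A.γ_mem _ h, fun h hx => A.δ_mem _ h hx⟩

theorem PosHypergraph.Sub.upLt_iff {k : ℕ} (a b : A.toHypergraph.face k) :
    A.toHypergraph.upLt a b ↔ Fam.Lt A.carrier a.1 b.1 := by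
  constructor
  · intro h
    induction h with
    | single h =>
      obtain ⟨α, h1, rfl⟩ := h
      exact TransGen.single ⟨α.1, α.2, h1, rfl⟩
    | tail _ h ih =>
      obtain ⟨α, h1, rfl⟩ := h
      exact ih.tail ⟨α.1, α.2, h1, rfl⟩
  · obtain ⟨b, hb⟩ := b
    intro h
    change Fam.Lt A.carrier a.1 b at h
    induction h with
    | single h =>
      obtain ⟨α, hα, h1, rfl⟩ := h
      exact TransGen.single ⟨⟨α, hα⟩, h1, rfl⟩
    | tail h' h ih =>
      obtain ⟨α, hα, h1, rfl⟩ := h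
      exact (ih (A.closed.δ_mem hα h1)).tail ⟨⟨α, hα⟩, h1, rfl⟩

theorem PosHypergraph.Sub.lowLt_of {k : ℕ} {a b : A.toHypergraph.face (k + 1)}
    (h : A.toHypergraph.lowLt a b) : T.lowLt a.1 b.1 := by
  induction h with
  | single h => exact TransGen.single h
  | tail _ h ih => exact ih.tail h

/-- In a cardinal, distinct minimal faces of one pencil would be comparable, contradicting
minimality. Conversely, globularity, strictness and disjointness restrict from `T` to any
sub-hypergraph, and linearity is `Fam.IsCell.pencil` together with `Fam.IsCell.linear_zero`. -/
theorem PosHypergraph.Sub.isOpetopicCardinal_iff (hT : T.IsOpetopicCardinal) :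
    A.toHypergraph.IsOpetopicCardinal ↔ Fam.IsCell A.carrier := by
  constructor
  · intro h
    refine { A.closed with nonempty := ?_, bot_zero := ?_, bot_γ := ?_, bot_δ := ?_ }
    · obtain ⟨x⟩ := h.nonempty
      exact ⟨x.1, x.2⟩
    · intro x y hx hy
      by_contra hne
      rcases h.linear_zero ⟨x, hx.1⟩ ⟨y, hy.1⟩ (fun e => hne (congrArg Subtype.val e)) with h | h
      · exact hy.not_lt ((A.upLt_iff _ _).1 h)
      · exact hx.not_lt ((A.upLt_iff _ _).1 h)
    · intro k x y hx hy hxy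
      by_contra hne
      rcases h.pencil_γ k (A.toHypergraph.γ ⟨y, hy.1⟩) ⟨x, hx.1⟩ ⟨y, hy.1⟩ (Subtype.ext hxy) rfl
        (fun e => hne (congrArg Subtype.val e)) with h | h
      · exact hy.not_lt ((A.upLt_iff _ _).1 h)
      · exact hx.not_lt ((A.upLt_iff _ _).1 h)
    · intro k x y z hx hy hzx hzy
      by_contra hne
      rcases h.pencil_δ k ⟨z, A.closed.δ_mem hx.1 hzx⟩ ⟨x, hx.1⟩ ⟨y, hy.1⟩ hzx hzy
        (fun e => hne (congrArg Subtype.val e)) with h | h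
      · exact hy.not_lt ((A.upLt_iff _ _).1 h)
      · exact hx.not_lt ((A.upLt_iff _ _).1 h)
  · intro h
    have conv : ∀ {k : ℕ} (a b : A.toHypergraph.face k), a ≠ b →
        (Fam.Le A.carrier a.1 b.1 ∨ Fam.Le A.carrier b.1 a.1) → A.toHypergraph.upPerp a b := by
      intro k a b hne hab
      have hne' : a.1 ≠ b.1 := fun e => hne (Subtype.ext e)
      rcases hab with h | h
      · exact Or.inl ((A.upLt_iff _ _).2 (h.eq_or_lt.resolve_left hne'))
      · exact Or.inr ((A.upLt_iff _ _).2 (h.eq_or_lt.resolve_left hne'.symm))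
    have hγδ : ∀ {k : ℕ} (a : A.toHypergraph.face (k + 2)) (x : A.toHypergraph.face k),
        x ∈ A.toHypergraph.γδ a ↔ x.1 ∈ T.γδ a.1 := by
      intro k a x
      constructor
      · rintro ⟨y, hy, rfl⟩
        exact ⟨y.1, hy, rfl⟩
      · rintro ⟨y, hy, e⟩
        exact ⟨⟨y, A.closed.δ_mem a.2 hy⟩, hy, Subtype.ext e⟩
    have hδδ : ∀ {k : ℕ} (a : A.toHypergraph.face (k + 2)) (x : A.toHypergraph.face k),
        x ∈ A.toHypergraph.δδ a ↔ x.1 ∈ T.δδ a.1 := by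
      intro k a x
      constructor
      · rintro ⟨y, hy, h⟩
        exact ⟨y.1, hy, h⟩
      · rintro ⟨y, hy, e⟩
        exact ⟨⟨y, A.closed.δ_mem a.2 hy⟩, hy, e⟩
    refine ⟨?_, ?_, ?_, ?_, ?_, ?_, ?_, ?_⟩
    · obtain ⟨x, hx⟩ := h.nonempty
      exact ⟨⟨x, hx⟩⟩
    · intro k a
      ext x
      have := Set.ext_iff.1 (hT.globular_γ k a.1) x.1
      rw [Set.mem_sdiff, hγδ, hδδ, ← Set.mem_sdiff, ← this]
      exact Subtype.ext_iff
    · intro k a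
      ext x
      have := Set.ext_iff.1 (hT.globular_δ k a.1) x.1
      rw [Set.mem_sdiff, hγδ, hδδ, ← Set.mem_sdiff, ← this]
      rfl
    · intro k a ha
      exact hT.strict k _ ((A.upLt_iff _ _).1 ha).up
    · intro a b hne
      exact conv a b hne (h.linear_zero hT a.2 b.2)
    · rintro k a b ⟨h1, h2⟩
      refine hT.disjoint k a.1 b.1 ⟨h1.imp A.lowLt_of A.lowLt_of, ?_⟩
      exact h2.imp (fun h => ((A.upLt_iff _ _).1 h).up) (fun h => ((A.upLt_iff _ _).1 h).up)
    · intro k x a b ha hb hne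
      exact conv a b hne (h.pencil hT k a.1 a.2 b.1 b.2
        (Or.inl (congrArg Subtype.val (ha.trans hb.symm))))
    · intro k x a b ha hb hne
      exact conv a b hne (h.pencil hT k a.1 a.2 b.1 b.2 (Or.inr ⟨x.1, ha, hb⟩))

end


/-! ## Cuts -/

namespace Fam

variable {T : PosHypergraph.{u}}

/-- A cut of `S` at level `k`: a set `W` of faces of dimension greater than `k` that is compatible
with the upper order and closed downwards for the lower order in dimension `k + 1`. -/
structure IsCut (S : Fam T) (k : ℕ) (W : Fam T) : Prop where
  γ_iff : ∀ l, k < l → ∀ α ∈ S (l + 1), (T.γ α ∈ W l ↔ α ∈ W (l + 1))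
  δ_iff : ∀ l, k < l → ∀ α ∈ S (l + 1), ∀ a ∈ T.δ α, (a ∈ W l ↔ α ∈ W (l + 1))
  down : ∀ a ∈ S (k + 1), ∀ b ∈ S (k + 1), T.γ a ∈ T.δ b → b ∈ W (k + 1) → a ∈ W (k + 1)

/-- The part of `S` below the cut `W`. -/
def low (S : Fam T) (k : ℕ) (W : Fam T) : Fam T := fun l =>
  {x | x ∈ S l ∧ (k < l → x ∈ W l) ∧ (l = k → ∀ a ∈ S (l + 1), a ∉ W (l + 1) → T.γ a ≠ x)}

/-- The part of `S` above the cut `W`. -/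
def high (S : Fam T) (k : ℕ) (W : Fam T) : Fam T := fun l =>
  {x | x ∈ S l ∧ (k < l → x ∉ W l) ∧ (l = k → ∀ a ∈ S (l + 1), a ∈ W (l + 1) → x ∉ T.δ a) ∧
    (l + 1 = k → ∀ α ∈ S (l + 2), α ∈ W (l + 2) → x ∉ T.ι α)}

/-- The iterated domain. -/
def dom (S : Fam T) (k : ℕ) : Fam T := low S k fun _ => ∅

/-- The iterated codomain. -/
def cod (S : Fam T) (k : ℕ) : Fam T := high S k fun _ => Set.univ

theorem mem_dom {S : Fam T} {k l : ℕ} {x : T.face l} :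
    x ∈ S.dom k l ↔ x ∈ S l ∧ l ≤ k ∧ (l = k → ∀ a ∈ S (l + 1), T.γ a ≠ x) := by
  change _ ∧ (_ → x ∈ (∅ : Set (T.face l))) ∧ (_ → ∀ a ∈ S (l + 1), a ∉ (∅ : Set _) → _) ↔ _
  simp

theorem mem_cod {S : Fam T} {k l : ℕ} {x : T.face l} :
    x ∈ S.cod k l ↔ x ∈ S l ∧ l ≤ k ∧ (l = k → ∀ a ∈ S (l + 1), x ∉ T.δ a) ∧
      (l + 1 = k → ∀ α ∈ S (l + 2), x ∉ T.ι α) := by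
  change _ ∧ (_ → x ∉ Set.univ) ∧ (_ → ∀ a ∈ S (l + 1), a ∈ Set.univ → _) ∧
    (_ → ∀ α ∈ S (l + 2), α ∈ Set.univ → _) ↔ _
  simp

theorem isCut_empty (S : Fam T) (k : ℕ) : S.IsCut k fun _ => ∅ :=
  ⟨by simp, by simp, by simp⟩

theorem isCut_univ (S : Fam T) (k : ℕ) : S.IsCut k fun _ => Set.univ :=
  ⟨by simp, by simp, by simp⟩

theorem IsCut.mono {S S' W : Fam T} {k : ℕ} (h : S.IsCut k W) (hS : ∀ l, k < l → S' l ⊆ S l) :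
    S'.IsCut k W :=
  ⟨fun l hl α hα => h.γ_iff l hl α (hS _ (by omega) hα),
   fun l hl α hα => h.δ_iff l hl α (hS _ (by omega) hα),
   fun a ha b hb => h.down a (hS _ (by omega) ha) b (hS _ (by omega) hb)⟩

theorem IsCut.union {S W W' : Fam T} {k : ℕ} (h : S.IsCut k W) (h' : S.IsCut k W') :
    S.IsCut k fun l => W l ∪ W' l :=
  ⟨fun l hl α hα => or_congr (h.γ_iff l hl α hα) (h'.γ_iff l hl α hα),
   fun l hl α hα a ha => or_congr (h.δ_iff l hl α hα a ha) (h'.δ_iff l hl α hα a ha),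
   fun a ha b hb hab => Or.imp (h.down a ha b hb hab) (h'.down a ha b hb hab)⟩

theorem IsCut.mem_iff_of_le {S W : Fam T} {k : ℕ} (h : S.IsCut k W) {l : ℕ} (hl : k < l)
    {a b : T.face l} (hab : S.Le a b) : a ∈ W l ↔ b ∈ W l := by
  induction hab with
  | refl => rfl
  | tail _ hs ih =>
    obtain ⟨α, hα, h1, rfl⟩ := hs
    rw [ih, h.δ_iff l hl α hα _ h1, h.γ_iff l hl α hα]

theorem IsCut.mem_iff_of_pencil {S W : Fam T} {k : ℕ} (h : S.IsCut k W) (hp : S.Pencil k)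
    {a b : T.face (k + 1)} (ha : a ∈ S (k + 1)) (hb : b ∈ S (k + 1))
    (hab : T.γ a = T.γ b ∨ ∃ x, x ∈ T.δ a ∧ x ∈ T.δ b) : a ∈ W (k + 1) ↔ b ∈ W (k + 1) := by
  rcases hp a ha b hb hab with h' | h'
  · exact h.mem_iff_of_le (by omega) h'
  · exact (h.mem_iff_of_le (by omega) h').symm

/-- A path ending in the codomain of a face of `W` consists of faces of `W`. -/
theorem IsCut.exists_of_lt_γ {S W : Fam T} {k : ℕ} (h : S.IsCut k W) {c d : T.face k}
    (hcd : S.Lt c d) {β : T.face (k + 1)} (hβ : β ∈ S (k + 1)) (hβW : β ∈ W (k + 1))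
    (hp : S.Pencil k) (hd : d = T.γ β) : ∃ w ∈ S (k + 1), w ∈ W (k + 1) ∧ c ∈ T.δ w := by
  induction hcd using TransGen.head_induction_on with
  | single hs =>
    obtain ⟨α, hα, h1, h2⟩ := hs
    exact ⟨α, hα, (h.mem_iff_of_pencil hp hα hβ (Or.inl (h2.trans hd))).2 hβW, h1⟩
  | head hs _ ih =>
    obtain ⟨α, hα, h1, rfl⟩ := hs
    obtain ⟨w, hw, hwW, h2⟩ := ih
    exact ⟨α, hα, h.down α hα w hw h2 hwW, h1⟩

end Fam

section

variable {T : PosHypergraph.{u}} (hT : T.IsOpetopicCardinal) {S W : Fam T} {k : ℕ}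
include hT

/-- Minimal faces of the lower part are already minimal in `S`, so the uniqueness conditions are
inherited. -/
theorem Fam.IsCell.low (hS : S.IsCell) (hW : S.IsCut k W) : (S.low k W).IsCell := by
  have hcl : (S.low k W).Closed := by
    constructor
    · rintro l a ⟨ha, h1, h2⟩
      refine ⟨hS.γ_mem ha, fun hl => (hW.γ_iff l hl a ha).2 (h1 (by omega)), ?_⟩
      rintro rfl b hb hbW e
      exact hbW ((hW.mem_iff_of_pencil (hS.pencil hT l) hb ha (Or.inl e)).2 (h1 (by omega)))
    · rintro l a x ⟨ha, h1, h2⟩ hx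
      refine ⟨hS.δ_mem ha hx, fun hl => (hW.δ_iff l hl a ha x hx).2 (h1 (by omega)), ?_⟩
      rintro rfl b hb hbW rfl
      exact hbW (hW.down b hb a ha hx (h1 (by omega)))
  have hbot : ∀ {l : ℕ} {a : T.face l}, (S.low k W).Bot a → S.Bot a := by
    rintro l a ⟨⟨ha, h1, h2⟩, h3⟩
    refine ⟨ha, ?_⟩
    rintro α hα rfl
    rcases lt_trichotomy l k with hl | rfl | hl
    -- If `α` has dimension `k` it may have been removed. A minimal face with the same codomain is
    -- never removed.
    · obtain ⟨b, hb, -, hb'⟩ := exists_bot_γ hT hS.toClosed α hα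
      exact h3 b ⟨hb.1, by omega, fun _ c hc _ => hb.2 c hc⟩ hb'
    · by_cases hαW : α ∈ W (l + 1)
      · exact h3 α ⟨hα, fun _ => hαW, by omega⟩ rfl
      · exact h2 rfl α hα hαW rfl
    · exact h3 α ⟨hα, fun _ => (hW.γ_iff l hl α hα).1 (h1 hl), by omega⟩ rfl
  refine { hcl with nonempty := ?_, bot_zero := ?_, bot_γ := ?_, bot_δ := ?_ }
  · obtain ⟨x, hx⟩ := hS.nonempty
    obtain ⟨b, hb, -⟩ := exists_bot hT hS.toClosed x hx
    exact ⟨b, hb.1, by omega, fun _ c hc _ => hb.2 c hc⟩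
  · exact fun hx hy => hS.bot_zero (hbot hx) (hbot hy)
  · exact fun hx hy => hS.bot_γ (hbot hx) (hbot hy)
  · exact fun hx hy => hS.bot_δ (hbot hx) (hbot hy)

/-- A face of the upper part comparable with a face in the domain of `β` in the lower part is above
the codomain of `β`. -/
theorem Fam.IsCut.γ_le_of_comparable (hS : S.IsCell) (hW : S.IsCut k W) {a b : T.face k}
    (ha : a ∈ S.high k W k) {β : T.face (k + 1)} (hβ : β ∈ S (k + 1)) (hβW : β ∈ W (k + 1))
    (hb : b ∈ T.δ β) (hab : S.Le a b ∨ S.Le b a) : S.Le (T.γ β) a := by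
  obtain ⟨-, -, h, -⟩ := ha
  -- A path from `a` to `γ β` would start in the domain of a face of `W`, and such faces are removed
  -- from the upper part.
  have hno : ¬ S.Lt a (T.γ β) := by
    intro h'
    obtain ⟨w, hw, hwW, haw⟩ := hW.exists_of_lt_γ h' hβ hβW (hS.pencil hT k) rfl
    exact h rfl w hw hwW haw
  rcases hab with hab | hab
  · exact (hno (hab.trans_lt (Fam.lt_γ hβ hb))).elim
  · rcases hS.linear hT hab (Fam.lt_γ hβ hb).le with h' | h'
    · rcases h'.eq_or_lt with rfl | h'
      · exact ReflTransGen.refl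
      · exact (hno h').elim
    · exact h'

/-- The delicate dimension is `k - 1`. If the codomain or a domain face of `a` were internal to a
face `β` of `W`, then `a` would be comparable with a face of `δ β`, hence above `γ β` and above all
of `δ β`; a lower step between `a` and a face of `δ β` then contradicts disjointness. -/
theorem Fam.IsCell.high_closed (hS : S.IsCell) (hW : S.IsCut k W) : (S.high k W).Closed := by
  constructor
  · rintro l a ⟨ha, h1, h2, h3⟩
    refine ⟨hS.γ_mem ha, fun hl h => h1 (by omega) ((hW.γ_iff l hl a ha).1 h), ?_, ?_⟩
    · rintro rfl b hb hbW h
      exact h1 (by omega) (hW.down a ha b hb h hbW)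
    · rintro rfl β hβ hβW ⟨⟨b, hb, hb'⟩, c, hc, hc'⟩
      have hle := hW.γ_le_of_comparable hT hS ⟨ha, h1, h2, h3⟩ hβ hβW hb
        (hS.pencil hT l a ha b (hS.δ_mem hβ hb) (Or.inl hb'.symm))
      have hlt := (Fam.lt_γ hβ hc).trans_le hle
      exact hT.low_irrefl a c (Or.inr hlt.up) hc'
  · rintro l a x ⟨ha, h1, h2, h3⟩ hx
    refine ⟨hS.δ_mem ha hx, fun hl h => h1 (by omega) ((hW.δ_iff l hl a ha x hx).1 h), ?_, ?_⟩
    · rintro rfl b hb hbW h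
      exact h1 (by omega) ((hW.mem_iff_of_pencil (hS.pencil hT l) ha hb
        (Or.inr ⟨x, hx, h⟩)).2 hbW)
    · rintro rfl β hβ hβW ⟨⟨b, hb, rfl⟩, c, hc, hc'⟩
      have hle := hW.γ_le_of_comparable hT hS ⟨ha, h1, h2, h3⟩ hβ hβW hc
        (hS.pencil hT l a ha c (hS.δ_mem hβ hc) (Or.inr ⟨_, hx, hc'⟩))
      have hlt := (Fam.lt_γ hβ hb).trans_le hle
      exact hT.low_irrefl b a (Or.inl hlt.up) hx

/-- Only dimension `k` acquires new minimal faces. They are maximal in the lower part, which is a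
cell, and maximal faces of a cell satisfy the same uniqueness conditions as minimal ones. -/
theorem Fam.IsCell.high (hS : S.IsCell) (hW : S.IsCut k W) : (S.high k W).IsCell := by
  have hlow := hS.low hT hW
  -- minimal faces in dimension `k` are the maximal faces of the lower part
  have htop : ∀ {a : T.face k}, (S.high k W).Bot a → (S.low k W).Top a := by
    rintro a ⟨⟨ha, h1, h2, h3⟩, h4⟩
    refine ⟨⟨ha, by omega, ?_⟩, ?_⟩
    · rintro - b hb hbW rfl
      exact h4 b ⟨hb, fun _ => hbW, by omega, by omega⟩ rfl
    · rintro α ⟨hα, hαW, -⟩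
      exact h2 rfl α hα (hαW (by omega))
  have hbot : ∀ {l : ℕ} {a : T.face l}, l ≠ k → (S.high k W).Bot a → S.Bot a := by
    rintro l a hlk ⟨⟨ha, h1, h2, h3⟩, h4⟩
    refine ⟨ha, ?_⟩
    rintro α hα rfl
    rcases lt_trichotomy (l + 1) k with hl | rfl | hl
    · obtain ⟨b, hb, -, hb'⟩ := exists_bot_γ hT hS.toClosed α hα
      exact h4 b ⟨hb.1, by omega, by omega, fun _ β hβ _ h => by
        obtain ⟨⟨c, hc, rfl⟩, -⟩ := h
        exact hb.2 _ (hS.δ_mem hβ hc) rfl⟩ hb'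
    · obtain ⟨b, hb, -, hb'⟩ := exists_bot_γ hT hS.toClosed α hα
      -- Climb from the minimal `b` to a maximal face `t` of the lower part, which also lies in the
      -- upper part. Either `t` keeps the codomain of `b`, contradicting minimality of `a`, or that
      -- codomain has become internal to a face of `W` and was removed.
      have hbl : b ∈ S.low (l + 1) W (l + 1) := ⟨hb.1, by omega, fun _ c hc _ => hb.2 c hc⟩
      obtain ⟨t, ht, hbt⟩ := exists_top hT hlow.toClosed b hbl
      rcases hT.γ_eq_or_ι hbt with e | ⟨β, hβ, -, hβ'⟩
      · refine h4 t ⟨ht.1.1, by omega, ?_, by omega⟩ (by rw [← e, hb'])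
        rintro - w hw hwW h
        exact ht.2 w ⟨hw, fun _ => hwW, by omega⟩ h
      · rw [hb'] at hβ'
        exact h3 rfl β hβ.1 (hβ.2.1 (by omega)) hβ'
    · refine h4 α ⟨hα, fun h h' => ?_, by omega, by omega⟩ rfl
      exact h1 (by omega) ((hW.γ_iff l (by omega) α hα).2 h')
  refine { hS.high_closed hT hW with nonempty := ?_, bot_zero := ?_, bot_γ := ?_, bot_δ := ?_ }
  · obtain ⟨x, hx⟩ := hS.nonempty
    obtain ⟨b, hb, -⟩ := exists_top hT hS.toClosed x hx
    refine ⟨b, hb.1, by omega, fun _ c hc _ => hb.2 c hc, fun _ β hβ _ h => ?_⟩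
    obtain ⟨-, c, hc, h⟩ := h
    exact hb.2 _ (hS.δ_mem hβ hc) h
  · intro x y hx hy
    by_cases h : 0 = k
    · subst h
      exact hlow.top_zero hT (htop hx) (htop hy)
    · exact hS.bot_zero (hbot h hx) (hbot h hy)
  · intro l x y hx hy
    by_cases h : l + 1 = k
    · subst h
      exact hlow.top_γ hT (htop hx) (htop hy)
    · exact hS.bot_γ (hbot h hx) (hbot h hy)
  · intro l x y z hx hy
    by_cases h : l + 1 = k
    · subst h
      exact hlow.top_δ hT (htop hx) (htop hy)
    · exact hS.bot_δ (hbot h hx) (hbot h hy)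

/-- The domain is the lower part for the empty cut and the codomain is the upper part for the full
cut, so no separate argument is needed. -/
theorem Fam.IsCell.dom (hS : S.IsCell) (k : ℕ) : (S.dom k).IsCell := hS.low hT (S.isCut_empty k)

theorem Fam.IsCell.cod (hS : S.IsCell) (k : ℕ) : (S.cod k).IsCell := hS.high hT (S.isCut_univ k)

end

/-! ## Top-dimensional faces are incomparable -/

/-- The family of all faces. -/
def Fam.all (T : PosHypergraph.{u}) : Fam T := fun _ => Set.univ

section

variable {T : PosHypergraph.{u}} (hT : T.IsOpetopicCardinal)

theorem Fam.all_closed : (Fam.all T).Closed := ⟨fun _ => trivial, fun _ _ => trivial⟩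

theorem Fam.lt_all {k : ℕ} {a b : T.face k} (h : T.upLt a b) : (Fam.all T).Lt a b :=
  TransGen.mono (fun _ _ ⟨α, h⟩ => ⟨α, trivial, h⟩) _ _ h

theorem Fam.Le.all {A : Fam T} {k : ℕ} {a b : T.face k} (h : A.Le a b) : (Fam.all T).Le a b :=
  h.mono (Set.subset_univ _)

/-- Without faces of dimension `l + 2`, each `l`-face is the codomain of at most one `(l+1)`-face.
Paths into `t` therefore form a tree, and two of them part either at an endpoint or inside the
domain of a single face. -/
theorem Fam.IsCell.comparable_or_siblings {l : ℕ} {S : Fam T} (hS : S.IsCell)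
    (hd : S (l + 2) = ∅) {a b t : T.face l} (ha : S.Le a t) (hb : S.Le b t) :
    S.Le a b ∨ S.Le b a ∨ ∃ p ∈ S (l + 1), ∃ c ∈ T.δ p, ∃ c' ∈ T.δ p, c ≠ c' ∧ S.Le a c ∧
      S.Le b c' := by
  induction ha using ReflTransGen.head_induction_on with
  | refl => exact Or.inr (Or.inl hb)
  | @head a a' hs _ ih =>
    obtain ⟨α, hα, h1, rfl⟩ := hs
    rcases ih with h | h | ⟨p, hp, c, hc, c', hc', hne, h2, h3⟩
    · exact Or.inl ((Fam.lt_γ hα h1).le.trans h)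
    · rcases ReflTransGen.cases_tail h with h | ⟨c, hc, β, hβ, h2, h3⟩
      · exact Or.inl (h ▸ (Fam.lt_γ hα h1).le)
      · have hbot : ∀ x ∈ S (l + 1), S.Bot x := fun x hx =>
          ⟨hx, fun y hy => by rw [hd] at hy; exact hy.elim⟩
        obtain rfl := hS.bot_γ (hbot β hβ) (hbot α hα) h3
        by_cases e : a = c
        · subst e; exact Or.inr (Or.inl hc)
        · exact Or.inr (Or.inr ⟨β, hα, a, h1, c, h2, e, ReflTransGen.refl, hc⟩)
    · exact Or.inr (Or.inr ⟨p, hp, c, hc, c', hc', hne, (Fam.lt_γ hα h1).le.trans h2, h3⟩)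

theorem Fam.cod_top {S : Fam T} {l : ℕ} : S.cod l (l + 1) = ∅ := by
  ext x
  simp only [Fam.mem_cod, Set.mem_empty_iff_false, iff_false]
  omega

include hT

theorem Fam.all_isCell : (Fam.all T).IsCell := by
  refine { Fam.all_closed with nonempty := ?_, bot_zero := ?_, bot_γ := ?_, bot_δ := ?_ }
  · obtain ⟨x⟩ := hT.nonempty
    exact ⟨x, trivial⟩
  · intro x y hx hy
    by_contra hne
    rcases hT.linear_zero x y hne with h | h
    · exact hy.not_lt (Fam.lt_all h)
    · exact hx.not_lt (Fam.lt_all h)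
  · intro k x y hx hy h
    by_contra hne
    rcases hT.pencil_γ k _ x y h rfl hne with h | h
    · exact hy.not_lt (Fam.lt_all h)
    · exact hx.not_lt (Fam.lt_all h)
  · intro k x y z hx hy h h'
    by_contra hne
    rcases hT.pencil_δ k z x y h h' hne with h | h
    · exact hy.not_lt (Fam.lt_all h)
    · exact hx.not_lt (Fam.lt_all h)

/-- The faces of dimension `l` of a sub-opetopic cardinal of dimension `l` are incomparable. -/
theorem Fam.IsCell.eq_of_le {l : ℕ} : ∀ {S A : Fam T}, S.IsCell → S (l + 1) = ∅ →
    ∀ {a b : T.face l}, a ∈ S l → b ∈ S l → A.Le a b → a = b := by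
  induction l with
  | zero =>
    intro S A hS hd a b ha hb hab
    refine hS.bot_zero ⟨ha, ?_⟩ ⟨hb, ?_⟩ <;> simp [hd]
  | succ l ih =>
    -- The ambient order on `l`-faces of `S` is already visible in `S`. Maximal faces above `a` and
    -- `b` lie in the `l`-codomain and are comparable, so they agree by induction. Sibling branches
    -- are excluded, because distinct faces of one domain are incomparable.
    have full : ∀ {S : Fam T}, S.IsCell → S (l + 2) = ∅ → ∀ {a b : T.face l}, a ∈ S l → b ∈ S l →
        (Fam.all T).Le a b → S.Le a b := by
      intro S hS hd a b ha hb hab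
      obtain ⟨t, ht, hat⟩ := exists_top hT hS.toClosed a ha
      obtain ⟨t', ht', hbt⟩ := exists_top hT hS.toClosed b hb
      have hmem : ∀ t, S.Top t → t ∈ S.cod l l := fun t ht =>
        Fam.mem_cod.2 ⟨ht.1, le_rfl, fun _ => ht.2, by omega⟩
      have htt : t = t' := by
        have hM := hS.cod hT l
        rcases (Fam.all_isCell hT).linear hT hat.all (hab.trans hbt.all) with h | h
        · exact ih hM Fam.cod_top (hmem t ht) (hmem t' ht') h
        · exact (ih hM Fam.cod_top (hmem t' ht') (hmem t ht) h).symm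
      subst htt
      rcases hS.comparable_or_siblings hd hat hbt with h | h | ⟨p, hp, c, hc, c', hc', hne, h, h'⟩
      · exact h
      · rw [hT.le_antisymm hab h]; exact ReflTransGen.refl
      · exfalso
        rcases (Fam.all_isCell hT).linear hT h.all (hab.trans h'.all) with h | h
        · exact hT.not_upLt_of_mem_δ hc hc' (h.eq_or_up.resolve_left hne)
        · exact hT.not_upLt_of_mem_δ hc' hc (h.eq_or_up.resolve_left (Ne.symm hne))
    intro S A hS hd a b ha hb hab
    by_contra hne
    have hbot : ∀ x ∈ S (l + 1), S.Bot x := fun x hx =>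
      ⟨hx, fun y hy => by rw [hd] at hy; exact hy.elim⟩
    -- Some `y ∈ δ b` lies below `x ∈ δ a`, hence below it within `S`. If `y ≠ x`, the first step
    -- from `y` must go through `b`, so `γ b ≤ x < γ a ≤ γ b`.
    obtain ⟨x, hx⟩ := T.δ_nonempty a
    obtain ⟨y, hy, hyx⟩ := hT.exists_δ_le Fam.all_closed hab.all x hx
    have hle := full hS hd (hS.δ_mem hb hy) (hS.δ_mem ha hx) hyx
    rcases ReflTransGen.cases_head hle with rfl | ⟨z, ⟨n, hn, h1, rfl⟩, h2⟩
    · exact hne (hS.bot_δ (hbot a ha) (hbot b hb) hx hy)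
    · obtain rfl := hS.bot_δ (hbot n hn) (hbot b hb) h1 hy
      exact hT.not_lt_of_le (hT.γ_le Fam.all_closed hab.all) (Fam.Le.trans_lt h2 (Fam.lt_γ ha hx))

end


/-! ## Composites -/

namespace Fam

variable {T : PosHypergraph.{u}}

/-- The union of two families. -/
def union (A B : Fam T) : Fam T := fun l => A l ∪ B l

theorem low_congr {S W W' : Fam T} {k : ℕ} (h : ∀ l, k < l → W l = W' l) :
    S.low k W = S.low k W' := by
  funext l
  ext x
  refine and_congr_right fun _ => and_congr ?_ ?_
  · exact forall_congr' fun hl => by rw [h l hl]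
  · refine forall_congr' fun hl => ?_
    rw [h (l + 1) (by omega)]

theorem high_congr {S W W' : Fam T} {k : ℕ} (h : ∀ l, k < l → W l = W' l) :
    S.high k W = S.high k W' := by
  funext l
  ext x
  refine and_congr_right fun _ => and_congr ?_ (and_congr ?_ ?_)
  · exact forall_congr' fun hl => by rw [h l hl]
  · refine forall_congr' fun hl => ?_
    rw [h (l + 1) (by omega)]
  · refine forall_congr' fun hl => ?_
    rw [h (l + 2) (by omega)]

theorem dom_eq_self {A : Fam T} {k : ℕ} (h : ∀ l, k < l → A l = ∅) : A.dom k = A := by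
  funext l
  ext x
  rw [mem_dom]
  refine ⟨fun h => h.1, fun hx => ⟨hx, ?_, ?_⟩⟩
  · by_contra hl
    rw [h l (by omega)] at hx
    exact hx
  · rintro rfl
    rw [h (l + 1) (by omega)]
    simp

theorem cod_eq_self {A : Fam T} {k : ℕ} (h : ∀ l, k < l → A l = ∅) : A.cod k = A := by
  funext l
  ext x
  rw [mem_cod]
  refine ⟨fun h => h.1, fun hx => ⟨hx, ?_, ?_, ?_⟩⟩
  · by_contra hl
    rw [h l (by omega)] at hx
    exact hx
  · rintro rfl
    rw [h (l + 1) (by omega)]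
    simp
  · rintro rfl
    rw [h (l + 2) (by omega)]
    simp

theorem dom_empty (A : Fam T) {k l : ℕ} (h : k < l) : A.dom k l = ∅ := by
  ext x
  simp only [mem_dom, Set.mem_empty_iff_false, iff_false]
  omega

theorem cod_empty (A : Fam T) {k l : ℕ} (h : k < l) : A.cod k l = ∅ := by
  ext x
  simp only [mem_cod, Set.mem_empty_iff_false, iff_false]
  omega

section composable

variable {A B : Fam T} {k : ℕ} (h : A.dom k = B.cod k)
include h

theorem right_of_left {l : ℕ} (hl : l ≤ k) {x : T.face l} (hx : x ∈ A l)
    (hx' : l = k → ∀ a ∈ A (l + 1), T.γ a ≠ x) : x ∈ B l ∧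
      (l = k → ∀ b ∈ B (l + 1), x ∉ T.δ b) ∧ (l + 1 = k → ∀ α ∈ B (l + 2), x ∉ T.ι α) := by
  have : x ∈ A.dom k l := mem_dom.2 ⟨hx, hl, hx'⟩
  rw [h, mem_cod] at this
  exact ⟨this.1, this.2.2⟩

theorem left_of_right {l : ℕ} (hl : l ≤ k) {x : T.face l} (hx : x ∈ B l)
    (hx' : l = k → ∀ b ∈ B (l + 1), x ∉ T.δ b)
    (hx'' : l + 1 = k → ∀ α ∈ B (l + 2), x ∉ T.ι α) : x ∈ A l ∧
      (l = k → ∀ a ∈ A (l + 1), T.γ a ≠ x) := by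
  have : x ∈ B.cod k l := mem_cod.2 ⟨hx, hl, hx', hx''⟩
  rw [← h, mem_dom] at this
  exact ⟨this.1, this.2.2⟩

end composable

end Fam

open Fam

section

variable {T : PosHypergraph.{u}} (hT : T.IsOpetopicCardinal)
include hT

section composable

variable {A B : Fam T} {k : ℕ} (hA : A.IsCell) (hB : B.IsCell) (h : A.dom k = B.cod k)
include hA hB h

/-- A minimal face of `A` below `x` and a maximal face of `B` above `x` both lie in the common
boundary, a cell of dimension at most `k`. Being comparable, they coincide, and `x` is squeezed
between them. -/
theorem bot_top_of_composable {x : T.face k} (hx : x ∈ A k) (hx' : x ∈ B k) :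
    A.Bot x ∧ B.Top x := by
  obtain ⟨m, hm, hmx⟩ := exists_bot hT hA.toClosed x hx
  obtain ⟨m', hm', hmx'⟩ := exists_top hT hB.toClosed x hx'
  have h1 : m ∈ A.dom k k := mem_dom.2 ⟨hm.1, le_rfl, fun _ => hm.2⟩
  have h2 : m' ∈ A.dom k k := by
    rw [h]; exact mem_cod.2 ⟨hm'.1, le_rfl, fun _ => hm'.2, by omega⟩
  have := (hA.dom hT k).eq_of_le hT (A.dom_empty (Nat.lt_succ_self k)) h1 h2
    (hmx.all.trans hmx'.all)
  subst this
  obtain rfl := hT.le_antisymm hmx hmx'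
  exact ⟨hm, hm'⟩

/-- Taking codomains of a common face leads down to dimension `k`, where the common face would be
both minimal in `A` and a codomain of a face of `A`. -/
theorem disjoint_of_composable {l : ℕ} (hl : k < l) {x : T.face l} (hx : x ∈ A l)
    (hx' : x ∈ B l) : False := by
  induction l with
  | zero => omega
  | succ l ih =>
    rcases Nat.lt_or_ge k l with h' | h'
    · exact ih h' (hA.γ_mem hx) (hB.γ_mem hx')
    · obtain rfl : k = l := by omega
      exact (bot_top_of_composable hT hA hB h (hA.γ_mem hx) (hB.γ_mem hx')).1.2 x hx rfl

/-- Minimal faces of dimension at most `k` are minimal in `B`. Above `k` each is minimal in its own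
factor, and faces from different factors share no codomain and no domain face. -/
theorem Fam.IsCell.union : (A.union B).IsCell := by
  have hbotB : ∀ {l : ℕ} {x : T.face l}, l ≤ k → (A.union B).Bot x → B.Bot x := by
    rintro l x hl ⟨hx | hx, hx'⟩
    · exact ⟨(right_of_left h hl hx fun _ a ha => hx' a (Or.inl ha)).1,
        fun b hb => hx' b (Or.inr hb)⟩
    · exact ⟨hx, fun b hb => hx' b (Or.inr hb)⟩
  have hbot : ∀ {l : ℕ} {x : T.face l}, (A.union B).Bot x → A.Bot x ∨ B.Bot x := by
    rintro l x ⟨hx | hx, hx'⟩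
    · exact Or.inl ⟨hx, fun b hb => hx' b (Or.inl hb)⟩
    · exact Or.inr ⟨hx, fun b hb => hx' b (Or.inr hb)⟩
  have hdisj := @disjoint_of_composable _ hT _ _ _ hA hB h
  have hγ : ∀ {l : ℕ} {a b : T.face (l + 1)}, k < l + 1 → a ∈ A (l + 1) → b ∈ B (l + 1) →
      T.γ a ≠ T.γ b := by
    intro l a b hl ha hb e
    rcases Nat.lt_or_ge k l with h' | h'
    · exact hdisj h' (hA.γ_mem ha) (e ▸ hB.γ_mem hb)
    · obtain rfl : k = l := by omega
      exact (bot_top_of_composable hT hA hB h (hA.γ_mem ha) (e ▸ hB.γ_mem hb)).1.2 a ha rfl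
  have hδ : ∀ {l : ℕ} {a b : T.face (l + 1)} {x : T.face l}, k < l + 1 → a ∈ A (l + 1) →
      b ∈ B (l + 1) → x ∈ T.δ a → x ∉ T.δ b := by
    intro l a b x hl ha hb e e'
    rcases Nat.lt_or_ge k l with h' | h'
    · exact hdisj h' (hA.δ_mem ha e) (hB.δ_mem hb e')
    · obtain rfl : k = l := by omega
      exact (bot_top_of_composable hT hA hB h (hA.δ_mem ha e) (hB.δ_mem hb e')).2.2 b hb e'
  refine { γ_mem := ?_, δ_mem := ?_, nonempty := ?_, bot_zero := ?_, bot_γ := ?_, bot_δ := ?_ }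
  · exact fun hx => hx.imp hA.γ_mem hB.γ_mem
  · exact fun hx hy => hx.imp (fun h => hA.δ_mem h hy) (fun h => hB.δ_mem h hy)
  · exact hA.nonempty.mono fun x hx => Or.inl hx
  · exact fun hx hy => hB.bot_zero (hbotB (by omega) hx) (hbotB (by omega) hy)
  · intro l a b ha hb hab
    by_cases hl : l + 1 ≤ k
    · exact hB.bot_γ (hbotB hl ha) (hbotB hl hb) hab
    · rcases hbot ha with ha | ha <;> rcases hbot hb with hb | hb
      · exact hA.bot_γ ha hb hab
      · exact (hγ (by omega) ha.1 hb.1 hab).elim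
      · exact (hγ (by omega) hb.1 ha.1 hab.symm).elim
      · exact hB.bot_γ ha hb hab
  · intro l a b x ha hb hxa hxb
    by_cases hl : l + 1 ≤ k
    · exact hB.bot_δ (hbotB hl ha) (hbotB hl hb) hxa hxb
    · rcases hbot ha with ha | ha <;> rcases hbot hb with hb | hb
      · exact hA.bot_δ ha hb hxa hxb
      · exact (hδ (by omega) ha.1 hb.1 hxa hxb).elim
      · exact (hδ (by omega) hb.1 ha.1 hxb hxa).elim
      · exact hB.bot_δ ha hb hxa hxb

/-- This makes decompositions along `k` the same thing as cuts: the next two lemmas recover the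
factors as the two parts. -/
theorem isCut_of_composable : (A.union B).IsCut k B := by
  have hdisj := @disjoint_of_composable _ hT _ _ _ hA hB h
  refine ⟨?_, ?_, ?_⟩
  · rintro l hl α (hα | hα)
    · exact iff_of_false (hdisj hl (hA.γ_mem hα)) (hdisj (by omega) hα)
    · exact iff_of_true (hB.γ_mem hα) hα
  · rintro l hl α (hα | hα) a ha
    · exact iff_of_false (hdisj hl (hA.δ_mem hα ha)) (hdisj (by omega) hα)
    · exact iff_of_true (hB.δ_mem hα ha) hα
  · rintro a (ha | ha) b - hab hb
    · exact ((bot_top_of_composable hT hA hB h (hA.γ_mem ha) (hB.δ_mem hb hab)).1.2 a ha rfl).elim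
    · exact ha

theorem low_of_composable : (A.union B).low k B = B := by
  have hdisj := @disjoint_of_composable _ hT _ _ _ hA hB h
  funext l
  ext x
  constructor
  · rintro ⟨hx | hx, h1, h2⟩
    · by_cases hl : k < l
      · exact h1 hl
      · refine (right_of_left h (by omega) hx ?_).1
        rintro rfl a ha
        exact h2 rfl a (Or.inl ha) (fun ha' => hdisj (by omega) ha ha')
    · exact hx
  · intro hx
    refine ⟨Or.inr hx, fun _ => hx, ?_⟩
    rintro rfl a (ha | ha) ha' rfl
    · exact (bot_top_of_composable hT hA hB h (hA.γ_mem ha) hx).1.2 a ha rfl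
    · exact ha' ha

theorem high_of_composable : (A.union B).high k B = A := by
  have hdisj := @disjoint_of_composable _ hT _ _ _ hA hB h
  funext l
  ext x
  constructor
  · rintro ⟨hx | hx, h1, h2, h3⟩
    · exact hx
    · by_cases hl : k < l
      · exact (h1 hl hx).elim
      · exact (left_of_right h (by omega) hx (fun e b hb => h2 e b (Or.inr hb) hb)
          (fun e b hb => h3 e b (Or.inr hb) hb)).1
  · intro hx
    refine ⟨Or.inl hx, fun hl hx' => hdisj hl hx hx', ?_, ?_⟩
    · rintro rfl b - hb hxb
      exact (bot_top_of_composable hT hA hB h hx (hB.δ_mem hb hxb)).2.2 b hb hxb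
    · rintro rfl
      have := right_of_left h (by omega) hx (by omega)
      exact fun α _ hα => this.2.2 rfl α hα

theorem dom_union_self : (A.union B).dom k = B.dom k := by
  funext l
  ext x
  rw [mem_dom, mem_dom]
  constructor
  · rintro ⟨hx | hx, hl, h1⟩
    · exact ⟨(right_of_left h hl hx fun e a ha => h1 e a (Or.inl ha)).1, hl,
        fun e a ha => h1 e a (Or.inr ha)⟩
    · exact ⟨hx, hl, fun e a ha => h1 e a (Or.inr ha)⟩
  · rintro ⟨hx, hl, h1⟩
    refine ⟨Or.inr hx, hl, ?_⟩
    rintro rfl a (ha | ha) rfl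
    · exact (bot_top_of_composable hT hA hB h (hA.γ_mem ha) hx).1.2 a ha rfl
    · exact h1 rfl a ha rfl

theorem cod_union_self : (A.union B).cod k = A.cod k := by
  funext l
  ext x
  rw [mem_cod, mem_cod]
  constructor
  · rintro ⟨hx | hx, hl, h1, h2⟩
    · exact ⟨hx, hl, fun e a ha => h1 e a (Or.inl ha), fun e a ha => h2 e a (Or.inl ha)⟩
    · exact ⟨(left_of_right h hl hx (fun e a ha => h1 e a (Or.inr ha))
        fun e a ha => h2 e a (Or.inr ha)).1, hl, fun e a ha => h1 e a (Or.inl ha),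
        fun e a ha => h2 e a (Or.inl ha)⟩
  · rintro ⟨hx, hl, h1, h2⟩
    refine ⟨Or.inl hx, hl, ?_, ?_⟩
    · rintro rfl a (ha | ha) hxa
      · exact h1 rfl a ha hxa
      · exact (bot_top_of_composable hT hA hB h hx (hB.δ_mem ha hxa)).2.2 a ha hxa
    · rintro rfl a (ha | ha) hxa
      · exact h2 rfl a ha hxa
      · exact (right_of_left h (by omega) hx (by omega)).2.2 rfl a ha hxa

theorem dom_union {l : ℕ} (hl : k < l) : (A.union B).dom l = (A.dom l).union (B.dom l) := by
  have hdisj := @disjoint_of_composable _ hT _ _ _ hA hB h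
  funext i
  ext x
  change _ ↔ x ∈ A.dom l i ∨ x ∈ B.dom l i
  rw [mem_dom, mem_dom, mem_dom]
  constructor
  · rintro ⟨hx, hi, h1⟩
    exact hx.imp (fun hx => ⟨hx, hi, fun e a ha => h1 e a (Or.inl ha)⟩)
      (fun hx => ⟨hx, hi, fun e a ha => h1 e a (Or.inr ha)⟩)
  · rintro (⟨hx, hi, h1⟩ | ⟨hx, hi, h1⟩)
    · refine ⟨Or.inl hx, hi, ?_⟩
      rintro rfl a (ha | ha) rfl
      · exact h1 rfl a ha rfl
      · exact hdisj hl hx (hB.γ_mem ha)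
    · refine ⟨Or.inr hx, hi, ?_⟩
      rintro rfl a (ha | ha) rfl
      · exact hdisj hl (hA.γ_mem ha) hx
      · exact h1 rfl a ha rfl

theorem cod_union {l : ℕ} (hl : k < l) : (A.union B).cod l = (A.cod l).union (B.cod l) := by
  have hdisj := @disjoint_of_composable _ hT _ _ _ hA hB h
  funext i
  ext x
  change _ ↔ x ∈ A.cod l i ∨ x ∈ B.cod l i
  rw [mem_cod, mem_cod, mem_cod]
  constructor
  · rintro ⟨hx, hi, h1, h2⟩
    exact hx.imp
      (fun hx => ⟨hx, hi, fun e a ha => h1 e a (Or.inl ha), fun e a ha => h2 e a (Or.inl ha)⟩)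
      (fun hx => ⟨hx, hi, fun e a ha => h1 e a (Or.inr ha), fun e a ha => h2 e a (Or.inr ha)⟩)
  · rintro (⟨hx, hi, h1, h2⟩ | ⟨hx, hi, h1, h2⟩)
    · refine ⟨Or.inl hx, hi, ?_, ?_⟩
      · rintro rfl a (ha | ha) hxa
        · exact h1 rfl a ha hxa
        · exact hdisj hl hx (hB.δ_mem ha hxa)
      · rintro rfl a (ha | ha) hxa
        · exact h2 rfl a ha hxa
        · obtain ⟨⟨b, hb, rfl⟩, c, hc, hc'⟩ := hxa
          have hmem := hB.δ_mem (hB.δ_mem ha hc) hc'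
          by_cases hi' : k < i
          · exact hdisj hi' hx hmem
          · obtain rfl : k = i := by omega
            exact (bot_top_of_composable hT hA hB h hx hmem).2.2 c (hB.δ_mem ha hc) hc'
    · refine ⟨Or.inr hx, hi, ?_, ?_⟩
      · rintro rfl a (ha | ha) hxa
        · exact hdisj hl (hA.δ_mem ha hxa) hx
        · exact h1 rfl a ha hxa
      · rintro rfl a (ha | ha) hxa
        · obtain ⟨⟨b, hb, rfl⟩, c, hc, hc'⟩ := hxa
          have hmem := hA.γ_mem (hA.δ_mem ha hb)
          by_cases hi' : k < i
          · exact hdisj hi' hmem hx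
          · obtain rfl : k = i := by omega
            exact (bot_top_of_composable hT hA hB h hmem hx).1.2 b (hA.δ_mem ha hb) rfl
        · exact h2 rfl a ha hxa

/-- A composite along `k`-cells is determined by the higher dimensional faces of one factor. -/
theorem eq_of_composable {A' B' : Fam T} (hA' : A'.IsCell) (hB' : B'.IsCell)
    (h' : A'.dom k = B'.cod k) (hS : A.union B = A'.union B') (hW : ∀ l, k < l → B l = B' l) :
    A = A' ∧ B = B' := by
  constructor
  · rw [← high_of_composable hT hA hB h, hS, high_congr hW, high_of_composable hT hA' hB' h']
  · rw [← low_of_composable hT hA hB h, hS, low_congr hW, low_of_composable hT hA' hB' h']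

end composable

/-! ### Decomposition of a cell along a cut -/

section cut

variable {S W : Fam T} {k : ℕ} (hS : S.IsCell) (hW : S.IsCut k W)
include hS hW

omit hT hS in
theorem union_high_low : (S.high k W).union (S.low k W) = S := by
  funext l
  ext x
  constructor
  · rintro (hx | hx)
    · exact hx.1
    · exact hx.1
  · intro hx
    rcases lt_trichotomy l k with hl | rfl | hl
    · exact Or.inr ⟨hx, by omega, by omega⟩
    · by_cases h1 : ∃ a ∈ S (l + 1), a ∉ W (l + 1) ∧ T.γ a = x
      · obtain ⟨a, ha, haW, rfl⟩ := h1
        refine Or.inl ⟨hx, by omega, ?_, by omega⟩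
        exact fun _ b hb hbW hab => haW (hW.down a ha b hb hab hbW)
      · exact Or.inr ⟨hx, by omega, fun _ a ha haW e => h1 ⟨a, ha, haW, e⟩⟩
    · by_cases h1 : x ∈ W l
      · exact Or.inr ⟨hx, fun _ => h1, by omega⟩
      · exact Or.inl ⟨hx, fun _ => h1, by omega, by omega⟩

omit hT hS hW in
-- Both sides remove the same faces: codomains of faces outside `W` and domain faces of `W` in
-- dimension `k`, and internal faces of `W` in dimension `k - 1`.
theorem dom_high_eq_cod_low : (S.high k W).dom k = (S.low k W).cod k := by
  funext l
  ext x
  rw [mem_dom, mem_cod]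
  constructor
  · rintro ⟨⟨hx, h1, h2, h3⟩, hl, h4⟩
    refine ⟨⟨hx, by omega, ?_⟩, hl, ?_, ?_⟩
    · rintro rfl a ha haW
      exact h4 rfl a ⟨ha, fun _ => haW, by omega, by omega⟩
    · rintro rfl a ⟨ha, haW, -⟩
      exact h2 rfl a ha (haW (by omega))
    · rintro rfl a ⟨ha, haW, -⟩
      exact h3 rfl a ha (haW (by omega))
  · rintro ⟨⟨hx, h1, h2⟩, hl, h3, h4⟩
    refine ⟨⟨hx, by omega, ?_, ?_⟩, hl, ?_⟩
    · rintro rfl a ha haW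
      exact h3 rfl a ⟨ha, fun _ => haW, by omega⟩
    · rintro rfl a ha haW
      exact h4 rfl a ⟨ha, fun _ => haW, by omega⟩
    · rintro rfl a ⟨ha, haW, -⟩
      exact h2 rfl a ha (haW (by omega))

end cut

/-! ## Globular identities -/

section globular

variable {S : Fam T} (hS : S.IsCell) {j k : ℕ} (hjk : j < k)

/-- The globular identities are proved by moving a witness to a minimal or maximal face, which
survives in the boundary; here the witness exhibits an internal face. -/
theorem exists_bot_ι (hS : S.IsCell) {i : ℕ} (a : T.face (i + 2)) (ha : a ∈ S (i + 2))
    {x : T.face i} (hx : x ∈ T.ι a) : ∃ b, S.Bot b ∧ x ∈ T.ι b := by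
  induction a using (hT.up_wf _).induction with
  | _ a ih =>
    by_cases h : S.Bot a
    · exact ⟨a, h, hx⟩
    · simp only [Fam.Bot, not_and, not_forall, not_not] at h
      obtain ⟨α, hα, rfl⟩ := h ha
      obtain ⟨c, hc, e⟩ := hT.ι_γ_subset α hx
      exact ih c (Fam.lt_γ hα hc).up (hS.δ_mem hα hc) e

theorem exists_top_ι (hS : S.IsCell) {i : ℕ} (a : T.face (i + 2)) (ha : a ∈ S (i + 2))
    {x : T.face i} (hx : x ∈ T.ι a) : ∃ b, S.Top b ∧ x ∈ T.ι b := by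
  induction a using (hT.up_wf' _).induction with
  | _ a ih =>
    by_cases h : S.Top a
    · exact ⟨a, h, hx⟩
    · simp only [Fam.Top, not_and, not_forall, not_not] at h
      obtain ⟨α, hα, hc⟩ := h ha
      exact ih _ (Fam.lt_γ hα hc).up (hS.γ_mem hα) (hT.ι_subset_ι_γ α hc hx)

omit hT in
theorem bot_mem_dom {l : ℕ} (hl : l ≤ k) {x : T.face l} (hx : S.Bot x) : x ∈ S.dom k l :=
  mem_dom.2 ⟨hx.1, hl, fun _ => hx.2⟩

omit hT in
theorem top_mem_cod {x : T.face k} (hx : S.Top x) : x ∈ S.cod k k :=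
  mem_cod.2 ⟨hx.1, le_rfl, fun _ => hx.2, by omega⟩

include hS

omit hT in
theorem bot_mem_cod {l : ℕ} (hl : l < k) {x : T.face l} (hx : S.Bot x) : x ∈ S.cod k l := by
  refine mem_cod.2 ⟨hx.1, hl.le, by omega, ?_⟩
  rintro rfl α hα ⟨⟨a, ha, h⟩, -⟩
  exact hx.2 a (hS.δ_mem hα ha) h

include hjk

theorem dom_dom : (S.dom k).dom j = S.dom j := by
  funext i
  ext x
  rw [mem_dom, mem_dom (k := j)]
  constructor
  · rintro ⟨hx, hi, h1⟩
    refine ⟨(mem_dom.1 hx).1, hi, ?_⟩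
    rintro rfl a ha rfl
    obtain ⟨b, hb, -, h2⟩ := exists_bot_γ hT hS.toClosed a ha
    exact h1 rfl b (bot_mem_dom (by omega) hb) h2
  · rintro ⟨hx, hi, h1⟩
    exact ⟨mem_dom.2 ⟨hx, by omega, by omega⟩, hi, fun e a ha => h1 e a (mem_dom.1 ha).1⟩

theorem dom_cod : (S.cod k).dom j = S.dom j := by
  funext i
  ext x
  rw [mem_dom, mem_dom (k := j)]
  constructor
  · rintro ⟨hx, hi, h1⟩
    refine ⟨(mem_cod.1 hx).1, hi, ?_⟩
    rintro rfl a ha rfl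
    -- The codomain keeps only maximal faces in dimension `k`. Climbing to one either preserves `γ
    -- a` or makes it internal to a `(k+1)`-face, and such internal faces are removed from the
    -- codomain.
    by_cases hik : i + 1 = k
    · subst hik
      obtain ⟨t, ht, hat⟩ := exists_top hT hS.toClosed a ha
      rcases hT.γ_eq_or_ι hat with e | ⟨β, hβ, -, h2⟩
      · exact h1 rfl t (top_mem_cod ht) e.symm
      · exact (mem_cod.1 hx).2.2.2 rfl β hβ h2
    · obtain ⟨b, hb, -, h2⟩ := exists_bot_γ hT hS.toClosed a ha
      exact h1 rfl b (bot_mem_cod hS (by omega) hb) h2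
  · rintro ⟨hx, hi, h1⟩
    refine ⟨mem_cod.2 ⟨hx, by omega, by omega, ?_⟩, hi, fun e a ha => h1 e a (mem_cod.1 ha).1⟩
    rintro rfl α hα ⟨⟨a, ha, h⟩, -⟩
    exact h1 (by omega) a (hS.δ_mem hα ha) h

theorem cod_dom : (S.dom k).cod j = S.cod j := by
  funext i
  ext x
  rw [mem_cod, mem_cod (k := j)]
  constructor
  · rintro ⟨hx, hi, h1, h2⟩
    refine ⟨(mem_dom.1 hx).1, hi, ?_, ?_⟩
    · rintro rfl a ha hxa
      obtain ⟨b, hb, -, h3⟩ := exists_bot_δ hT hS.toClosed a ha hxa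
      exact h1 rfl b (bot_mem_dom (by omega) hb) h3
    · rintro rfl a ha hxa
      obtain ⟨b, hb, h3⟩ := exists_bot_ι hT hS a ha hxa
      exact h2 rfl b (bot_mem_dom (by omega) hb) h3
  · rintro ⟨hx, hi, h1, h2⟩
    exact ⟨mem_dom.2 ⟨hx, by omega, by omega⟩, hi, fun e a ha => h1 e a (mem_dom.1 ha).1,
      fun e a ha => h2 e a (mem_dom.1 ha).1⟩

theorem cod_cod : (S.cod k).cod j = S.cod j := by
  funext i
  ext x
  rw [mem_cod, mem_cod (k := j)]
  constructor
  · rintro ⟨hx, hi, h1, h2⟩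
    refine ⟨(mem_cod.1 hx).1, hi, ?_, ?_⟩
    · rintro rfl a ha hxa
      by_cases hik : i + 1 = k
      · subst hik
        obtain ⟨t, ht, hat⟩ := exists_top hT hS.toClosed a ha
        rcases hT.δ_mem_or_ι hat hxa with e | ⟨β, hβ, -, h2⟩
        · exact h1 rfl t (top_mem_cod ht) e
        · exact (mem_cod.1 hx).2.2.2 rfl β hβ h2
      · obtain ⟨b, hb, -, h3⟩ := exists_bot_δ hT hS.toClosed a ha hxa
        exact h1 rfl b (bot_mem_cod hS (by omega) hb) h3
    · rintro rfl a ha hxa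
      by_cases hik : i + 2 = k
      · subst hik
        obtain ⟨b, hb, h3⟩ := exists_top_ι hT hS a ha hxa
        exact h2 rfl b (top_mem_cod hb) h3
      · obtain ⟨b, hb, h3⟩ := exists_bot_ι hT hS a ha hxa
        exact h2 rfl b (bot_mem_cod hS (by omega) hb) h3
  · rintro ⟨hx, hi, h1, h2⟩
    refine ⟨mem_cod.2 ⟨hx, by omega, by omega, ?_⟩, hi, fun e a ha => h1 e a (mem_cod.1 ha).1,
      fun e a ha => h2 e a (mem_cod.1 ha).1⟩
    rintro rfl α hα ⟨-, a, ha, h⟩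
    exact h1 (by omega) a (hS.δ_mem hα ha) h

end globular

end

open Fam

/-! ## Cells generated by a face -/

section

variable {T : PosHypergraph.{u}}

/-- The family of faces generated by `x`. -/
def genFam {n : ℕ} (x : T.face n) : Fam T := (gen x).carrier

theorem genFam_closed {n : ℕ} (x : T.face n) : (genFam x).Closed := (gen x).closed

theorem self_mem_genFam {n : ℕ} (x : T.face n) : x ∈ genFam x n := fun _ h => h

theorem genFam_subset {n : ℕ} {x : T.face n} {A : Fam T} (hA : A.Closed) (hx : x ∈ A n) (l : ℕ) :
    genFam x l ⊆ A l := fun _ hy =>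
  hy { carrier := A, γ_mem := fun _ h => hA.γ_mem h, δ_mem := fun _ h _ hx => hA.δ_mem h hx } hx

theorem genFam_empty {n : ℕ} (x : T.face n) {l : ℕ} (hl : n < l) : genFam x l = ∅ := by
  have hc : Fam.Closed (fun l => {_y : T.face l | l ≤ n}) :=
    ⟨fun h => (Nat.le_succ _).trans h, fun h _ => (Nat.le_succ _).trans h⟩
  ext y
  refine ⟨fun hy => ?_, fun hy => hy.elim⟩
  have : l ≤ n := genFam_subset hc (show n ≤ n from le_rfl) l hy
  omega

/-- The faces with this property form a closed family containing `x`, so leastness applies. -/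
theorem genFam_cases {n : ℕ} (x : T.face n) {l : ℕ} {y : T.face l} (hy : y ∈ genFam x l) :
    (⟨l, y⟩ : T.Face) = ⟨n, x⟩ ∨ ∃ z ∈ genFam x (l + 1), T.γ z = y ∨ y ∈ T.δ z := by
  let P : Fam T := fun l => {y | y ∈ genFam x l ∧ ((⟨l, y⟩ : T.Face) = ⟨n, x⟩ ∨
    ∃ z ∈ genFam x (l + 1), T.γ z = y ∨ y ∈ T.δ z)}
  have hc : P.Closed := by
    constructor
    · rintro k a ⟨ha, -⟩
      exact ⟨(genFam_closed x).γ_mem ha, Or.inr ⟨a, ha, Or.inl rfl⟩⟩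
    · rintro k a y ⟨ha, -⟩ hy
      exact ⟨(genFam_closed x).δ_mem ha hy, Or.inr ⟨a, ha, Or.inr hy⟩⟩
  exact (genFam_subset hc (show x ∈ P n from ⟨self_mem_genFam x, Or.inl rfl⟩) l hy).2

theorem mem_genFam_self {n : ℕ} {x y : T.face n} : y ∈ genFam x n ↔ y = x := by
  constructor
  · intro hy
    rcases genFam_cases x hy with h | ⟨z, hz, -⟩
    · simpa using h
    · rw [genFam_empty x (Nat.lt_succ_self n)] at hz
      exact hz.elim
  · rintro rfl
    exact self_mem_genFam y

theorem mem_genFam_pred {n : ℕ} {x : T.face (n + 1)} {y : T.face n} :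
    y ∈ genFam x n ↔ y = T.γ x ∨ y ∈ T.δ x := by
  constructor
  · intro hy
    rcases genFam_cases x hy with h | ⟨z, hz, h⟩
    · have := congrArg Sigma.fst h
      simp at this
    · rw [mem_genFam_self] at hz
      subst hz
      exact h.imp_left Eq.symm
  · rintro (rfl | h)
    · exact (genFam_closed x).γ_mem (self_mem_genFam x)
    · exact (genFam_closed x).δ_mem (self_mem_genFam x) h

theorem genFam_of_lt {n : ℕ} {x : T.face n} {l : ℕ} (hl : l < n) {y : T.face l}
    (hy : y ∈ genFam x l) : ∃ z ∈ genFam x (l + 1), T.γ z = y ∨ y ∈ T.δ z := by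
  rcases genFam_cases x hy with h | h
  · have := congrArg Sigma.fst h
    simp only at this
    omega
  · exact h

theorem genFam_γ_subset {n : ℕ} (x : T.face (n + 1)) (l : ℕ) :
    genFam (T.γ x) l ⊆ genFam x l :=
  genFam_subset (genFam_closed x) ((genFam_closed x).γ_mem (self_mem_genFam x)) l

variable (hT : T.IsOpetopicCardinal)
include hT

/-- Consequently, minimal faces of `T[x]` below dimension `n` lie in `T[γ x]`, which allows
induction along codomains. A face in the domain of `z` is also in the domain of a minimal face, and
the claim one dimension higher places that face in `T[γ x]`. -/
theorem mem_genFam_γ_or {n : ℕ} (x : T.face (n + 1)) {l : ℕ} (hl : l < n) {y : T.face l}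
    (hy : y ∈ genFam x l) : y ∈ genFam (T.γ x) l ∨ ∃ w ∈ genFam x (l + 1), T.γ w = y := by
  obtain ⟨d, rfl⟩ : ∃ d, n = l + 1 + d := ⟨n - (l + 1), by omega⟩
  induction d generalizing l with
  | zero =>
    obtain ⟨z, hz, h | h⟩ := genFam_of_lt (by omega) hy
    · exact Or.inr ⟨z, hz, h⟩
    · rw [mem_genFam_pred] at hz
      rcases hz with rfl | hz
      · exact Or.inl ((genFam_closed _).δ_mem (self_mem_genFam _) h)
      · rcases hT.mem_δ_or hz h with h | ⟨⟨b, hb, rfl⟩, -⟩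
        · exact Or.inl ((genFam_closed _).δ_mem (self_mem_genFam _) h)
        · exact Or.inr ⟨b, (genFam_closed x).δ_mem (self_mem_genFam x) hb, rfl⟩
  | succ d ih =>
    obtain ⟨z, hz, h | h⟩ := genFam_of_lt (by omega) hy
    · exact Or.inr ⟨z, hz, h⟩
    · obtain ⟨b, hb, hbz, hyb⟩ := exists_bot_δ hT (genFam_closed x) z hz h
      have hn : l + 1 + (d + 1) = (l + 1) + 1 + d := by omega
      -- Generalizing the dimension of `x` allows the index equation to be substituted.
      have : ∀ (m : ℕ) (hm : m = (l + 1) + 1 + d) (x : T.face (m + 1)),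
          b ∈ genFam x (l + 1) → (genFam x).Bot b → y ∈ genFam (T.γ x) l := by
        rintro m rfl x hbx hbb
        rcases ih x (by omega) hbx with h' | ⟨w, hw, e⟩
        · exact (genFam_closed _).δ_mem h' hyb
        · exact (hbb.2 w hw e).elim
      exact Or.inl (this _ hn x hb.1 hb)

theorem bot_genFam_γ {n : ℕ} (x : T.face (n + 1)) {l : ℕ} (hl : l < n) {y : T.face l}
    (hy : (genFam x).Bot y) : (genFam (T.γ x)).Bot y := by
  rcases mem_genFam_γ_or hT x hl hy.1 with h | ⟨w, hw, e⟩
  · exact ⟨h, fun w hw => hy.2 w (genFam_γ_subset x _ hw)⟩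
  · exact (hy.2 w hw e).elim

theorem bot_genFam_pred {n : ℕ} {x : T.face (n + 1)} {y : T.face n} :
    (genFam x).Bot y ↔ y ∈ T.δ x := by
  constructor
  · rintro ⟨hy, h⟩
    rcases mem_genFam_pred.1 hy with rfl | hy
    · exact (h x (self_mem_genFam x) rfl).elim
    · exact hy
  · intro hy
    refine ⟨mem_genFam_pred.2 (Or.inr hy), ?_⟩
    rintro α hα rfl
    rw [mem_genFam_self] at hα
    subst hα
    exact hT.γ_notMem_δ α hy

/-- Below dimension `n`, minimal faces come from `T[γ x]`. In dimension `n` they are the faces of `δ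
x`, whose codomains are distinct and whose domains are disjoint. For `n = 0` the fact that `δ x` is
a singleton is needed. -/
theorem genFam_isCell {n : ℕ} (x : T.face n) : (genFam x).IsCell := by
  induction n with
  | zero =>
    have hno : ∀ {k : ℕ} {a : T.face (k + 1)}, ¬ (genFam x).Bot a := by
      rintro k a ⟨ha, -⟩
      rw [genFam_empty x (Nat.succ_pos k)] at ha
      exact ha
    refine { genFam_closed x with nonempty := ⟨x, self_mem_genFam x⟩, bot_zero := ?_, bot_γ := ?_, bot_δ := ?_ }
    · intro a b ha hb
      rw [mem_genFam_self.1 ha.1, mem_genFam_self.1 hb.1]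
    · exact fun ha => (hno ha).elim
    · exact fun ha => (hno ha).elim
  | succ n ih =>
    have ih := ih (T.γ x)
    have hbig : ∀ {l : ℕ} {a b : T.face l}, n < l → (genFam x).Bot a → (genFam x).Bot b → a = b := by
      intro l a b hl ha hb
      rcases Nat.lt_or_ge (n + 1) l with h | h
      · have := ha.1
        rw [genFam_empty x h] at this
        exact this.elim
      · obtain rfl : l = n + 1 := by omega
        rw [mem_genFam_self.1 ha.1, mem_genFam_self.1 hb.1]
    refine { genFam_closed x with nonempty := ?_, bot_zero := ?_, bot_γ := ?_, bot_δ := ?_ }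
    · obtain ⟨y, hy⟩ := ih.nonempty
      exact ⟨y, genFam_γ_subset x _ hy⟩
    · intro a b ha hb
      rcases Nat.eq_zero_or_pos n with rfl | hn
      · rw [bot_genFam_pred hT] at ha hb
        obtain ⟨c, hc⟩ := T.δ_function x
        rw [hc] at ha hb
        exact ha.trans hb.symm
      · exact ih.bot_zero (bot_genFam_γ hT x hn ha) (bot_genFam_γ hT x hn hb)
    · intro l a b ha hb h
      rcases lt_trichotomy (l + 1) n with hl | rfl | hl
      · exact ih.bot_γ (bot_genFam_γ hT x hl ha) (bot_genFam_γ hT x hl hb) h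
      · rw [bot_genFam_pred hT] at ha hb
        exact hT.eq_of_mem_δ_of_γ ha hb h
      · exact hbig hl ha hb
    · intro l a b y ha hb h h'
      rcases lt_trichotomy (l + 1) n with hl | rfl | hl
      · exact ih.bot_δ (bot_genFam_γ hT x hl ha) (bot_genFam_γ hT x hl hb) h h'
      · rw [bot_genFam_pred hT] at ha hb
        exact hT.eq_of_mem_δ_of_δ ha hb h h'
      · exact hbig hl ha hb

theorem genFam_cod {n : ℕ} (x : T.face (n + 1)) : (genFam x).cod n = genFam (T.γ x) := by
  have hlow : ∀ {l : ℕ} {y : T.face l}, l + 1 < n → y ∈ genFam x l → y ∈ genFam (T.γ x) l := by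
    intro l y hl hy
    rcases mem_genFam_γ_or hT x (by omega) hy with h | ⟨w, hw, rfl⟩
    · exact h
    · obtain ⟨b, hb, -, e⟩ := exists_bot_γ hT (genFam_closed x) w hw
      rw [← e]
      exact (genFam_closed _).γ_mem (bot_genFam_γ hT x hl hb).1
  funext l
  ext y
  rw [mem_cod]
  constructor
  · rintro ⟨hy, hl, h1, h2⟩
    rcases Nat.lt_or_ge (l + 1) n with h | h
    · exact hlow h hy
    rcases Nat.lt_or_ge l n with h' | h'
    · obtain rfl : n = l + 1 := by omega
      rcases mem_genFam_γ_or hT x (by omega) hy with h | ⟨w, hw, rfl⟩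
      · exact h
      · rcases mem_genFam_pred.1 hw with rfl | hw
        · exact (genFam_closed _).γ_mem (self_mem_genFam _)
        · rcases hT.γ_eq_or hw with e | e
          · rw [e]; exact (genFam_closed _).γ_mem (self_mem_genFam _)
          · exact (h2 rfl x (self_mem_genFam x) e).elim
    · obtain rfl : l = n := by omega
      rcases mem_genFam_pred.1 hy with rfl | hy
      · exact self_mem_genFam _
      · exact (h1 rfl x (self_mem_genFam x) hy).elim
  · intro hy
    have hl : l ≤ n := by
      by_contra h
      rw [genFam_empty (T.γ x) (by omega)] at hy
      exact hy
    refine ⟨genFam_γ_subset x l hy, hl, ?_, ?_⟩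
    · rintro rfl a ha
      obtain rfl := mem_genFam_self.1 ha
      obtain rfl := mem_genFam_self.1 hy
      exact hT.γ_notMem_δ a
    · rintro rfl a ha ⟨⟨b, hb, h⟩, c, hc, h'⟩
      obtain rfl := mem_genFam_self.1 ha
      rcases mem_genFam_pred.1 hy with rfl | hy
      · exact hT.γγ_notMem a hc h'
      · exact (hT.mem_δγ hy).2 b hb h

theorem mem_genFam_dom {n : ℕ} (x : T.face (n + 1)) {y : T.face n} :
    y ∈ (genFam x).dom n n ↔ y ∈ T.δ x := by
  rw [← bot_genFam_pred hT, mem_dom]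
  exact ⟨fun h => ⟨h.1, h.2.2 rfl⟩, fun h => ⟨h.1, le_rfl, fun _ => h.2⟩⟩

/-! ## Existence of cuts -/

/-- A set of faces closed upwards for the lower order contains a face with maximal codomain. -/
theorem exists_γ_top {S : Fam T} (hS : S.Closed) {j : ℕ} {P : Set (T.face (j + 1))}
    (hPS : P ⊆ S (j + 1)) (hP : ∀ a ∈ P, ∀ b ∈ S (j + 1), T.γ a ∈ T.δ b → b ∈ P)
    {a : T.face (j + 1)} (ha : a ∈ P) : ∃ b ∈ P, S.Top (T.γ b) := by
  obtain ⟨x, hx⟩ : ∃ x, T.γ a = x := ⟨_, rfl⟩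
  induction x using (hT.up_wf' j).induction generalizing a with
  | _ x ih =>
    by_cases h : S.Top (T.γ a)
    · exact ⟨a, ha, h⟩
    · simp only [Fam.Top, not_and, not_forall, not_not] at h
      obtain ⟨b, hb, hab⟩ := h (hS.γ_mem (hPS ha))
      subst hx
      exact ih _ (Fam.lt_γ hb hab).up (hP a ha b hb hab) rfl

omit hT in
theorem Face.mk_inj {l : ℕ} {a b : T.face l} (h : (⟨l, a⟩ : T.Face) = ⟨l, b⟩) : a = b :=
  eq_of_heq (Sigma.mk.inj h).2

omit hT in
theorem γIter_succ {m l : ℕ} (h : m ≤ l) (α : T.face (l + 1)) :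
    Face.γIter m (⟨l + 1, α⟩ : T.Face) = Face.γIter m ⟨l, T.γ α⟩ := by
  have h' : m < l + 1 := by omega
  simp only [Face.γIter, γIterAux, h']
  rfl

omit hT in
theorem γIter_self {m : ℕ} (a : T.face m) : Face.γIter m (⟨m, a⟩ : T.Face) = ⟨m, a⟩ :=
  Face.γIter_of_le _ le_rfl

/-- Take a maximal face `r` whose codomain is maximal. The faces whose `(j+1)`-codomain lies below
`r` form the upper part, and everything else is the cut. At least one of `t`, `t'` differs from `r`,
so both parts are nontrivial. -/
theorem exists_cut {S : Fam T} (hS : S.IsCell) {j : ℕ} {t t' : T.face (j + 1)} (ht : S.Top t)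
    (ht' : S.Top t') (hne : t ≠ t') : ∃ W, S.IsCut j W ∧ (∃ a ∈ S (j + 1), a ∉ W (j + 1)) ∧
      ∃ b ∈ S (j + 1), b ∈ W (j + 1) := by
  obtain ⟨b, hb, hbt⟩ := exists_γ_top hT hS.toClosed (P := S (j + 1)) subset_rfl
    (fun _ _ b hb _ => hb) ht.1
  obtain ⟨r, hr, hbr⟩ := exists_top hT hS.toClosed b hb
  have hγr : S.Top (T.γ r) := by
    rw [← hbt.eq_of_le (hT.γ_le hS.toClosed hbr)]; exact hbt
  -- `Q` is the complement of the intended cut; the iterated codomain carries the condition to all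
  -- higher dimensions.
  let Q : Fam T := fun l =>
    {a | ∃ c : T.face (j + 1), Face.γIter (j + 1) (⟨l, a⟩ : T.Face) = ⟨j + 1, c⟩ ∧ S.Le c r}
  have hQ1 : ∀ {a : T.face (j + 1)}, a ∈ Q (j + 1) ↔ S.Le a r := by
    intro a
    constructor
    · rintro ⟨c, h1, h2⟩
      rw [γIter_self] at h1
      obtain rfl := Face.mk_inj h1
      exact h2
    · exact fun h => ⟨a, γIter_self a, h⟩
  have hQγ : ∀ {l : ℕ}, j < l → ∀ {α : T.face (l + 1)}, T.γ α ∈ Q l ↔ α ∈ Q (l + 1) := by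
    intro l hl α
    change (∃ c, _) ↔ (∃ c, _)
    rw [γIter_succ (by omega)]
  have hQδ : ∀ l, j < l → ∀ α ∈ S (l + 1), ∀ a ∈ T.δ α, a ∈ Q l ↔ T.γ α ∈ Q l := by
    intro l hl
    obtain ⟨d, rfl⟩ : ∃ d, l = j + 1 + d := ⟨l - (j + 1), by omega⟩
    clear hl
    induction d with
    | zero =>
      intro α hα a ha
      change a ∈ Q (j + 1) ↔ T.γ α ∈ Q (j + 1)
      rw [hQ1, hQ1]
      have hlt := Fam.lt_γ hα ha
      constructor
      · intro h
        rcases hS.linear hT hlt.le h with h' | h'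
        · exact h'
        · rw [hr.eq_of_le h']; exact ReflTransGen.refl
      · exact fun h => hlt.le.trans h
    | succ d ih =>
      intro α hα a ha
      have hle := hT.γ_le_γγ hS.toClosed hα _ a ha rfl
      refine (hQγ (l := j + 1 + d) (by omega)).symm.trans
        (Iff.trans ?_ (hQγ (l := j + 1 + d) (by omega)))
      have hmono : ∀ {c e : T.face (j + 1 + d)}, S.Le c e →
          (c ∈ Q (j + 1 + d) ↔ e ∈ Q (j + 1 + d)) := by
        intro c e hce
        induction hce with
        | refl => rfl
        | tail _ hs ih' =>
          obtain ⟨β, hβ, h1, rfl⟩ := hs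
          exact ih'.trans (ih β hβ _ h1)
      exact hmono hle
  refine ⟨fun l => (Q l)ᶜ, ⟨?_, ?_, ?_⟩, ⟨r, hr.1, ?_⟩, ?_⟩
  · intro l hl α _
    exact not_congr (hQγ hl)
  · intro l hl α hα a ha
    exact not_congr ((hQδ l hl α hα a ha).trans (hQγ hl))
  · intro a ha b hb hab hbW haQ
    -- Since `γ r` is maximal, `γ a ≠ γ r`, so `γ a` is internal to some `α` with `γ α ≤ r`. Then
    -- `b` shares `γ a` with a face of `δ α`, and linearity with maximality of `r` gives `b ≤ r`.
    refine hbW (hQ1.2 ?_)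
    rcases hT.γ_eq_or_ι (hQ1.1 haQ) with e | ⟨α, hα, hαr, -, c, hc, hxc⟩
    · exact (hγr.2 b hb (e ▸ hab)).elim
    · have hcr := (Fam.lt_γ hα hc).le.trans hαr
      rcases hS.pencil hT j b hb c (hS.δ_mem hα hc) (Or.inr ⟨_, hab, hxc⟩) with h | h
      · exact h.trans hcr
      · rcases hS.linear hT h hcr with h' | h'
        · exact h'
        · rw [hr.eq_of_le h']; exact ReflTransGen.refl
  · exact fun h => h (hQ1.2 ReflTransGen.refl)
  · by_cases h : t = r
    · refine ⟨t', ht'.1, fun hq => hne ?_⟩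
      rw [h, ht'.eq_of_le (hQ1.1 hq)]
    · exact ⟨t, ht.1, fun hq => h (ht.eq_of_le (hQ1.1 hq))⟩

/-- If all maximal faces in positive dimensions are unique, the cell is generated by one face. -/
theorem eq_genFam {S : Fam T} (hS : S.IsCell) {n : ℕ} (hd : S (n + 1) = ∅) {x : T.face n}
    (hx : x ∈ S n) (h : ∀ l, l < n → ∀ t t' : T.face (l + 1), S.Top t → S.Top t' → t = t')
    (hd' : ∀ l, n < l → S l = ∅) :
    S = genFam x := by
  have huniq : ∀ l, l ≤ n → ∀ t t' : T.face l, S.Top t → S.Top t' → t = t' := by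
    intro l hl t t' ht ht'
    cases l with
    | zero => exact hS.top_zero hT ht ht'
    | succ l => exact h l (by omega) t t' ht ht'
  have key : ∀ d l, l + d = n → S l ⊆ genFam x l ∧ ∃ t : T.face l, S.Top t ∧ t ∈ genFam x l := by
    intro d
    induction d with
    | zero =>
      rintro l rfl
      have htop : ∀ y ∈ S l, S.Top y := fun y hy => ⟨hy, by simp [show S (l + 1) = ∅ from hd]⟩
      refine ⟨fun y hy => ?_, x, htop x hx, self_mem_genFam x⟩
      rw [huniq l le_rfl y x (htop y hy) (htop x hx)]
      exact self_mem_genFam x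
    | succ d ih =>
      rintro l rfl
      obtain ⟨h1, t, ht, htx⟩ := ih (l + 1) (by omega)
      -- A face `b` with `γ t` in its domain would lie below the unique maximal face `t`,
      -- contradicting disjointness or strictness.
      have htop : S.Top (T.γ t) := by
        refine ⟨hS.γ_mem ht.1, fun b hb hab => ?_⟩
        obtain ⟨t', ht', hbt⟩ := exists_top hT hS.toClosed b hb
        obtain rfl := huniq (l + 1) (by omega) t t' ht ht'
        rcases hbt.eq_or_up with rfl | hbt
        · exact hT.γ_notMem_δ b hab
        · exact hT.low_irrefl t b (Or.inr hbt) hab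
      refine ⟨fun y hy => ?_, _, htop, (genFam_closed x).γ_mem htx⟩
      by_cases hyt : S.Top y
      · rw [huniq l (by omega) y _ hyt htop]
        exact (genFam_closed x).γ_mem htx
      · simp only [Fam.Top, not_and, not_forall, not_not] at hyt
        obtain ⟨b, hb, hab⟩ := hyt hy
        exact (genFam_closed x).δ_mem (h1 hb) hab
  funext l
  refine subset_antisymm ?_ (genFam_subset hS.toClosed hx l)
  rcases Nat.lt_or_ge n l with hl | hl
  · rw [hd' l hl]; exact Set.empty_subset _
  · exact (key (n - l) l (by omega)).1

/-- A cell of dimension `n` is generated by a face or has a nontrivial cut. -/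
theorem eq_genFam_or_exists_cut {S : Fam T} (hS : S.IsCell) {n : ℕ} (hd : ∀ l, n < l → S l = ∅)
    {x : T.face n} (hx : x ∈ S n) : S = genFam x ∨ ∃ k, k < n ∧ ∃ W, S.IsCut k W ∧
      (∃ a ∈ S (k + 1), a ∉ W (k + 1)) ∧ ∃ b ∈ S (k + 1), b ∈ W (k + 1) := by
  by_cases h : ∀ l, l < n → ∀ t t' : T.face (l + 1), S.Top t → S.Top t' → t = t'
  · exact Or.inl (eq_genFam hT hS (hd _ (Nat.lt_succ_self n)) hx h hd)
  · push Not at h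
    obtain ⟨l, hl, t, t', ht, ht', hne⟩ := h
    exact Or.inr ⟨l, hl, exists_cut hT hS ht ht' hne⟩

/-- If there is no nontrivial cut below level `k`, nontrivial cuts at level `k` have a nontrivial
union. -/
theorem exists_notMem_union {S W W' : Fam T} (hS : S.IsCell) {k : ℕ} (hW : S.IsCut k W)
    (hW' : S.IsCut k W')
    (h : ∀ l, l < k → ∀ W, S.IsCut l W → (∃ a ∈ S (l + 1), a ∉ W (l + 1)) →
      ¬ ∃ b ∈ S (l + 1), b ∈ W (l + 1))
    (ha : ∃ a ∈ S (k + 1), a ∉ W (k + 1)) (ha' : ∃ a ∈ S (k + 1), a ∉ W' (k + 1)) :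
    ∃ a ∈ S (k + 1), a ∉ W (k + 1) ∧ a ∉ W' (k + 1) := by
  -- Two maximal `k`-faces would give a nontrivial cut one level lower. The complement of each cut
  -- contains a face with maximal codomain; these codomains agree, so pencil saturation puts one
  -- face outside both cuts.
  have huniq : ∀ t t' : T.face k, S.Top t → S.Top t' → t = t' := by
    intro t t' ht ht'
    cases k with
    | zero => exact hS.top_zero hT ht ht'
    | succ l =>
      by_contra hne
      obtain ⟨W, hW, h1, h2⟩ := exists_cut hT hS ht ht' hne
      exact h l (by omega) W hW h1 h2
  have key : ∀ {W : Fam T}, S.IsCut k W → (∃ a ∈ S (k + 1), a ∉ W (k + 1)) →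
      ∃ b ∈ S (k + 1), b ∉ W (k + 1) ∧ S.Top (T.γ b) := by
    rintro W hW ⟨a, ha, haW⟩
    obtain ⟨b, hb, hb'⟩ := exists_γ_top hT hS.toClosed (P := {a | a ∈ S (k + 1) ∧ a ∉ W (k + 1)})
      (fun a h => h.1) (fun a ha b hb hab => ⟨hb, fun h => ha.2 (hW.down a ha.1 b hb hab h)⟩)
      (show a ∈ _ from ⟨ha, haW⟩)
    exact ⟨b, hb.1, hb.2, hb'⟩
  obtain ⟨b, hb, hbW, hbt⟩ := key hW ha
  obtain ⟨b', hb', hbW', hbt'⟩ := key hW' ha'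
  refine ⟨b, hb, hbW, fun h => hbW' ?_⟩
  exact (hW'.mem_iff_of_pencil (hS.pencil hT k) hb hb' (Or.inl (huniq _ _ hbt hbt'))).1 h

omit hT in
/-- A cell is determined by its top-dimensional faces and its domain. -/
theorem eq_of_dom_eq {A B : Fam T} (hA : A.IsCell) (hB : B.IsCell) {n : ℕ}
    (hdA : ∀ l, n < l → A l = ∅) (hdB : ∀ l, n < l → B l = ∅) (h : A n = B n)
    (h' : ∀ k, k + 1 = n → A.dom k = B.dom k) : A = B := by
  have key : ∀ {A B : Fam T}, A.IsCell → B.IsCell → A n = B n →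
      (∀ k, k + 1 = n → A.dom k = B.dom k) → ∀ l, l < n → A l ⊆ B l := by
    intro A B hA hB h h' l hl x hx
    obtain ⟨k, rfl⟩ : ∃ k, n = k + 1 := ⟨n - 1, by omega⟩
    by_cases hlk : l = k ∧ ∃ a ∈ A (l + 1), T.γ a = x
    · obtain ⟨rfl, a, ha, rfl⟩ := hlk
      rw [h] at ha
      exact hB.γ_mem ha
    · have : x ∈ A.dom k l := mem_dom.2 ⟨hx, by omega, fun e a ha e' => hlk ⟨e, a, ha, e'⟩⟩
      rw [h' k rfl] at this
      exact (mem_dom.1 this).1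
  funext l
  rcases lt_trichotomy l n with hl | rfl | hl
  · exact subset_antisymm (key hA hB h h' l hl)
      (key hB hA h.symm (fun k hk => (h' k hk).symm) l hl)
  · exact h
  · rw [hdA l hl, hdB l hl]

end


/-! ## The `ω`-category of a positive opetope -/

section

variable {T : POpe.{u}} {n : ℕ}

/-- The family of faces of a cell. -/
def fam (c : StarCell T n) : Fam T.hg := c.1.carrier

theorem fam_isCell (c : StarCell T n) : (fam c).IsCell :=
  (c.1.isOpetopicCardinal_iff T.isCardinal).1 c.2.1

theorem fam_empty (c : StarCell T n) {k : ℕ} (h : n < k) : fam c k = ∅ := c.2.2 k h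

theorem fam_injective : Function.Injective (fam : StarCell T n → Fam T.hg) := by
  rintro ⟨⟨A, hA, hA'⟩, h⟩ ⟨⟨B, hB, hB'⟩, h'⟩ e
  obtain rfl : A = B := e
  rfl

/-- The cell with a given family of faces. -/
def mkCell (A : Fam T.hg) (hA : A.IsCell) (hd : ∀ k, n < k → A k = ∅) : StarCell T n :=
  ⟨{ carrier := A, γ_mem := fun _ h => hA.γ_mem h, δ_mem := fun _ h _ hx => hA.δ_mem h hx },
    (PosHypergraph.Sub.isOpetopicCardinal_iff _ T.isCardinal).2 hA, hd⟩

end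

/-- The operations of `T^*`. -/
@[reducible] def starData (T : POpe.{u}) : OmegaData.{u} where
  cell := StarCell T
  dom {k _} _ x := mkCell ((fam x).dom k) ((fam_isCell x).dom T.isCardinal k)
    fun _ hl => Fam.dom_empty _ hl
  cod {k _} _ x := mkCell ((fam x).cod k) ((fam_isCell x).cod T.isCardinal k)
    fun _ hl => Fam.cod_empty _ hl
  idt {n} x := mkCell (fam x) (fam_isCell x) fun _ hl => fam_empty x (by omega)
  cmp _ x y e := mkCell ((fam x).union (fam y))
    ((fam_isCell x).union T.isCardinal (fam_isCell y) (congrArg fam e))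
    fun l hl => by simp [Fam.union, fam_empty x hl, fam_empty y hl]

section

variable (T : POpe.{u})

theorem OmegaData.idIter_self (C : OmegaData.{u}) {k : ℕ} (x : C.cell k) :
    C.idIter le_rfl x = x := Nat.leRec_self _ _

theorem OmegaData.idIter_succ (C : OmegaData.{u}) {k n : ℕ} (h : k ≤ n) (h' : k ≤ n + 1)
    (x : C.cell k) : C.idIter h' x = C.idt (C.idIter h x) :=
  Nat.leRec_succ (motive := fun n _ => C.cell n) _ _ h

theorem fam_idIter {k n : ℕ} (h : k ≤ n) (x : StarCell T k) :
    fam (T := T) ((starData T).idIter h x) = fam x := by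
  induction n, h using Nat.le_induction with
  | base => exact congrArg fam ((starData T).idIter_self x)
  | succ n h ih => exact (congrArg fam ((starData T).idIter_succ h _ x)).trans ih

theorem Fam.union_dom_self {T : PosHypergraph.{u}} (A : Fam T) (k : ℕ) : A.union (A.dom k) = A := by
  funext l
  exact Set.union_eq_left.2 fun x hx => (Fam.mem_dom.1 hx).1

theorem Fam.cod_union_left {T : PosHypergraph.{u}} (A : Fam T) (k : ℕ) :
    (A.cod k).union A = A := by
  funext l
  exact Set.union_eq_right.2 fun x hx => (Fam.mem_cod.1 hx).1

/-- The `ω`-category `T^*`. -/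
@[reducible] def starCat : OmegaCat.{u} where
  toOmegaData := starData T
  dom_dom h _ x := fam_injective (dom_dom T.isCardinal (fam_isCell x) h)
  dom_cod h _ x := fam_injective (dom_cod T.isCardinal (fam_isCell x) h)
  cod_dom h _ x := fam_injective (cod_dom T.isCardinal (fam_isCell x) h)
  cod_cod h _ x := fam_injective (cod_cod T.isCardinal (fam_isCell x) h)
  dom_idt x := fam_injective (Fam.dom_eq_self fun _ hl => fam_empty x hl)
  cod_idt x := fam_injective (Fam.cod_eq_self fun _ hl => fam_empty x hl)
  dom_cmp_self _ x y e := fam_injective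
    (dom_union_self T.isCardinal (fam_isCell x) (fam_isCell y) (congrArg fam e))
  cod_cmp_self _ x y e := fam_injective
    (cod_union_self T.isCardinal (fam_isCell x) (fam_isCell y) (congrArg fam e))
  dom_cmp h _ x y e _ := fam_injective
    (dom_union T.isCardinal (fam_isCell x) (fam_isCell y) (congrArg fam e) h)
  cod_cmp h _ x y e _ := fam_injective
    (cod_union T.isCardinal (fam_isCell x) (fam_isCell y) (congrArg fam e) h)
  cmp_idt {k _} h x _ := fam_injective
    ((congrArg (fam x).union (fam_idIter T h.le _)).trans ((fam x).union_dom_self k))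
  idt_cmp {k _} h x _ := fam_injective
    ((congrArg (Fam.union · (fam x)) (fam_idIter T h.le _)).trans ((fam x).cod_union_left k))
  cmp_assoc _ _ _ _ _ _ _ _ := fam_injective (funext fun _ => Set.union_assoc _ _ _)
  interchange _ _ _ _ _ _ _ _ _ _ _ _ := fam_injective
    (funext fun _ => Set.union_union_union_comm _ _ _ _)
  idt_of_cmp _ _ _ _ _ := rfl

variable {T}

theorem star_idIter_fam {k n : ℕ} (h : k ≤ n) (x : StarCell T k) :
    fam (T := T) ((starCat T).idIter h x) = fam x := fam_idIter T h x

theorem star_cmp_fam {k n : ℕ} (h : k < n) (x y : StarCell T n)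
    (e : (starCat T).dom h x = (starCat T).cod h y) :
    fam (T := T) ((starCat T).cmp h x y e) = (fam x).union (fam y) := rfl

/-- The generator given by a face. -/
def genCell {n : ℕ} (x : T.hg.face n) : StarCell T n :=
  mkCell (genFam x) (genFam_isCell T.isCardinal x) fun _ hl => genFam_empty x hl

theorem fam_genCell {n : ℕ} (x : T.hg.face n) : fam (genCell x) = genFam x := rfl

theorem genCell_injective {n : ℕ} : Function.Injective (genCell : T.hg.face n → StarCell T n) := by
  intro x y h
  have : x ∈ fam (genCell y) n := h ▸ self_mem_genFam x
  exact mem_genFam_self.1 this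

/-! ### Sizes and decompositions -/

/-- The number of faces of a cell. -/
noncomputable def cellSize {n : ℕ} (c : StarCell T n) : ℕ :=
  Set.ncard {f : T.hg.Face | f.2 ∈ fam c f.1}

theorem finite_Face (S : PosHypergraph.{u}) : Finite S.Face := by
  obtain ⟨N, hN⟩ := S.bounded
  have := S.finite_face
  refine Finite.of_injective (β := Σ k : Fin N, S.face k)
    (fun f => ⟨⟨f.1, by by_contra h; exact (hN f.1 (by omega)).false f.2⟩, f.2⟩) ?_
  rintro ⟨k, x⟩ ⟨l, y⟩ h
  simp only [Sigma.mk.injEq, Fin.mk.injEq] at h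
  obtain ⟨rfl, h⟩ := h
  rw [eq_of_heq h]

theorem cellSize_le {n : ℕ} {c d : StarCell T n} (h : ∀ l, fam c l ⊆ fam d l) :
    cellSize c ≤ cellSize d := by
  have := finite_Face T.hg
  exact Set.ncard_le_ncard (fun f hf => h _ hf)

theorem cellSize_lt {n : ℕ} {c d : StarCell T n} (h : ∀ l, fam c l ⊆ fam d l) {l : ℕ}
    {a : T.hg.face l} (ha : a ∈ fam d l) (ha' : a ∉ fam c l) : cellSize c < cellSize d := by
  have := finite_Face T.hg
  exact Set.ncard_lt_ncard ⟨fun f hf => h _ hf, fun h' => ha' (h' (show (⟨l, a⟩ : T.hg.Face) ∈ _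
    from ha))⟩

theorem cellSize_lt_or_eq {n : ℕ} {c d : StarCell T n} (h : ∀ l, fam c l ⊆ fam d l) :
    cellSize c < cellSize d ∨ c = d := by
  by_cases h' : ∀ l, fam d l ⊆ fam c l
  · exact Or.inr (fam_injective (funext fun l => subset_antisymm (h l) (h' l)))
  · push Not at h'
    obtain ⟨l, hl⟩ := h'
    obtain ⟨a, ha, ha'⟩ := Set.not_subset.1 hl
    exact Or.inl (cellSize_lt h ha ha')

theorem exists_cmp_of_isCut {n k : ℕ} (h : k < n) (c : StarCell T n) {W : Fam T.hg}
    (hW : (fam c).IsCut k W) : ∃ (x y : StarCell T n)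
      (e : (starCat T).dom h x = (starCat T).cod h y), c = (starCat T).cmp h x y e ∧
      (∀ l, k < l → fam x l = fam c l \ W l) ∧ (∀ l, k < l → fam y l = fam c l ∩ W l) := by
  refine ⟨mkCell _ ((fam_isCell c).high T.isCardinal hW) fun l hl => ?_,
    mkCell _ ((fam_isCell c).low T.isCardinal hW) fun l hl => ?_,
    fam_injective dom_high_eq_cod_low, fam_injective (union_high_low hW).symm, ?_, ?_⟩
  · ext x
    refine ⟨fun hx => ?_, fun hx => hx.elim⟩
    rw [← fam_empty c hl]; exact hx.1
  · ext x
    refine ⟨fun hx => ?_, fun hx => hx.elim⟩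
    rw [← fam_empty c hl]; exact hx.1
  · intro l hl
    ext x
    exact ⟨fun hx => ⟨hx.1, hx.2.1 hl⟩, fun hx => ⟨hx.1, fun _ => hx.2, by omega, by omega⟩⟩
  · intro l hl
    ext x
    exact ⟨fun hx => ⟨hx.1, hx.2.1 hl⟩, fun hx => ⟨hx.1, fun _ => hx.2, by omega⟩⟩

theorem exists_smaller_cmp {n k : ℕ} (h : k < n) (c : StarCell T n) {W : Fam T.hg}
    (hW : (fam c).IsCut k W) (ha : ∃ a ∈ fam c (k + 1), a ∉ W (k + 1))
    (hb : ∃ b ∈ fam c (k + 1), b ∈ W (k + 1)) : ∃ (x y : StarCell T n)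
      (e : (starCat T).dom h x = (starCat T).cod h y), c = (starCat T).cmp h x y e ∧
      cellSize x < cellSize c ∧ cellSize y < cellSize c := by
  obtain ⟨x, y, e, rfl, h1, h2⟩ := exists_cmp_of_isCut h c hW
  obtain ⟨a, ha, haW⟩ := ha
  obtain ⟨b, hb, hbW⟩ := hb
  refine ⟨x, y, e, rfl, cellSize_lt (fun l => Set.subset_union_left) hb ?_,
    cellSize_lt (fun l => Set.subset_union_right) ha ?_⟩
  · rw [h1 _ (by omega)]
    exact fun h => h.2 hbW
  · rw [h2 _ (by omega)]
    exact fun h => haW h.2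

/-- The case analysis behind the inductions on cells: without `n`-faces a cell is an identity, and
otherwise it is a generator or a composite of cells with fewer faces. -/
theorem star_cases {n : ℕ} (c : StarCell T n) :
    (0 < n ∧ fam c n = ∅) ∨ (∃ x, c = genCell x) ∨ ∃ (k : ℕ) (h : k < n) (x y : StarCell T n)
      (e : (starCat T).dom h x = (starCat T).cod h y), c = (starCat T).cmp h x y e ∧
      cellSize x < cellSize c ∧ cellSize y < cellSize c := by
  rcases (fam c n).eq_empty_or_nonempty with h | ⟨x, hx⟩
  · refine Or.inl ⟨Nat.pos_of_ne_zero ?_, h⟩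
    rintro rfl
    exact (fam_isCell c).nonempty.ne_empty h
  · rcases eq_genFam_or_exists_cut T.isCardinal (fam_isCell c) (fun l hl => fam_empty c hl) hx with
      h | ⟨k, hk, W, hW, ha, hb⟩
    · exact Or.inr (Or.inl ⟨x, fam_injective h⟩)
    · exact Or.inr (Or.inr ⟨k, hk, exists_smaller_cmp hk c hW ha hb⟩)

theorem exists_idt_of_empty {n : ℕ} (c : StarCell T (n + 1)) (h : fam c (n + 1) = ∅) :
    ∃ x : StarCell T n, c = (starCat T).idt x ∧ fam c = fam x := by
  refine ⟨mkCell (fam c) (fam_isCell c) fun l hl => ?_, fam_injective rfl, rfl⟩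
  rcases Nat.lt_or_ge (n + 1) l with hl' | hl'
  · exact fam_empty c hl'
  · obtain rfl : l = n + 1 := by omega
    exact h

theorem exists_idIter_of_empty {k n : ℕ} (hk : k ≤ n) (c : StarCell T n)
    (h : ∀ l, k < l → fam c l = ∅) :
    ∃ x : StarCell T k, c = (starCat T).idIter hk x ∧ fam c = fam x :=
  ⟨mkCell (fam c) (fam_isCell c) h,
    fam_injective (Eq.symm (star_idIter_fam hk (mkCell (fam c) (fam_isCell c) h))), rfl⟩

/-- Induction on cells. -/
theorem star_induction {P : ∀ n, StarCell T n → Prop}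
    (idt : ∀ n (x : StarCell T n), P n x → P (n + 1) ((starCat T).idt x))
    (gen : ∀ n (x : T.hg.face n), (∀ m, m < n → ∀ c, P m c) → P n (genCell x))
    (cmp : ∀ n k (h : k < n) (x y : StarCell T n)
      (e : (starCat T).dom h x = (starCat T).cod h y), (∀ m, m < n → ∀ c, P m c) →
      P n x → P n y → P n ((starCat T).cmp h x y e))
    (n : ℕ) (c : StarCell T n) : P n c := by
  induction n using Nat.strong_induction_on with
  | _ n ih =>
    obtain ⟨s, hs⟩ : ∃ s, cellSize c = s := ⟨_, rfl⟩
    induction s using Nat.strong_induction_on generalizing c with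
    | _ s ihs =>
      rcases star_cases c with ⟨hn, h⟩ | ⟨x, rfl⟩ | ⟨k, h, x, y, e, rfl, h1, h2⟩
      · obtain ⟨m, rfl⟩ : ∃ m, n = m + 1 := ⟨n - 1, by omega⟩
        obtain ⟨x, rfl, -⟩ := exists_idt_of_empty c h
        exact idt m x (ih m (by omega) x)
      · exact gen n x ih
      · exact cmp n k h x y e ih (ihs _ (hs ▸ h1) x rfl) (ihs _ (hs ▸ h2) y rfl)

theorem genCell_cod {n : ℕ} (x : T.hg.face (n + 1)) :
    (starCat T).cod (Nat.lt_succ_self n) (genCell x) = genCell (T.hg.γ x) :=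
  fam_injective (genFam_cod T.isCardinal x)

end


/-! ## Freeness -/

theorem OmegaCat.cmp_congr (D : OmegaCat.{u}) {k n : ℕ} (h : k < n) {x y x' y' : D.cell n}
    (hx : x = x') (hy : y = y') (e : D.dom h x = D.cod h y) (e' : D.dom h x' = D.cod h y') :
    D.cmp h x y e = D.cmp h x' y' e' := by
  subst hx hy
  rfl

theorem TruncFunctor.map_idIter {m : ℕ} {C D : OmegaCat.{u}} (F : TruncFunctor m C D) {k n : ℕ}
    (h : k ≤ n) (hn : n ≤ m) (x : C.cell k) :
    F.map n hn (C.idIter h x) = D.idIter h (F.map k (h.trans hn) x) := by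
  induction n, h using Nat.le_induction with
  | base => rw [OmegaData.idIter_self, OmegaData.idIter_self]
  | succ n h ih =>
    rw [OmegaData.idIter_succ _ h, OmegaData.idIter_succ _ h, F.map_idt hn, ih]

section

variable {T : POpe.{u}} {m : ℕ} {D : OmegaCat.{u}} (F : TruncFunctor m (starCat T) D)
  (φ : T.hg.face (m + 1) → D.cell (m + 1))

/-- `Val F φ c v` says that `v` is the value of an expression for `c` in terms of identities and
generators. -/
inductive Val : StarCell T (m + 1) → D.cell (m + 1) → Prop
  | idt (x : StarCell T m) : Val ((starCat T).idt x) (D.idt (F.map m le_rfl x))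
  | gen (x : T.hg.face (m + 1)) : Val (genCell x) (φ x)
  | cmp {k : ℕ} (h : k < m + 1) (x y : StarCell T (m + 1)) (v w : D.cell (m + 1))
    (e : (starCat T).dom h x = (starCat T).cod h y) (e' : D.dom h v = D.cod h w) :
    Val x v → Val y w → Val ((starCat T).cmp h x y e) (D.cmp h v w e')

variable (hd : ∀ x, D.dom (Nat.lt_succ_self m) (φ x) =
    F.map m le_rfl ((starCat T).dom (Nat.lt_succ_self m) (genCell x)))
  (hc : ∀ x, D.cod (Nat.lt_succ_self m) (φ x) =
    F.map m le_rfl ((starCat T).cod (Nat.lt_succ_self m) (genCell x)))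

variable {F φ}

section
include hd hc

/-- Boundaries of values are forced by `F`, so values of composable cells are composable whichever
expressions produced them. -/
theorem Val.dom_cod {c : StarCell T (m + 1)} {v : D.cell (m + 1)} (hv : Val F φ c v) :
    D.dom (Nat.lt_succ_self m) v = F.map m le_rfl ((starCat T).dom (Nat.lt_succ_self m) c) ∧
    D.cod (Nat.lt_succ_self m) v = F.map m le_rfl ((starCat T).cod (Nat.lt_succ_self m) c) := by
  induction hv with
  | idt x => rw [D.dom_idt, D.cod_idt, (starCat T).dom_idt, (starCat T).cod_idt]; exact ⟨rfl, rfl⟩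
  | gen x => exact ⟨hd x, hc x⟩
  | @cmp k h x y v w e e' _ _ ihx ihy =>
    rcases Nat.lt_or_ge k m with hk | hk
    · have ed : (starCat T).dom hk ((starCat T).dom (Nat.lt_succ_self m) x) =
          (starCat T).cod hk ((starCat T).dom (Nat.lt_succ_self m) y) := by
        rw [(starCat T).dom_dom, (starCat T).cod_dom]; exact e
      have ec : (starCat T).dom hk ((starCat T).cod (Nat.lt_succ_self m) x) =
          (starCat T).cod hk ((starCat T).cod (Nat.lt_succ_self m) y) := by
        rw [(starCat T).dom_cod, (starCat T).cod_cod]; exact e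
      have ed' : D.dom hk (D.dom (Nat.lt_succ_self m) v) =
          D.cod hk (D.dom (Nat.lt_succ_self m) w) := by
        rw [D.dom_dom, D.cod_dom]; exact e'
      have ec' : D.dom hk (D.cod (Nat.lt_succ_self m) v) =
          D.cod hk (D.cod (Nat.lt_succ_self m) w) := by
        rw [D.dom_cod, D.cod_cod]; exact e'
      constructor
      · rw [D.dom_cmp hk (Nat.lt_succ_self m) v w e' ed',
          (starCat T).dom_cmp hk (Nat.lt_succ_self m) x y e ed,
          F.map_cmp hk le_rfl _ _ ed (by rw [← ihx.1, ← ihy.1]; exact ed')]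
        exact D.cmp_congr hk ihx.1 ihy.1 _ _
      · rw [D.cod_cmp hk (Nat.lt_succ_self m) v w e' ec',
          (starCat T).cod_cmp hk (Nat.lt_succ_self m) x y e ec,
          F.map_cmp hk le_rfl _ _ ec (by rw [← ihx.2, ← ihy.2]; exact ec')]
        exact D.cmp_congr hk ihx.2 ihy.2 _ _
    · obtain rfl : k = m := by omega
      rw [D.dom_cmp_self, D.cod_cmp_self, (starCat T).dom_cmp_self, (starCat T).cod_cmp_self]
      exact ⟨ihy.1, ihx.2⟩

theorem Val.dom {c : StarCell T (m + 1)} {v : D.cell (m + 1)} (hv : Val F φ c v) {k : ℕ}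
    (h : k < m + 1) : D.dom h v = F.map k (by omega) ((starCat T).dom h c) := by
  rcases Nat.lt_or_ge k m with hk | hk
  · rw [← D.dom_dom hk (Nat.lt_succ_self m), (hv.dom_cod hd hc).1, ← F.map_dom,
      (starCat T).dom_dom]
  · obtain rfl : k = m := by omega
    exact (hv.dom_cod hd hc).1

theorem Val.cod {c : StarCell T (m + 1)} {v : D.cell (m + 1)} (hv : Val F φ c v) {k : ℕ}
    (h : k < m + 1) : D.cod h v = F.map k (by omega) ((starCat T).cod h c) := by
  rcases Nat.lt_or_ge k m with hk | hk
  · rw [← D.cod_cod hk (Nat.lt_succ_self m), (hv.dom_cod hd hc).2, ← F.map_cod,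
      (starCat T).cod_cod]
  · obtain rfl : k = m := by omega
    exact (hv.dom_cod hd hc).2

theorem Val.composable {c c' : StarCell T (m + 1)} {v v' : D.cell (m + 1)} (hv : Val F φ c v)
    (hv' : Val F φ c' v') {k : ℕ} {h : k < m + 1}
    (e : (starCat T).dom h c = (starCat T).cod h c') : D.dom h v = D.cod h v' := by
  rw [hv.dom hd hc, hv'.cod hd hc, e]

theorem Val.exists (c : StarCell T (m + 1)) : ∃ v, Val F φ c v := by
  obtain ⟨s, hs⟩ : ∃ s, cellSize c = s := ⟨_, rfl⟩
  induction s using Nat.strong_induction_on generalizing c with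
  | _ s ih =>
    rcases star_cases c with ⟨-, h⟩ | ⟨x, rfl⟩ | ⟨k, h, x, y, e, rfl, h1, h2⟩
    · obtain ⟨x, rfl, -⟩ := exists_idt_of_empty c h
      exact ⟨_, Val.idt x⟩
    · exact ⟨_, Val.gen x⟩
    · obtain ⟨v, hv⟩ := ih _ (hs ▸ h1) x rfl
      obtain ⟨w, hw⟩ := ih _ (hs ▸ h2) y rfl
      exact ⟨_, Val.cmp h x y v w e (hv.composable hd hc hw e) hv hw⟩

end

/-- The values of identities are identities. -/
theorem Val.eq_idt {c : StarCell T (m + 1)} {v : D.cell (m + 1)} (hv : Val F φ c v)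
    (h : fam c (m + 1) = ∅) (x : StarCell T m) (hx : fam c = fam x) :
    v = D.idt (F.map m le_rfl x) := by
  induction hv generalizing x with
  | idt y =>
    obtain rfl : y = x := fam_injective hx
    rfl
  | gen y =>
    have := self_mem_genFam y
    rw [← fam_genCell, h] at this
    exact this.elim
  | @cmp k hk c c' v w e e' _ _ ih ih' =>
    have hU : fam c (m + 1) ∪ fam c' (m + 1) = ∅ := h
    rw [Set.union_empty_iff] at hU
    obtain ⟨y, rfl, hy⟩ := exists_idt_of_empty c hU.1
    obtain ⟨y', rfl, hy'⟩ := exists_idt_of_empty c' hU.2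
    obtain rfl := ih hU.1 y hy
    obtain rfl := ih' hU.2 y' hy'
    rcases Nat.lt_or_ge k m with hkm | hkm
    · have e1 : (starCat T).dom hkm y = (starCat T).cod hkm y' := by
        rw [← (starCat T).dom_dom hkm (Nat.lt_succ_self m), ← (starCat T).cod_cod hkm
          (Nat.lt_succ_self m), (starCat T).dom_idt, (starCat T).cod_idt] at e
        exact e
      obtain rfl : x = (starCat T).cmp hkm y y' e1 := fam_injective hx.symm
      rw [F.map_cmp hkm le_rfl y y' e1 (by rw [← F.map_dom, ← F.map_cod, e1])]
      rw [D.idt_of_cmp hkm _ _ _ e']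
    · obtain rfl : k = m := by omega
      rw [(starCat T).dom_idt, (starCat T).cod_idt] at e
      subst e
      obtain rfl : x = y := fam_injective (hx.symm.trans (funext fun l => Set.union_self _))
      -- Composing an identity with itself along its own boundary is a unit law. Abstracting the
      -- second factor as `z` avoids rewriting under the composability proof.
      have key : ∀ (z : D.cell (k + 1)) (_ : z = D.idt (F.map k le_rfl x))
          (e : D.dom (Nat.lt_succ_self k) (D.idt (F.map k le_rfl x)) =
            D.cod (Nat.lt_succ_self k) z),
          D.cmp (Nat.lt_succ_self k) (D.idt (F.map k le_rfl x)) z e =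
            D.idt (F.map k le_rfl x) := by
        intro z hz e
        have hz' : D.idIter (Nat.le_succ k) (D.dom (Nat.lt_succ_self k)
            (D.idt (F.map k le_rfl x))) = D.idt (F.map k le_rfl x) := by
          rw [D.dom_idt, OmegaData.idIter_succ _ le_rfl, OmegaData.idIter_self]
        obtain rfl : D.idIter (Nat.le_succ k) (D.dom (Nat.lt_succ_self k)
            (D.idt (F.map k le_rfl x))) = z := hz'.trans hz.symm
        exact D.cmp_idt (Nat.lt_succ_self k) (D.idt (F.map k le_rfl x)) e
      exact key _ rfl _

/-- The value of an iterated identity. -/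
theorem Val.eq_idIter {c : StarCell T (m + 1)} {v : D.cell (m + 1)} (hv : Val F φ c v) {k : ℕ}
    (hk : k < m + 1) (h : ∀ l, k < l → fam c l = ∅) (x : StarCell T k) (hx : fam c = fam x) :
    v = D.idIter hk.le (F.map k (by omega) x) := by
  have hkm : k ≤ m := by omega
  rw [hv.eq_idt (h _ hk) ((starCat T).idIter hkm x) (hx.trans (star_idIter_fam hkm x).symm),
    F.map_idIter hkm le_rfl, OmegaData.idIter_succ _ hkm]

end


/-! ### Uniqueness of values -/

section

variable {T : POpe.{u}}

theorem star_disjoint {k n : ℕ} {h : k < n} {x y : StarCell T n}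
    (e : (starCat T).dom h x = (starCat T).cod h y) {l : ℕ} (hl : k < l) {a : T.hg.face l}
    (ha : a ∈ fam x l) : a ∉ fam y l :=
  fun hb => disjoint_of_composable T.isCardinal (fam_isCell x) (fam_isCell y) (congrArg fam e) hl
    ha hb

theorem star_cmp_isCut {k n : ℕ} {h : k < n} {x y : StarCell T n}
    (e : (starCat T).dom h x = (starCat T).cod h y) :
    (fam (T := T) ((starCat T).cmp h x y e)).IsCut k (fam y) :=
  isCut_of_composable T.isCardinal (fam_isCell x) (fam_isCell y) (congrArg fam e)

theorem star_eq_of_cmp_eq {k n : ℕ} {h : k < n} {x y x' y' : StarCell T n}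
    {e : (starCat T).dom h x = (starCat T).cod h y}
    {e' : (starCat T).dom h x' = (starCat T).cod h y'}
    (hS : (starCat T).cmp h x y e = (starCat T).cmp h x' y' e')
    (hW : ∀ l, k < l → fam y l = fam y' l) : x = x' ∧ y = y' := by
  have := eq_of_composable T.isCardinal (fam_isCell x) (fam_isCell y) (congrArg fam e)
    (fam_isCell x') (fam_isCell y') (congrArg fam e') (congrArg fam hS) hW
  exact ⟨fam_injective this.1, fam_injective this.2⟩

variable {m : ℕ} {D : OmegaCat.{u}} {F : TruncFunctor m (starCat T) D}
  {φ : T.hg.face (m + 1) → D.cell (m + 1)}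
  (hd : ∀ x, D.dom (Nat.lt_succ_self m) (φ x) =
    F.map m le_rfl ((starCat T).dom (Nat.lt_succ_self m) (genCell x)))
  (hc : ∀ x, D.cod (Nat.lt_succ_self m) (φ x) =
    F.map m le_rfl ((starCat T).cod (Nat.lt_succ_self m) (genCell x)))

include hd hc

/-- If the composite equals `x`, disjointness leaves `y` no faces above `k`. Its value is then an
iterated identity and is absorbed by the unit law. -/
theorem Val.cmp_eq_left {x y : StarCell T (m + 1)} {v w : D.cell (m + 1)} (hv : Val F φ x v)
    (hw : Val F φ y w) {k : ℕ} {h : k < m + 1} (e : (starCat T).dom h x = (starCat T).cod h y)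
    (e' : D.dom h v = D.cod h w) (hxc : x = (starCat T).cmp h x y e) : D.cmp h v w e' = v := by
  have hy : ∀ l, k < l → fam y l = ∅ := by
    intro l hl
    ext a
    refine ⟨fun ha => ?_, fun ha => ha.elim⟩
    have : a ∈ fam x l := by rw [hxc]; exact Or.inr ha
    exact (star_disjoint e hl this ha).elim
  have hy' : fam y = fam (T := T) ((starCat T).dom h x) := by
    rw [e]; exact (Fam.cod_eq_self hy).symm
  have hw' := hw.eq_idIter h hy _ hy'
  rw [← hv.dom hd hc] at hw'
  subst hw'
  exact D.cmp_idt h v e'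

theorem Val.cmp_eq_right {x y : StarCell T (m + 1)} {v w : D.cell (m + 1)} (hv : Val F φ x v)
    (hw : Val F φ y w) {k : ℕ} {h : k < m + 1} (e : (starCat T).dom h x = (starCat T).cod h y)
    (e' : D.dom h v = D.cod h w) (hyc : y = (starCat T).cmp h x y e) : D.cmp h v w e' = w := by
  have hx : ∀ l, k < l → fam x l = ∅ := by
    intro l hl
    ext a
    refine ⟨fun ha => ?_, fun ha => ha.elim⟩
    have : a ∈ fam y l := by rw [hyc]; exact Or.inl ha
    exact (star_disjoint e hl ha this).elim
  have hx' : fam x = fam (T := T) ((starCat T).cod h y) := by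
    rw [← e]; exact (Fam.dom_eq_self hx).symm
  have hv' := hv.eq_idIter h hx _ hx'
  rw [← hw.cod hd hc] at hv'
  subst hv'
  exact D.idt_cmp h w e'

/-- Every value is that of a generator, of an identity, or of a nontrivial composite. -/
theorem Val.normal {c : StarCell T (m + 1)} {v : D.cell (m + 1)} (hv : Val F φ c v) :
    (∃ x, c = genCell x ∧ v = φ x) ∨ fam c (m + 1) = ∅ ∨
    ∃ (k : ℕ) (h : k < m + 1) (x y : StarCell T (m + 1)) (vx vy : D.cell (m + 1))
      (e : (starCat T).dom h x = (starCat T).cod h y) (e' : D.dom h vx = D.cod h vy),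
      Val F φ x vx ∧ Val F φ y vy ∧ c = (starCat T).cmp h x y e ∧ v = D.cmp h vx vy e' ∧
      cellSize x < cellSize c ∧ cellSize y < cellSize c := by
  induction hv with
  | idt x => exact Or.inr (Or.inl (fam_empty x (Nat.lt_succ_self m)))
  | gen x => exact Or.inl ⟨x, rfl, rfl⟩
  | @cmp k h x y v w e e' hv hw ihx ihy =>
    rcases cellSize_lt_or_eq (c := x) (d := (starCat T).cmp h x y e)
      (fun l => Set.subset_union_left) with hx | hx
    · rcases cellSize_lt_or_eq (c := y) (d := (starCat T).cmp h x y e)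
        (fun l => Set.subset_union_right) with hy | hy
      · exact Or.inr (Or.inr ⟨k, h, x, y, v, w, e, e', hv, hw, rfl, rfl, hx, hy⟩)
      · rw [Val.cmp_eq_right hd hc hv hw e e' hy, ← hy]
        exact ihy
    · rw [Val.cmp_eq_left hd hc hv hw e e' hx, ← hx]
      exact ihx

/-- Compatibility of decompositions along cells of different dimensions. -/
theorem Val.confluence_of_lt {c : StarCell T (m + 1)}
    (hF : ∀ z, cellSize z < cellSize c → ∀ v v', Val F φ z v → Val F φ z v' → v = v')
    {l k : ℕ} (hlk : l < k) {h : k < m + 1} {h' : l < m + 1} {x y x' y' : StarCell T (m + 1)}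
    {e : (starCat T).dom h x = (starCat T).cod h y}
    {e' : (starCat T).dom h' x' = (starCat T).cod h' y'}
    (hxy : c = (starCat T).cmp h x y e) (hxy' : c = (starCat T).cmp h' x' y' e')
    (hx : cellSize x < cellSize c) (hy : cellSize y < cellSize c)
    (hx' : cellSize x' < cellSize c) (hy' : cellSize y' < cellSize c)
    {vx vy vx' vy' : D.cell (m + 1)} (hvx : Val F φ x vx) (hvy : Val F φ y vy)
    (hvx' : Val F φ x' vx') (hvy' : Val F φ y' vy')
    (ed : D.dom h vx = D.cod h vy) (ed' : D.dom h' vx' = D.cod h' vy') :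
    D.cmp h vx vy ed = D.cmp h' vx' vy' ed' := by
  -- The lower-level cut `y'` also cuts `x` and `y`, giving a two-by-two array of cells `x1`, `x2`,
  -- `y1`, `y2`.
  have hcut : (fam c).IsCut l (fam y') := by rw [hxy']; exact star_cmp_isCut e'
  have hcx : (fam x).IsCut l (fam y') := hcut.mono fun j _ => by
    rw [hxy]; exact Set.subset_union_left
  have hcy : (fam y).IsCut l (fam y') := hcut.mono fun j _ => by
    rw [hxy]; exact Set.subset_union_right
  obtain ⟨x1, x2, ex, hx12, hx1, hx2⟩ := exists_cmp_of_isCut h' x hcx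
  obtain ⟨y1, y2, ey, hy12, hy1, hy2⟩ := exists_cmp_of_isCut h' y hcy
  -- the common boundary decomposes compatibly
  have ex' : (starCat T).dom hlk ((starCat T).dom h x1) =
      (starCat T).cod hlk ((starCat T).dom h x2) := by
    rw [(starCat T).dom_dom, (starCat T).cod_dom]; exact ex
  have ey' : (starCat T).dom hlk ((starCat T).cod h y1) =
      (starCat T).cod hlk ((starCat T).cod h y2) := by
    rw [(starCat T).dom_cod, (starCat T).cod_cod]; exact ey
  have hM : (starCat T).cmp hlk _ _ ex' = (starCat T).cmp hlk _ _ ey' := by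
    rw [← (starCat T).dom_cmp hlk h x1 x2 ex ex', ← (starCat T).cod_cmp hlk h y1 y2 ey ey',
      ← hx12, ← hy12, e]
  have hsub1 : ∀ j, l < j → fam (T := T) ((starCat T).dom h x2) j =
      fam (T := T) ((starCat T).cmp hlk _ _ ex') j ∩ fam y' j := by
    intro j hj
    ext a
    constructor
    · intro ha
      refine ⟨Or.inr ha, ?_⟩
      have : a ∈ fam x2 j := (Fam.mem_dom.1 ha).1
      rw [hx2 j hj] at this
      exact this.2
    · rintro ⟨ha | ha, ha'⟩
      · have : a ∈ fam x1 j := (Fam.mem_dom.1 ha).1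
        rw [hx1 j hj] at this
        exact (this.2 ha').elim
      · exact ha
  have hsub2 : ∀ j, l < j → fam (T := T) ((starCat T).cod h y2) j =
      fam (T := T) ((starCat T).cmp hlk _ _ ey') j ∩ fam y' j := by
    intro j hj
    ext a
    constructor
    · intro ha
      refine ⟨Or.inr ha, ?_⟩
      have : a ∈ fam y2 j := (Fam.mem_cod.1 ha).1
      rw [hy2 j hj] at this
      exact this.2
    · rintro ⟨ha | ha, ha'⟩
      · have : a ∈ fam y1 j := (Fam.mem_cod.1 ha).1
        rw [hy1 j hj] at this
        exact (this.2 ha').elim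
      · exact ha
  -- The common `k`-boundary inherits an `l`-decomposition from each side. Both have the same faces
  -- of `y'` above `l`, so they agree, and the pieces are composable along `k`.
  obtain ⟨e1, e2⟩ := star_eq_of_cmp_eq hM (fun j hj => by rw [hsub1 j hj, hsub2 j hj, hM])
  -- interchange
  have e3 : (starCat T).dom h' ((starCat T).cmp h x1 y1 e1) =
      (starCat T).cod h' ((starCat T).cmp h x2 y2 e2) := by
    rw [← (starCat T).dom_dom hlk h, ← (starCat T).cod_cod hlk h, (starCat T).dom_cmp_self,
      (starCat T).cod_cmp_self, (starCat T).dom_dom, (starCat T).cod_cod, ey,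
      ← (starCat T).cod_cod hlk h y2, ← e2, (starCat T).cod_dom]
  have hc12 : (starCat T).cmp h' _ _ e3 = (starCat T).cmp h' x' y' e' := by
    rw [← hxy', hxy]
    refine fam_injective ?_
    have hx12' : fam x = (fam x1).union (fam x2) := congrArg fam hx12
    have hy12' : fam y = (fam y1).union (fam y2) := congrArg fam hy12
    rw [star_cmp_fam, star_cmp_fam, star_cmp_fam, star_cmp_fam, hx12', hy12']
    exact funext fun j => Set.union_union_union_comm _ _ _ _
  obtain ⟨hp, hq⟩ := star_eq_of_cmp_eq hc12 (fun j hj => by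
    change fam x2 j ∪ fam y2 j = _
    rw [hx2 j hj, hy2 j hj, ← Set.union_inter_distrib_right]
    have hcc : fam x j ∪ fam y j = fam x' j ∪ fam y' j := by
      have := congrArg (fun z => fam z j) (hxy.symm.trans hxy')
      exact this
    rw [hcc, Set.inter_eq_right]
    exact Set.subset_union_right)
  subst hp hq
  obtain ⟨v1, hv1⟩ := Val.exists hd hc x1
  obtain ⟨v2, hv2⟩ := Val.exists hd hc x2
  obtain ⟨w1, hw1⟩ := Val.exists hd hc y1
  obtain ⟨w2, hw2⟩ := Val.exists hd hc y2
  have d1 := hv1.composable hd hc hv2 ex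
  have d2 := hw1.composable hd hc hw2 ey
  have d3 := hv1.composable hd hc hw1 e1
  have d4 := hv2.composable hd hc hw2 e2
  subst hx12 hy12
  -- All four given factors are smaller than `c`, so their values may be computed from the array;
  -- the claim becomes interchange in `D`.
  obtain rfl := hF _ hx _ _ hvx (Val.cmp h' x1 x2 v1 v2 ex d1 hv1 hv2)
  obtain rfl := hF _ hy _ _ hvy (Val.cmp h' y1 y2 w1 w2 ey d2 hw1 hw2)
  obtain rfl := hF _ hx' _ _ hvx' (Val.cmp h x1 y1 v1 w1 e1 d3 hv1 hw1)
  obtain rfl := hF _ hy' _ _ hvy' (Val.cmp h x2 y2 v2 w2 e2 d4 hv2 hw2)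
  exact (D.interchange hlk h v1 w1 v2 w2 d3 d4 ed' d1 d2 ed).symm

/-- Compatibility with a larger cut at the same level. -/
theorem Val.nested {c : StarCell T (m + 1)}
    (hF : ∀ z, cellSize z < cellSize c → ∀ v v', Val F φ z v → Val F φ z v' → v = v')
    {k : ℕ} {h : k < m + 1} {x y : StarCell T (m + 1)}
    {e : (starCat T).dom h x = (starCat T).cod h y}
    (hxy : c = (starCat T).cmp h x y e) (hx : cellSize x < cellSize c)
    {vx vy : D.cell (m + 1)} (hvx : Val F φ x vx) (hvy : Val F φ y vy)
    (ed : D.dom h vx = D.cod h vy) {U : Fam T.hg} (hU : (fam c).IsCut k U)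
    (hyU : ∀ j, k < j → fam y j ⊆ U j) :
    ∃ (p q : StarCell T (m + 1)) (vp vq : D.cell (m + 1))
      (e' : (starCat T).dom h p = (starCat T).cod h q) (ed' : D.dom h vp = D.cod h vq),
      c = (starCat T).cmp h p q e' ∧ Val F φ p vp ∧ Val F φ q vq ∧
      (∀ j, k < j → fam q j = fam c j ∩ U j) ∧ D.cmp h vx vy ed = D.cmp h vp vq ed' ∧
      cellSize p < cellSize c := by
  have hcx : (fam x).IsCut k U := hU.mono fun j _ => by
    rw [hxy]; exact Set.subset_union_left
  obtain ⟨x1, x2, ex, rfl, hx1, hx2⟩ := exists_cmp_of_isCut h x hcx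
  -- Only `x` has to be split; its part `x2` inside `U` is moved onto `y` by associativity.
  have e1 : (starCat T).dom h x2 = (starCat T).cod h y := by
    rw [← e, (starCat T).dom_cmp_self]
  have e2 : (starCat T).dom h x1 = (starCat T).cod h ((starCat T).cmp h x2 y e1) := by
    rw [ex, (starCat T).cod_cmp_self]
  obtain ⟨v1, hv1⟩ := Val.exists hd hc x1
  obtain ⟨v2, hv2⟩ := Val.exists hd hc x2
  have d1 := hv1.composable hd hc hv2 ex
  have d2 := hv2.composable hd hc hvy e1
  have hq := Val.cmp h x2 y v2 vy e1 d2 hv2 hvy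
  have d3 := hv1.composable hd hc hq e2
  obtain rfl := hF _ hx _ _ hvx (Val.cmp h x1 x2 v1 v2 ex d1 hv1 hv2)
  refine ⟨x1, _, v1, _, e2, d3, ?_, hv1, hq, ?_, D.cmp_assoc h v1 v2 vy d1 d2 ed d3, ?_⟩
  · rw [hxy, (starCat T).cmp_assoc h x1 x2 y ex e1 e e2]
  · intro j hj
    have hcj : fam c j = (fam x1 j ∪ fam x2 j) ∪ fam y j := by rw [hxy]; rfl
    change fam x2 j ∪ fam y j = _
    ext a
    constructor
    · rintro (ha | ha)
      · refine ⟨hcj ▸ Or.inl (Or.inr ha), ?_⟩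
        rw [hx2 j hj] at ha
        exact ha.2
      · exact ⟨hcj ▸ Or.inr ha, hyU j hj ha⟩
    · rintro ⟨ha, haU⟩
      rw [hcj] at ha
      rcases ha with (ha | ha) | ha
      · rw [hx1 j hj] at ha
        exact (ha.2 haU).elim
      · exact Or.inl ha
      · exact Or.inr ha
  · exact (cellSize_le fun j => Set.subset_union_left).trans_lt hx

/-- Compatibility of any two nontrivial decompositions. -/
theorem Val.confluence {c : StarCell T (m + 1)}
    (hF : ∀ z, cellSize z < cellSize c → ∀ v v', Val F φ z v → Val F φ z v' → v = v')
    {l k : ℕ} {h : k < m + 1} {h' : l < m + 1} {x y x' y' : StarCell T (m + 1)}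
    {e : (starCat T).dom h x = (starCat T).cod h y}
    {e' : (starCat T).dom h' x' = (starCat T).cod h' y'}
    (hxy : c = (starCat T).cmp h x y e) (hxy' : c = (starCat T).cmp h' x' y' e')
    (hx : cellSize x < cellSize c) (hy : cellSize y < cellSize c)
    (hx' : cellSize x' < cellSize c) (hy' : cellSize y' < cellSize c)
    {vx vy vx' vy' : D.cell (m + 1)} (hvx : Val F φ x vx) (hvy : Val F φ y vy)
    (hvx' : Val F φ x' vx') (hvy' : Val F φ y' vy')
    (ed : D.dom h vx = D.cod h vy) (ed' : D.dom h' vx' = D.cod h' vy') :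
    D.cmp h vx vy ed = D.cmp h' vx' vy' ed' := by
  rcases lt_trichotomy l k with hlk | rfl | hlk
  · exact Val.confluence_of_lt hd hc hF hlk hxy hxy' hx hy hx' hy' hvx hvy hvx' hvy' ed ed'
  -- If no lower level has a nontrivial cut, the union of the two cuts is still proper, and both
  -- composites can be enlarged to it.
  · by_cases hlow : ∀ j, j < l → ∀ W, (fam c).IsCut j W → (∃ a ∈ fam c (j + 1), a ∉ W (j + 1)) →
      ¬ ∃ b ∈ fam c (j + 1), b ∈ W (j + 1)
    -- If `y` contained all `(l+1)`-faces of `c`, then `x` would have no faces above `l` and would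
    -- reduce to the codomain of `y`, so `c` would be no larger than `y`.
    · have hne : ∀ {x y : StarCell T (m + 1)} {e : (starCat T).dom h x = (starCat T).cod h y},
          c = (starCat T).cmp h x y e → cellSize y < cellSize c →
          ∃ a ∈ fam c (l + 1), a ∉ fam y (l + 1) := by
        intro x y e hxy hy
        by_contra hcon
        push Not at hcon
        have hxe : fam x (l + 1) = ∅ := by
          ext a
          refine ⟨fun ha => ?_, fun ha => ha.elim⟩
          refine (star_disjoint e (Nat.lt_succ_self l) ha (hcon a ?_)).elim
          rw [hxy]; exact Or.inl ha
        have hxe' : ∀ j, l < j → fam x j = ∅ := by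
          intro j hj
          induction j, hj using Nat.le_induction with
          | base => exact hxe
          | succ j hj ih =>
            ext a
            refine ⟨fun ha => ?_, fun ha => ha.elim⟩
            have := (fam_isCell x).γ_mem ha
            rw [ih] at this
            exact this
        have hxd : fam x = fam (T := T) ((starCat T).cod h y) := by
          rw [← e]; exact (Fam.dom_eq_self hxe').symm
        have : cellSize c ≤ cellSize y := by
          refine cellSize_le fun j a ha => ?_
          rw [hxy] at ha
          rcases ha with ha | ha
          · rw [hxd] at ha
            exact (Fam.mem_cod.1 ha).1
          · exact ha
        omega
      have hcut : (fam c).IsCut l (fam y) := by rw [hxy]; exact star_cmp_isCut e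
      have hcut' : (fam c).IsCut l (fam y') := by rw [hxy']; exact star_cmp_isCut e'
      obtain ⟨a, ha, hay, hay'⟩ := exists_notMem_union T.isCardinal (fam_isCell c) hcut hcut' hlow
        (hne hxy hy) (hne hxy' hy')
      obtain ⟨p, q, vp, vq, ee, eed, hcpq, hvp, hvq, hqU, heq, hps⟩ :=
        Val.nested hd hc hF hxy hx hvx hvy ed (hcut.union hcut')
          (fun j _ => Set.subset_union_left)
      obtain ⟨p', q', vp', vq', ee', eed', hcpq', hvp', hvq', hqU', heq', hps'⟩ :=
        Val.nested hd hc hF hxy' hx' hvx' hvy' ed' (hcut.union hcut')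
          (fun j _ => Set.subset_union_right)
      obtain ⟨rfl, rfl⟩ := star_eq_of_cmp_eq (hcpq.symm.trans hcpq')
        (fun j hj => by rw [hqU j hj, hqU' j hj])
      have hqs : cellSize q < cellSize c := by
        refine cellSize_lt (fun j => ?_) ha ?_
        · rw [hcpq]; exact Set.subset_union_right
        · rw [hqU _ (Nat.lt_succ_self l)]
          rintro ⟨-, h | h⟩
          · exact hay h
          · exact hay' h
      obtain rfl := hF _ hps _ _ hvp hvp'
      obtain rfl := hF _ hqs _ _ hvq hvq'
      rw [heq, heq']
    · push Not at hlow
      -- A decomposition at a lower level mediates between the two, each comparison involving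
      -- different levels.
      obtain ⟨j, hj, W, hW, ha, hb⟩ := hlow
      obtain ⟨p, q, epq, hpq, hp, hq⟩ := exists_smaller_cmp (hj.trans h) c hW ha hb
      obtain ⟨v, hv⟩ := Val.exists hd hc p
      obtain ⟨w, hw⟩ := Val.exists hd hc q
      have d := hv.composable hd hc hw epq
      rw [Val.confluence_of_lt hd hc hF hj hxy hpq hx hy hp hq hvx hvy hv hw ed d,
        Val.confluence_of_lt hd hc hF hj hxy' hpq hx' hy' hp hq hvx' hvy' hv hw ed' d]
  · exact (Val.confluence_of_lt hd hc hF hlk hxy' hxy hx' hy' hx hy hvx' hvy' hvx hvy ed' ed).symm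

theorem Val.unique (c : StarCell T (m + 1)) : ∀ v v', Val F φ c v → Val F φ c v' → v = v' := by
  obtain ⟨s, hs⟩ : ∃ s, cellSize c = s := ⟨_, rfl⟩
  induction s using Nat.strong_induction_on generalizing c with
  | _ s ih =>
    have hF : ∀ z, cellSize z < cellSize c → ∀ v v', Val F φ z v → Val F φ z v' → v = v' :=
      fun z hz => ih _ (hs ▸ hz) z rfl
    -- A generator is not a composite of smaller cells: the factor containing `x` contains
    -- everything generated by `x`.
    have hgen : ∀ (x : T.hg.face (m + 1)) (k : ℕ) (h : k < m + 1) (y z : StarCell T (m + 1))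
        (e : (starCat T).dom h y = (starCat T).cod h z), genCell x = (starCat T).cmp h y z e →
        cellSize y < cellSize (genCell x) → cellSize z < cellSize (genCell x) → False := by
      intro x k h y z e hyz hy hz
      have hx : x ∈ fam (genCell x) (m + 1) := self_mem_genFam x
      rw [hyz] at hx
      rcases hx with hx | hx
      · exact absurd (cellSize_le (c := genCell x) (d := y)
          (genFam_subset (fam_isCell y).toClosed hx)) (by omega)
      · exact absurd (cellSize_le (c := genCell x) (d := z)
          (genFam_subset (fam_isCell z).toClosed hx)) (by omega)
    have hnogen : ∀ (x : T.hg.face (m + 1)), fam (genCell x) (m + 1) ≠ ∅ := by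
      intro x h
      have hx : x ∈ fam (genCell x) (m + 1) := self_mem_genFam x
      rw [h] at hx
      exact hx
    intro v v' hv hv'
    by_cases hempty : fam c (m + 1) = ∅
    · obtain ⟨x, -, hx⟩ := exists_idt_of_empty c hempty
      rw [hv.eq_idt hempty x hx, hv'.eq_idt hempty x hx]
    rcases Val.normal hd hc hv with ⟨x, rfl, rfl⟩ | h | ⟨k, h, x, y, vx, vy, e, e', hvx, hvy, hxy,
      rfl, hx, hy⟩
    · rcases Val.normal hd hc hv' with ⟨x', h, rfl⟩ | h | ⟨k, h, x', y', vx, vy, e, e', hvx, hvy,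
        hxy, rfl, hx, hy⟩
      · rw [genCell_injective h]
      · exact (hempty h).elim
      · exact (hgen x k h x' y' e hxy hx hy).elim
    · exact (hempty h).elim
    · rcases Val.normal hd hc hv' with ⟨x', rfl, rfl⟩ | h | ⟨k', h', x', y', vx', vy', e1, e1',
        hvx', hvy', hxy', rfl, hx', hy'⟩
      · exact (hgen x' k h x y e hxy hx hy).elim
      · exact (hempty h).elim
      · exact Val.confluence hd hc hF hxy hxy' hx hy hx' hy' hvx hvy hvx' hvy' e' e1'

end


/-! ### Extension of truncated functors and the polygraph property -/

theorem TruncFunctor.ext' {m : ℕ} {C D : OmegaCat.{u}} {F G : TruncFunctor m C D}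
    (h : ∀ n hn x, F.map n hn x = G.map n hn x) : F = G := by
  obtain ⟨f, _, _, _, _⟩ := F
  obtain ⟨g, _, _, _, _⟩ := G
  obtain rfl : f = g := funext fun n => funext fun hn => funext fun x => h n hn x
  rfl

section

variable {T : POpe.{u}}

/-- Truncated functors agreeing on generators are equal. -/
theorem TruncFunctor.ext_of_gen {m : ℕ} {D : OmegaCat.{u}} {F G : TruncFunctor m (starCat T) D}
    (h : ∀ n hn (x : T.hg.face n), F.map n hn (genCell x) = G.map n hn (genCell x)) : F = G := by
  refine TruncFunctor.ext' fun n hn x => ?_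
  refine star_induction (P := fun n x => ∀ hn, F.map n hn x = G.map n hn x) ?_ ?_ ?_ n x hn
  · intro n x ih hn
    rw [F.map_idt hn, G.map_idt hn, ih]
  · intro n x _ hn
    exact h n hn x
  · intro n k hk x y e _ ihx ihy hn
    rw [F.map_cmp hk hn x y e (by rw [← F.map_dom, ← F.map_cod, e]),
      G.map_cmp hk hn x y e (by rw [← G.map_dom, ← G.map_cod, e])]
    exact D.cmp_congr hk (ihx hn) (ihy hn) _ _

variable {m : ℕ} {D : OmegaCat.{u}} (F : TruncFunctor m (starCat T) D)
  (φ : T.hg.face (m + 1) → D.cell (m + 1))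

/-- The extension of a truncated functor by a map on cells of dimension `m + 1`. -/
def extMap (val : StarCell T (m + 1) → D.cell (m + 1)) (n : ℕ) (hn : n ≤ m + 1)
    (x : StarCell T n) : D.cell n :=
  if h : n ≤ m then F.map n h x
  else Eq.rec (motive := fun k _ => StarCell T k → D.cell k) val
    (show m + 1 = n by omega) x

theorem extMap_of_le (val : StarCell T (m + 1) → D.cell (m + 1)) {n : ℕ} (hn : n ≤ m)
    (hn' : n ≤ m + 1) (x : StarCell T n) : extMap F val n hn' x = F.map n hn x := dif_pos hn

theorem extMap_top (val : StarCell T (m + 1) → D.cell (m + 1)) (hn' : m + 1 ≤ m + 1)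
    (x : StarCell T (m + 1)) : extMap F val (m + 1) hn' x = val x := dif_neg (by omega)

variable {F φ}
  (hd : ∀ x, D.dom (Nat.lt_succ_self m) (φ x) =
    F.map m le_rfl ((starCat T).dom (Nat.lt_succ_self m) (genCell x)))
  (hc : ∀ x, D.cod (Nat.lt_succ_self m) (φ x) =
    F.map m le_rfl ((starCat T).cod (Nat.lt_succ_self m) (genCell x)))
include hd hc

theorem exists_extension : ∃ G : TruncFunctor (m + 1) (starCat T) D,
    (∀ (n : ℕ) (hn : n ≤ m) (x : StarCell T n), G.map n (hn.trans m.le_succ) x = F.map n hn x) ∧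
    ∀ x, G.map (m + 1) le_rfl (genCell x) = φ x := by
  choose val hval using Val.exists (F := F) (φ := φ) hd hc
  have huniq : ∀ {c v}, Val F φ c v → val c = v := fun h => Val.unique hd hc _ _ _ (hval _) h
  refine ⟨⟨extMap F val, ?_, ?_, ?_, ?_⟩, fun n hn x => extMap_of_le F val hn (hn.trans m.le_succ) x,
    fun x => (extMap_top F val le_rfl _).trans (huniq (Val.gen x))⟩
  · intro k n h hn x
    rcases Nat.lt_or_ge m n with h' | h'
    · obtain rfl : n = m + 1 := by omega
      rw [extMap_top, extMap_of_le F val (by omega), (hval x).dom hd hc h]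
    · rw [extMap_of_le F val h', extMap_of_le F val (by omega), F.map_dom h h']
  · intro k n h hn x
    rcases Nat.lt_or_ge m n with h' | h'
    · obtain rfl : n = m + 1 := by omega
      rw [extMap_top, extMap_of_le F val (by omega), (hval x).cod hd hc h]
    · rw [extMap_of_le F val h', extMap_of_le F val (by omega), F.map_cod h h']
  · intro n hn x
    rcases Nat.lt_or_ge n m with h' | h'
    · rw [extMap_of_le F val h', extMap_of_le F val (by omega), F.map_idt h']
    · obtain rfl : n = m := by omega
      rw [extMap_top, extMap_of_le F val le_rfl, huniq (Val.idt x)]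
  · intro k n h hn x y e e'
    rcases Nat.lt_or_ge m n with h' | h'
    · obtain rfl : n = m + 1 := by omega
      have := (hval x).composable hd hc (hval y) e
      rw [extMap_top, huniq (Val.cmp h x y _ _ e this (hval x) (hval y))]
      exact D.cmp_congr h (extMap_top F val _ x).symm (extMap_top F val _ y).symm _ _
    · rw [extMap_of_le F val h', F.map_cmp h h' x y e (by rw [← F.map_dom, ← F.map_cod, e])]
      exact D.cmp_congr h (extMap_of_le F val h' _ x).symm (extMap_of_le F val h' _ y).symm _ _

end

/-- The generators of `T^*`. -/
def gens (T : POpe.{u}) (n : ℕ) : Set ((starCat T).cell n) := Set.range genCell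

theorem star_isPositiveToOnePolygraph (T : POpe.{u}) :
    IsPositiveToOnePolygraph (starCat T) (gens T) where
  zero := by
    refine Set.eq_univ_of_forall fun c => ?_
    rcases star_cases c with ⟨h, -⟩ | ⟨x, rfl⟩ | ⟨k, h, -⟩
    · omega
    · exact ⟨x, rfl⟩
    · omega
  free m D F φ hd hc := by
    obtain ⟨G, hG, hG'⟩ := exists_extension (F := F) (φ := fun x => φ ⟨genCell x, x, rfl⟩)
      (fun x => hd ⟨genCell x, x, rfl⟩) (fun x => hc ⟨genCell x, x, rfl⟩)
    refine ⟨G, ⟨hG, ?_⟩, ?_⟩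
    · rintro ⟨_, x, rfl⟩
      exact hG' x
    · rintro G' ⟨h1, h2⟩
      refine TruncFunctor.ext_of_gen fun n hn x => ?_
      rcases Nat.lt_or_ge m n with h | h
      · obtain rfl : n = m + 1 := by omega
        exact (h2 ⟨genCell x, x, rfl⟩).trans (hG' x).symm
      · exact (h1 n h _).trans (hG n h _).symm
  cod_mem n c hc := by
    obtain ⟨x, rfl⟩ := hc
    exact ⟨_, (genCell_cod x).symm⟩
  dom_ne_idt n c hc y h := by
    obtain ⟨x, rfl⟩ := hc
    -- A face of the nonempty set `δ x` has dimension `n + 1`, whereas an identity on an `n`-cell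
    -- has no such face.
    obtain ⟨z, hz⟩ := T.hg.δ_nonempty x
    have hmem : z ∈ fam (T := T) ((starCat T).dom (Nat.lt_succ_self (n + 1)) (genCell x)) (n + 1) :=
      (mem_genFam_dom T.isCardinal x).2 hz
    rw [h] at hmem
    have : z ∈ fam y (n + 1) := hmem
    rw [fam_empty y (Nat.lt_succ_self n)] at this
    exact this

/-- An `ω`-functor out of `T^*` is determined by its values on generators. -/
theorem OmegaFunctor.ext_of_gen {T : POpe.{u}} {D : OmegaCat.{u}} {f g : OmegaFunctor (starCat T) D}
    (h : ∀ n (x : T.hg.face n), f.map n (genCell x) = g.map n (genCell x)) : f = g := by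
  refine OmegaFunctor.ext (funext fun n => funext fun x => ?_)
  refine star_induction (P := fun n x => f.map n x = g.map n x) ?_ ?_ ?_ n x
  · intro n x ih
    rw [f.map_idt, g.map_idt, ih]
  · intro n x _
    exact h n x
  · intro n k hk x y e _ ihx ihy
    rw [f.map_cmp hk x y e (by rw [← f.map_dom, ← f.map_cod, e]),
      g.map_cmp hk x y e (by rw [← g.map_dom, ← g.map_cod, e])]
    exact D.cmp_congr hk ihx ihy _ _


/-! ## Images under contractions -/

section

variable {Q P : POpe.{u}} (h : Contraction Q.hg P.hg)

/-- The image of a family of faces. -/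
def img (A : Fam Q.hg) : Fam P.hg := fun l =>
  {p | ∃ (j : ℕ) (q : Q.hg.face j), q ∈ A j ∧ h.toFun ⟨j, q⟩ = ⟨l, p⟩}

theorem img_union (A B : Fam Q.hg) : img h (A.union B) = (img h A).union (img h B) := by
  funext l
  ext p
  constructor
  · rintro ⟨j, q, hq | hq, e⟩
    · exact Or.inl ⟨j, q, hq, e⟩
    · exact Or.inr ⟨j, q, hq, e⟩
  · rintro (⟨j, q, hq, e⟩ | ⟨j, q, hq, e⟩)
    · exact ⟨j, q, Or.inl hq, e⟩
    · exact ⟨j, q, Or.inr hq, e⟩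

variable {h}

theorem Contraction.le_of_eq {j l : ℕ} {q : Q.hg.face j} {p : P.hg.face l}
    (e : h.toFun ⟨j, q⟩ = ⟨l, p⟩) : l ≤ j := by
  have := h.dim_le ⟨j, q⟩
  rw [e] at this
  exact this

theorem img_empty {A : Fam Q.hg} {n : ℕ} (hA : ∀ l, n < l → A l = ∅) {l : ℕ} (hl : n < l) :
    img h A l = ∅ := by
  ext p
  refine ⟨?_, fun hp => hp.elim⟩
  rintro ⟨j, q, hq, e⟩
  rw [hA j (hl.trans_le (Contraction.le_of_eq e))] at hq
  exact hq.elim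

variable (h) in
/-- The image of `A` is a cell and taking images commutes with domains and codomains. -/
structure GoodImage (n : ℕ) (A : Fam Q.hg) : Prop where
  isCell : (img h A).IsCell
  dom : ∀ k, k < n → (img h A).dom k = img h (A.dom k)
  cod : ∀ k, k < n → (img h A).cod k = img h (A.cod k)

theorem GoodImage.succ {n : ℕ} {A : Fam Q.hg} (hA : GoodImage h n A)
    (hd : ∀ l, n < l → A l = ∅) : GoodImage h (n + 1) A := by
  refine ⟨hA.isCell, fun k hk => ?_, fun k hk => ?_⟩
  · rcases Nat.lt_or_ge k n with h' | h'
    · exact hA.dom k h'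
    · obtain rfl : k = n := by omega
      rw [Fam.dom_eq_self hd, Fam.dom_eq_self fun l hl => img_empty hd hl]
  · rcases Nat.lt_or_ge k n with h' | h'
    · exact hA.cod k h'
    · obtain rfl : k = n := by omega
      rw [Fam.cod_eq_self hd, Fam.cod_eq_self fun l hl => img_empty hd hl]

theorem GoodImage.union {n k : ℕ} (hk : k < n) {A B : Fam Q.hg} (hA : A.IsCell) (hB : B.IsCell)
    (e : A.dom k = B.cod k) (hA' : GoodImage h n A) (hB' : GoodImage h n B) :
    GoodImage h n (A.union B) := by
  have e' : (img h A).dom k = (img h B).cod k := by rw [hA'.dom k hk, hB'.cod k hk, e]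
  have hU := hA.union Q.isCardinal hB e
  have hU' : (img h (A.union B)).IsCell := by
    rw [img_union]; exact hA'.isCell.union P.isCardinal hB'.isCell e'
  refine ⟨hU', fun j hj => ?_, fun j hj => ?_⟩
  · rcases lt_trichotomy j k with h' | rfl | h'
    -- Below level `k`, the boundary is computed through the `k`-boundary, to which only one factor
    -- contributes.
    · rw [← dom_dom P.isCardinal hU' h', img_union, dom_union_self P.isCardinal hA'.isCell
        hB'.isCell e', dom_dom P.isCardinal hB'.isCell h', hB'.dom j hj,
        ← dom_dom Q.isCardinal hU h', dom_union_self Q.isCardinal hA hB e,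
        dom_dom Q.isCardinal hB h']
    · rw [img_union, dom_union_self P.isCardinal hA'.isCell hB'.isCell e', hB'.dom j hj,
        dom_union_self Q.isCardinal hA hB e]
    · rw [img_union, dom_union P.isCardinal hA'.isCell hB'.isCell e' h', hA'.dom j hj,
        hB'.dom j hj, dom_union Q.isCardinal hA hB e h', img_union]
  · rcases lt_trichotomy j k with h' | rfl | h'
    · rw [← cod_cod P.isCardinal hU' h', img_union, cod_union_self P.isCardinal hA'.isCell
        hB'.isCell e', cod_cod P.isCardinal hA'.isCell h', hA'.cod j hj,
        ← cod_cod Q.isCardinal hU h', cod_union_self Q.isCardinal hA hB e,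
        cod_cod Q.isCardinal hA h']
    · rw [img_union, cod_union_self P.isCardinal hA'.isCell hB'.isCell e', hA'.cod j hj,
        cod_union_self Q.isCardinal hA hB e]
    · rw [img_union, cod_union P.isCardinal hA'.isCell hB'.isCell e' h', hA'.cod j hj,
        hB'.cod j hj, cod_union Q.isCardinal hA hB e h', img_union]

theorem genFam_decomp {T : PosHypergraph.{u}} {n : ℕ} (x : T.face (n + 1)) {l : ℕ} {y : T.face l}
    (hy : y ∈ genFam x l) : (⟨l, y⟩ : T.Face) = ⟨n + 1, x⟩ ∨ y ∈ (genFam x).dom n l ∨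
      y ∈ genFam (T.γ x) l := by
  rcases lt_trichotomy l n with hl | rfl | hl
  · exact Or.inr (Or.inl (Fam.mem_dom.2 ⟨hy, by omega, by omega⟩))
  · rcases mem_genFam_pred.1 hy with rfl | h'
    · exact Or.inr (Or.inr (self_mem_genFam _))
    · by_cases e : y = T.γ x
      · subst e; exact Or.inr (Or.inr (self_mem_genFam _))
      · refine Or.inr (Or.inl (Fam.mem_dom.2 ⟨hy, le_rfl, fun _ a ha e' => e ?_⟩))
        rw [mem_genFam_self.1 ha] at e'
        exact e'.symm
  · rcases Nat.lt_or_ge (n + 1) l with h' | h'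
    · rw [genFam_empty x h'] at hy
      exact hy.elim
    · obtain rfl : l = n + 1 := by omega
      rw [mem_genFam_self.1 hy]
      exact Or.inl rfl

/-- The inductive step for generators: the image of `T[x]` consists of the image of `x` and the
images of its domain and codomain. The image of the domain is identified by `eq_of_dom_eq`, from its
`n`-faces and its own domain. -/
theorem GoodImage.gen {n : ℕ} (x : Q.hg.face (n + 1))
    (hK : GoodImage h n ((genFam x).dom n)) (hγ : GoodImage h n (genFam (Q.hg.γ x)))
    (hγ' : img h (genFam (Q.hg.γ x)) = genFam (h.toFun ⟨n, Q.hg.γ x⟩).2) :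
    img h (genFam x) = genFam (h.toFun ⟨n + 1, x⟩).2 ∧ GoodImage h (n + 1) (genFam x) := by
  have hx := genFam_isCell Q.isCardinal x
  -- The domain and codomain of `x` are parallel, hence so are their images; this transfers known
  -- boundaries from the image of `γ x`.
  have hKdom : ∀ k, k < n → (img h ((genFam x).dom n)).dom k =
      (img h (genFam (Q.hg.γ x))).dom k := by
    intro k hk
    rw [hK.dom k hk, hγ.dom k hk, ← genFam_cod Q.isCardinal, dom_dom Q.isCardinal hx hk,
      dom_cod Q.isCardinal hx hk]
  have hKempty : ∀ l, n < l → img h ((genFam x).dom n) l = ∅ :=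
    fun l hl => img_empty (fun l hl => Fam.dom_empty _ hl) hl
  -- the faces of dimension `n` in the image of the domain
  have hKn : ∀ {p : P.hg.face n}, p ∈ img h ((genFam x).dom n) n ↔
      ∃ q ∈ Q.hg.δ x, h.toFun ⟨n, q⟩ = ⟨n, p⟩ := by
    intro p
    constructor
    · rintro ⟨j, q, hq, e⟩
      have h1 := Contraction.le_of_eq e
      have h2 := (Fam.mem_dom.1 hq).2.1
      obtain rfl : j = n := by omega
      exact ⟨q, (mem_genFam_dom Q.isCardinal x).1 hq, e⟩
    · rintro ⟨q, hq, e⟩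
      exact ⟨n, q, (mem_genFam_dom Q.isCardinal x).2 hq, e⟩
  have hmapγ : h.toFun ⟨n, Q.hg.γ x⟩ = (h.toFun ⟨n + 1, x⟩).γIter n := by
    rw [← h.map_γ n ⟨n + 1, x⟩ rfl, γIter_succ le_rfl, γIter_self]
  have himg : ∀ {l : ℕ} {p : P.hg.face l}, p ∈ img h (genFam x) l ↔
      h.toFun ⟨n + 1, x⟩ = ⟨l, p⟩ ∨ p ∈ img h ((genFam x).dom n) l ∨
        p ∈ img h (genFam (Q.hg.γ x)) l := by
    intro l p
    constructor
    · rintro ⟨j, q, hq, e⟩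
      rcases genFam_decomp x hq with h' | h' | h'
      · rw [h'] at e
        exact Or.inl e
      · exact Or.inr (Or.inl ⟨j, q, h', e⟩)
      · exact Or.inr (Or.inr ⟨j, q, h', e⟩)
    · rintro (e | ⟨j, q, hq, e⟩ | ⟨j, q, hq, e⟩)
      · exact ⟨n + 1, x, self_mem_genFam x, e⟩
      · exact ⟨j, q, (Fam.mem_dom.1 hq).1, e⟩
      · exact ⟨j, q, genFam_γ_subset x j hq, e⟩
  have hfin : ∀ {d : ℕ} (p : P.hg.face d), img h (genFam x) = genFam p →
      (genFam p).dom n = img h ((genFam x).dom n) →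
      (genFam p).cod n = img h (genFam (Q.hg.γ x)) → GoodImage h (n + 1) (genFam x) := by
    intro d p h1 h2 h3
    have hp := genFam_isCell P.isCardinal p
    rw [← genFam_cod Q.isCardinal] at h3
    refine ⟨h1 ▸ hp, fun k hk => ?_, fun k hk => ?_⟩
    · rw [h1]
      rcases Nat.lt_or_ge k n with h' | h'
      · rw [← dom_dom P.isCardinal hp h', h2, hK.dom k h', dom_dom Q.isCardinal hx h']
      · obtain rfl : k = n := by omega
        exact h2
    · rw [h1]
      rcases Nat.lt_or_ge k n with h' | h'
      · rw [← cod_cod P.isCardinal hp h', h3, genFam_cod Q.isCardinal, hγ.cod k h',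
          ← genFam_cod Q.isCardinal, cod_cod Q.isCardinal hx h']
      · obtain rfl : k = n := by omega
        exact h3
  have hdim := h.dim_le ⟨n + 1, x⟩
  obtain ⟨⟨d, p⟩, hf⟩ : ∃ f, h.toFun ⟨n + 1, x⟩ = f := ⟨_, rfl⟩
  have hδ0 := h.map_δ_zero n ⟨n + 1, x⟩ rfl
  have hδ1 := h.map_δ_one n ⟨n + 1, x⟩ rfl
  have hδ2 := h.map_δ_two n ⟨n + 1, x⟩ rfl
  rw [hf] at hdim hδ0 hδ1 hδ2 hmapγ
  rw [hf]
  change d ≤ n + 1 at hdim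
  rcases Nat.lt_or_ge n d with hd | hd
  · obtain rfl : d = n + 1 := by omega
    have hp := genFam_isCell P.isCardinal p
    rw [γIter_succ le_rfl, γIter_self] at hmapγ
    rw [hmapγ] at hγ'
    have hbij := hδ0 rfl
    have hK' : img h ((genFam x).dom n) = (genFam p).dom n := by
      refine eq_of_dom_eq hK.isCell (hp.dom P.isCardinal n) hKempty
        (fun l hl => Fam.dom_empty _ hl) ?_ ?_
      · ext y
        rw [hKn, mem_genFam_dom P.isCardinal]
        constructor
        · rintro ⟨q, hq, e⟩
          have hq' : (⟨n, q⟩ : Q.hg.Face) ∈ Face.δ (⟨n + 1, x⟩ : Q.hg.Face) \ faceKer h.toFun := by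
            refine ⟨⟨q, hq, rfl⟩, ?_⟩
            change ¬ (h.toFun ⟨n, q⟩).1 < n
            rw [e]
            exact lt_irrefl n
          obtain ⟨z, hz, hz'⟩ := hbij.mapsTo hq'
          rw [e] at hz'
          rw [Face.mk_inj hz']
          exact hz
        · intro hy
          obtain ⟨_, ⟨⟨q, hq, rfl⟩, -⟩, e⟩ := hbij.surjOn
            (show (⟨n, y⟩ : P.hg.Face) ∈ Face.δ (⟨n + 1, p⟩ : P.hg.Face) from ⟨y, hy, rfl⟩)
          exact ⟨q, hq, e⟩
      · rintro k rfl
        rw [hKdom k (Nat.lt_succ_self k), hγ', dom_dom P.isCardinal hp (Nat.lt_succ_self k),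
          ← genFam_cod P.isCardinal, dom_cod P.isCardinal hp (Nat.lt_succ_self k)]
    have h1 : img h (genFam x) = genFam p := by
      funext l
      ext y
      rw [himg, hf, hK', hγ']
      constructor
      · rintro (e | h' | h')
        · obtain ⟨rfl, e⟩ := Sigma.mk.inj e
          rw [eq_of_heq e]
          exact self_mem_genFam y
        · exact (Fam.mem_dom.1 h').1
        · exact genFam_γ_subset p l h'
      · intro hy
        exact (genFam_decomp p hy).imp_left Eq.symm
    exact ⟨h1, hfin p h1 hK'.symm (by rw [genFam_cod P.isCardinal, hγ'])⟩
  · have hp := genFam_isCell P.isCardinal p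
    -- In the collapsing case `γ x` and `x` have the same image `p`, and both boundaries of `T[x]`
    -- are sent onto the cell generated by `p`.
    have hmapγ' := hmapγ.trans (Face.γIter_of_le (⟨d, p⟩ : P.hg.Face) hd)
    rw [hmapγ'] at hγ'
    have hpe : ∀ l, n < l → genFam p l = ∅ := fun l hl => genFam_empty p (by omega)
    have hK' : img h ((genFam x).dom n) = genFam p := by
      refine eq_of_dom_eq hK.isCell hp hKempty hpe ?_ ?_
      · ext y
        rw [hKn]
        rcases Nat.lt_or_ge d n with hdn | hdn
        · rw [genFam_empty p hdn]
          refine ⟨?_, fun h' => h'.elim⟩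
          rintro ⟨q, hq, e⟩
          have hlt : (⟨n, q⟩ : Q.hg.Face) ∈ faceKer h.toFun :=
            hδ2 (show d + 1 < n + 1 by omega)
              (show (⟨n, q⟩ : Q.hg.Face) ∈ Face.δ (⟨n + 1, x⟩ : Q.hg.Face) from ⟨q, hq, rfl⟩)
          change (h.toFun ⟨n, q⟩).1 < n at hlt
          rw [e] at hlt
          exact (lt_irrefl n hlt).elim
        · obtain rfl : d = n := by omega
          have hbij := hδ1 rfl
          rw [mem_genFam_self]
          constructor
          · rintro ⟨q, hq, e⟩
            have hq' : (⟨d, q⟩ : Q.hg.Face) ∈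
                Face.δ (⟨d + 1, x⟩ : Q.hg.Face) \ faceKer h.toFun := by
              refine ⟨⟨q, hq, rfl⟩, ?_⟩
              change ¬ (h.toFun ⟨d, q⟩).1 < d
              rw [e]
              exact lt_irrefl d
            have hz := hbij.mapsTo hq'
            rw [e] at hz
            exact Face.mk_inj hz
          · rintro rfl
            obtain ⟨_, ⟨⟨q, hq, rfl⟩, -⟩, e⟩ := hbij.surjOn (Set.mem_singleton _)
            exact ⟨q, hq, e⟩
      · rintro k rfl
        rw [hKdom k (Nat.lt_succ_self k), hγ']
    have h1 : img h (genFam x) = genFam p := by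
      funext l
      ext y
      rw [himg, hf, hK', hγ']
      constructor
      · rintro (e | h' | h')
        · obtain ⟨rfl, e⟩ := Sigma.mk.inj e
          rw [eq_of_heq e]
          exact self_mem_genFam y
        · exact h'
        · exact h'
      · exact fun hy => Or.inr (Or.inl hy)
    exact ⟨h1, hfin p h1 (by rw [Fam.dom_eq_self hpe, hK']) (by rw [Fam.cod_eq_self hpe, hγ'])⟩

/-- The two claims are proved together: all `n`-cells are needed for the domain of an
`(n+1)`-generator, and generators in turn give all `(n+1)`-cells by induction on size. -/
theorem goodImage_aux (n : ℕ) : (∀ x : Q.hg.face n, img h (genFam x) =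
    genFam (h.toFun ⟨n, x⟩).2) ∧ ∀ c : StarCell Q n, GoodImage h n (fam c) := by
  induction n with
  | zero =>
    have hgen : ∀ x : Q.hg.face 0, img h (genFam x) = genFam (h.toFun ⟨0, x⟩).2 := by
      intro x
      obtain ⟨⟨d, p⟩, hf⟩ : ∃ f, h.toFun ⟨0, x⟩ = f := ⟨_, rfl⟩
      have hd : d = 0 := by
        have := Contraction.le_of_eq hf
        omega
      subst hd
      rw [hf]
      funext l
      ext y
      constructor
      · rintro ⟨j, q, hq, e⟩
        have hj : j = 0 := by
          by_contra hj
          rw [genFam_empty x (by omega)] at hq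
          exact hq
        subst hj
        rw [mem_genFam_self.1 hq, hf] at e
        obtain ⟨rfl, e⟩ := Sigma.mk.inj e
        rw [eq_of_heq e]
        exact self_mem_genFam y
      · intro hy
        have hl : l = 0 := by
          by_contra hl
          rw [genFam_empty p (by omega)] at hy
          exact hy
        subst hl
        rw [mem_genFam_self.1 hy]
        exact ⟨0, x, self_mem_genFam x, hf⟩
    refine ⟨hgen, fun c => ?_⟩
    rcases star_cases c with ⟨h', -⟩ | ⟨x, rfl⟩ | ⟨k, hk, -⟩
    · omega
    · refine ⟨?_, fun k hk => by omega, fun k hk => by omega⟩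
      rw [fam_genCell, hgen]
      exact genFam_isCell P.isCardinal _
    · omega
  | succ n ih =>
    have hgen : ∀ x : Q.hg.face (n + 1), img h (genFam x) = genFam (h.toFun ⟨n + 1, x⟩).2 ∧
        GoodImage h (n + 1) (genFam x) := fun x =>
      GoodImage.gen x (ih.2 ((starCat Q).dom (Nat.lt_succ_self n) (genCell x)))
        (ih.2 (genCell (Q.hg.γ x))) (ih.1 (Q.hg.γ x))
    refine ⟨fun x => (hgen x).1, fun c => ?_⟩
    obtain ⟨s, hs⟩ : ∃ s, cellSize c = s := ⟨_, rfl⟩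
    induction s using Nat.strong_induction_on generalizing c with
    | _ s ihs =>
      rcases star_cases c with ⟨-, h'⟩ | ⟨x, rfl⟩ | ⟨k, hk, x, y, e, rfl, h1, h2⟩
      · obtain ⟨x, -, hx⟩ := exists_idt_of_empty c h'
        rw [hx]
        exact (ih.2 x).succ fun l hl => fam_empty x hl
      · exact (hgen x).2
      · exact GoodImage.union hk (fam_isCell x) (fam_isCell y) (congrArg fam e)
          (ihs _ (hs ▸ h1) x rfl) (ihs _ (hs ▸ h2) y rfl)

theorem img_genFam {n : ℕ} (x : Q.hg.face n) : img h (genFam x) = genFam (h.toFun ⟨n, x⟩).2 :=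
  (goodImage_aux n).1 x

theorem goodImage {n : ℕ} (c : StarCell Q n) : GoodImage h n (fam c) := (goodImage_aux n).2 c

variable (h)

/-- The `ω`-functor given by a contraction. -/
def starMap : OmegaFunctor (starCat Q) (starCat P) where
  map _ c := mkCell (img h (fam c)) (goodImage c).isCell
    fun _ hl => img_empty (fun _ hl => fam_empty c hl) hl
  map_dom hk c := fam_injective ((goodImage c).dom _ hk).symm
  map_cod hk c := fam_injective ((goodImage c).cod _ hk).symm
  map_idt _ := rfl
  map_cmp _ _ _ _ _ := fam_injective (img_union h _ _)

end

/-! ### The functor on positive opetopes and its faithfulness -/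

/-- The functor `(-)^*`. -/
def starFunctor : POpe.{u} ⥤ OmegaCat.{u} where
  obj := starCat
  map h := starMap h
  map_id T := by
    refine OmegaFunctor.ext (funext fun n => funext fun c => fam_injective ?_)
    funext l
    ext p
    constructor
    · rintro ⟨j, q, hq, e⟩
      obtain ⟨rfl, e⟩ := Sigma.mk.inj e
      rw [← eq_of_heq e]
      exact hq
    · exact fun hp => ⟨l, p, hp, rfl⟩
  map_comp {Q P R} f g := by
    refine OmegaFunctor.ext (funext fun n => funext fun c => fam_injective ?_)
    funext l
    ext p
    constructor
    · rintro ⟨j, q, hq, e⟩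
      exact ⟨_, _, ⟨j, q, hq, rfl⟩, e⟩
    · rintro ⟨j, q, ⟨i, r, hr, e'⟩, e⟩
      refine ⟨i, r, hr, ?_⟩
      change Contraction.toFun g (Contraction.toFun f ⟨i, r⟩) = _
      rw [e', e]


theorem starFunctor_isStar : IsStar starFunctor.{u} fun T n => Equiv.refl (StarCell T n) where
  dom_faces T k n h x l := by
    ext a
    refine (Fam.mem_dom (S := fam x)).trans ?_
    change _ ↔ a ∈ fam x l ∧ l ≤ k ∧ (l = k → ¬ ∃ b ∈ fam x (l + 1), T.hg.γ b = a)
    simp only [not_exists, not_and, ne_eq]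
  cod_faces T k n h x l := by
    ext a
    refine (Fam.mem_cod (S := fam x)).trans ?_
    change _ ↔ a ∈ fam x l ∧ l ≤ k ∧ (l = k → ¬ ∃ b ∈ fam x (l + 1), a ∈ T.hg.δ b) ∧
      (l + 1 = k → ¬ ∃ b ∈ fam x (l + 2), a ∈ T.hg.ι b)
    simp only [not_exists, not_and]
  idt_faces _ _ _ _ := rfl
  cmp_faces _ _ _ _ _ _ _ _ := rfl
  map_faces _ _ _ _ := rfl

theorem starGenerators_eq (T : POpe.{u}) :
    starGenerators (F := starFunctor) (fun T n => Equiv.refl (StarCell T n)) T = gens T := by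
  funext n
  ext c
  constructor
  · rintro ⟨x, hx⟩
    exact ⟨x, (Subtype.ext hx).symm⟩
  · rintro ⟨x, rfl⟩
    exact ⟨x, rfl⟩

theorem genFam_injective {T : PosHypergraph.{u}} {m n : ℕ} {x : T.face m} {y : T.face n}
    (h : genFam x = genFam y) : (⟨m, x⟩ : T.Face) = ⟨n, y⟩ := by
  have hx : x ∈ genFam y m := h ▸ self_mem_genFam x
  have hy : y ∈ genFam x n := h ▸ self_mem_genFam y
  rcases lt_trichotomy m n with hmn | rfl | hmn
  · rw [genFam_empty x hmn] at hy
    exact hy.elim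
  · rw [mem_genFam_self.1 hx]
  · rw [genFam_empty y hmn] at hx
    exact hx.elim

/-- The value on the generator of `x` is generated by the image of `x`, and a generated family
determines its generating face together with its dimension. -/
instance starFunctor_faithful : starFunctor.{u}.Faithful where
  map_injective {Q P} h h' e := by
    refine Contraction.ext (funext fun q => ?_)
    obtain ⟨n, x⟩ := q
    have := congrArg (fun g : OmegaFunctor (starCat Q) (starCat P) => fam (g.map n (genCell x))) e
    exact genFam_injective ((img_genFam x).symm.trans (this.trans (img_genFam x)))

/-! ## Functors sending generators to generators or identities -/

/-- The faces in a set of faces of a fixed dimension. -/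
def facesOf {T : PosHypergraph.{u}} {n : ℕ} (A : Set (T.face n)) : Set T.Face :=
  {y | ∃ z ∈ A, y = ⟨n, z⟩}

theorem facesOf_empty {T : PosHypergraph.{u}} {n : ℕ} : facesOf (∅ : Set (T.face n)) = ∅ := by
  ext y
  simp [facesOf]

theorem facesOf_singleton {T : PosHypergraph.{u}} {n : ℕ} (x : T.face n) :
    facesOf {x} = {(⟨n, x⟩ : T.Face)} := by
  ext y
  constructor
  · rintro ⟨z, rfl, rfl⟩
    rfl
  · rintro rfl
    exact ⟨x, rfl, rfl⟩

theorem facesOf_union {T : PosHypergraph.{u}} {n : ℕ} (A B : Set (T.face n)) :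
    facesOf (A ∪ B) = facesOf A ∪ facesOf B := by
  ext y
  simp [facesOf, or_and_right, exists_or]

theorem genFam_self {T : PosHypergraph.{u}} {n : ℕ} (x : T.face n) : genFam x n = {x} :=
  Set.ext fun _ => mem_genFam_self

section

variable {Q P : POpe.{u}} {f : OmegaFunctor (starCat Q) (starCat P)} {g : Q.hg.Face → P.hg.Face}
  (hle : ∀ q, (g q).dim ≤ q.dim)
  (hfam : ∀ n (x : Q.hg.face n), fam (f.map n (genCell x)) = genFam (g ⟨n, x⟩).2)

include hfam in
theorem map_dom_genCell {n : ℕ} (x : Q.hg.face (n + 1)) :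
    fam (f.map n ((starCat Q).dom (Nat.lt_succ_self n) (genCell x))) =
      (genFam (g ⟨n + 1, x⟩).2).dom n := by
  rw [← hfam, f.map_dom]
  rfl

include hfam in
theorem map_cod_genCell {n : ℕ} (x : Q.hg.face (n + 1)) :
    genFam (g ⟨n, Q.hg.γ x⟩).2 = (genFam (g ⟨n + 1, x⟩).2).cod n := by
  rw [← hfam, ← hfam, ← genCell_cod, f.map_cod]
  rfl

include hle hfam

/-- For composites, injectivity across the two factors holds because the values are composable in
the target and thus share no faces above `k`. -/
theorem bijOn_of_map {n : ℕ} (c : StarCell Q n) :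
    Set.BijOn g (facesOf (fam c n) \ faceKer g) (facesOf (fam (f.map n c) n)) := by
  refine star_induction (P := fun n c =>
    Set.BijOn g (facesOf (fam c n) \ faceKer g) (facesOf (fam (f.map n c) n))) ?_ ?_ ?_ n c
  · intro n x _
    have h1 : fam (T := Q) ((starCat Q).idt x) (n + 1) = ∅ := fam_empty x (Nat.lt_succ_self n)
    have h2 : fam (f.map (n + 1) ((starCat Q).idt x)) (n + 1) = ∅ := by
      rw [f.map_idt]
      exact fam_empty (f.map n x) (Nat.lt_succ_self n)
    rw [h1, h2, facesOf_empty, facesOf_empty, Set.empty_sdiff]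
    exact Set.bijOn_empty g
  · intro n x _
    rw [hfam, fam_genCell, genFam_self]
    obtain ⟨⟨d, p⟩, hp⟩ : ∃ p, g ⟨n, x⟩ = p := ⟨_, rfl⟩
    have hd : d ≤ n := by
      have := hle ⟨n, x⟩
      rwa [hp] at this
    rw [hp]
    rcases hd.lt_or_eq with hd | rfl
    · have hk : (⟨n, x⟩ : Q.hg.Face) ∈ faceKer g := by
        change (g ⟨n, x⟩).1 < n
        rwa [hp]
      have he : facesOf {x} \ faceKer g = ∅ := Set.sdiff_eq_empty.2 (by
        rintro _ ⟨z, rfl, rfl⟩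
        exact hk)
      rw [genFam_empty p hd, facesOf_empty, he]
      exact Set.bijOn_empty g
    · have hk : (⟨d, x⟩ : Q.hg.Face) ∉ faceKer g := by
        change ¬ (g ⟨d, x⟩).1 < d
        rw [hp]
        exact lt_irrefl d
      have he : facesOf {x} \ faceKer g = facesOf {x} := sdiff_eq_left.mpr (Set.disjoint_left.2 (by
        rintro _ ⟨z, rfl, rfl⟩
        exact hk))
      rw [genFam_self, he, facesOf_singleton, facesOf_singleton]
      exact Set.bijOn_singleton.mpr hp
  · intro n k hk x y e _ hx hy
    have e' : (starCat P).dom hk (f.map n x) = (starCat P).cod hk (f.map n y) := by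
      rw [← f.map_dom, ← f.map_cod, e]
    have h1 : fam (T := Q) ((starCat Q).cmp hk x y e) n = fam x n ∪ fam y n := rfl
    have h2 : fam (f.map n ((starCat Q).cmp hk x y e)) n =
        fam (f.map n x) n ∪ fam (f.map n y) n := by
      rw [f.map_cmp hk x y e e']
      rfl
    have hne : ∀ a ∈ facesOf (fam x n) \ faceKer g, ∀ b ∈ facesOf (fam y n) \ faceKer g,
        g a ≠ g b := by
      intro a ha b hb hab
      obtain ⟨z, hz, hz'⟩ := hx.mapsTo ha
      obtain ⟨w, hw, hw'⟩ := hy.mapsTo hb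
      obtain rfl := Face.mk_inj (hz'.symm.trans (hab.trans hw'))
      exact star_disjoint e' hk hz hw
    rw [h1, h2, facesOf_union, facesOf_union, Set.union_sdiff_distrib]
    refine hx.union hy ?_
    rintro a (ha | ha) b (hb | hb) hab
    · exact hx.injOn ha hb hab
    · exact (hne a ha b hb hab).elim
    · exact (hne b hb a ha hab.symm).elim
    · exact hy.injOn ha hb hab

theorem bijOn_δ {n : ℕ} (x : Q.hg.face (n + 1)) :
    Set.BijOn g (Face.δ (⟨n + 1, x⟩ : Q.hg.Face) \ faceKer g)
      (facesOf ((genFam (g ⟨n + 1, x⟩).2).dom n n)) := by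
  have := bijOn_of_map hle hfam ((starCat Q).dom (Nat.lt_succ_self n) (genCell x))
  rw [map_dom_genCell hfam] at this
  have hδ : fam (T := Q) ((starCat Q).dom (Nat.lt_succ_self n) (genCell x)) n = Q.hg.δ x :=
    Set.ext fun y => mem_genFam_dom Q.isCardinal x
  rw [hδ] at this
  exact this

/-- The contraction underlying a functor that sends generators to generators or identities. -/
def contractionOfMap : Contraction Q.hg P.hg where
  toFun := g
  dim_le := hle
  map_γ := by
    rintro k ⟨_, x⟩ rfl
    rw [γIter_succ le_rfl, γIter_self]
    have hcod := map_cod_genCell hfam x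
    obtain ⟨⟨d, p⟩, hp⟩ : ∃ p, g ⟨k + 1, x⟩ = p := ⟨_, rfl⟩
    have hd : d ≤ k + 1 := by
      have := hle ⟨k + 1, x⟩
      rwa [hp] at this
    rw [hp] at hcod ⊢
    rcases Nat.lt_or_ge k d with hd' | hd'
    · obtain rfl : d = k + 1 := by omega
      rw [γIter_succ le_rfl, γIter_self]
      exact genFam_injective (hcod.trans (genFam_cod P.isCardinal p))
    · exact (genFam_injective (hcod.trans
        (Fam.cod_eq_self fun l hl => genFam_empty p (lt_of_le_of_lt hd' hl)))).trans
        (Face.γIter_of_le (⟨d, p⟩ : P.hg.Face) hd').symm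
  -- The three clauses for `δ` come from one bijection: the top faces of the domain of `T[p]` are `δ
  -- p`, `{p}` or none, according to how far the dimension drops.
  map_δ_zero := by
    rintro k ⟨_, x⟩ rfl hd
    have hbij := bijOn_δ hle hfam x
    obtain ⟨⟨d, p⟩, hp⟩ : ∃ p, g ⟨k + 1, x⟩ = p := ⟨_, rfl⟩
    rw [hp] at hbij hd ⊢
    obtain rfl : d = k + 1 := hd
    have hδ : (genFam p).dom k k = P.hg.δ p := Set.ext fun y => mem_genFam_dom P.isCardinal p
    rw [hδ] at hbij
    exact hbij
  map_δ_one := by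
    rintro k ⟨_, x⟩ rfl hd
    have hbij := bijOn_δ hle hfam x
    obtain ⟨⟨d, p⟩, hp⟩ : ∃ p, g ⟨k + 1, x⟩ = p := ⟨_, rfl⟩
    rw [hp] at hbij hd ⊢
    obtain rfl : d = k := Nat.succ.inj hd
    have hdom : (genFam p).dom d d = {p} := by
      rw [Fam.dom_eq_self (A := genFam p) fun l hl => genFam_empty p hl, genFam_self]
    rw [hdom, facesOf_singleton] at hbij
    exact hbij
  map_δ_two := by
    rintro k ⟨_, x⟩ rfl hd
    have hbij := bijOn_δ hle hfam x
    obtain ⟨⟨d, p⟩, hp⟩ : ∃ p, g ⟨k + 1, x⟩ = p := ⟨_, rfl⟩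
    rw [hp] at hbij hd
    have hd' : d < k := Nat.lt_of_succ_lt_succ hd
    have he : (genFam p).dom k k = ∅ :=
      Set.eq_empty_of_forall_notMem fun y hy => by
        have := (Fam.mem_dom.1 hy).1
        rw [genFam_empty p hd'] at this
        exact this
    rw [he, facesOf_empty] at hbij
    exact fun q hq => by_contra fun hk => hbij.mapsTo ⟨hq, hk⟩

theorem starMap_contractionOfMap : starMap (contractionOfMap hle hfam) = f := by
  refine OmegaFunctor.ext_of_gen fun n x => fam_injective ?_
  rw [hfam]
  exact img_genFam (h := contractionOfMap hle hfam) x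

end

/-- Iterated identities do not change the underlying faces, so each generator is sent to a family
generated by one face of no larger dimension; these faces define the contraction. -/
theorem exists_map_eq_of_sendsGenerators {Q P : POpe.{u}}
    (f : starFunctor.obj Q ⟶ starFunctor.obj P) (hf : SendsGenerators (gens Q) (gens P) f) :
    ∃ h : Q ⟶ P, starFunctor.map h = f := by
  have hex : ∀ q : Q.hg.Face, ∃ p : P.hg.Face, p.dim ≤ q.dim ∧
      fam (T := P) (OmegaFunctor.map f q.1 (genCell q.2)) = genFam p.2 := by
    rintro ⟨n, x⟩
    obtain ⟨m, hm, _, ⟨y, rfl⟩, e⟩ := hf n (genCell x) ⟨x, rfl⟩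
    refine ⟨⟨m, y⟩, hm, ?_⟩
    exact (congrArg (fam (T := P)) e).trans (fam_idIter P hm (genCell y))
  choose g hle hfam using hex
  exact ⟨contractionOfMap (Q := Q) (P := P) (f := f) hle fun n x => hfam ⟨n, x⟩,
    starMap_contractionOfMap (Q := Q) (P := P) (f := f) hle fun n x => hfam ⟨n, x⟩⟩

/-! ## Isomorphisms -/

theorem OmegaFunctor.map_idIter {C D : OmegaCat.{u}} (f : OmegaFunctor C D) {k n : ℕ} (h : k ≤ n)
    (x : C.cell k) : f.map n (C.idIter h x) = D.idIter h (f.map k x) := by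
  induction n, h using Nat.le_induction with
  | base => rw [OmegaData.idIter_self, OmegaData.idIter_self]
  | succ n h ih => rw [OmegaData.idIter_succ _ h, f.map_idt, ih, OmegaData.idIter_succ _ h]

/-- A cell is indecomposable if it is not an identity and is a factor of each of its
decompositions. -/
structure IsIndecomposable {C : OmegaCat.{u}} {n : ℕ} (c : C.cell n) : Prop where
  ne_idIter : ∀ (m : ℕ) (h : m < n) (b : C.cell m), C.idIter h.le b ≠ c
  eq_or_eq : ∀ (k : ℕ) (h : k < n) (x y : C.cell n) (e : C.dom h x = C.cod h y),
    C.cmp h x y e = c → x = c ∨ y = c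

theorem IsIndecomposable.map {C D : OmegaCat.{u}} {f : OmegaFunctor C D} {g : OmegaFunctor D C}
    (hfg : ∀ n (c : C.cell n), g.map n (f.map n c) = c)
    (hgf : ∀ n (d : D.cell n), f.map n (g.map n d) = d) {n : ℕ} {c : C.cell n}
    (hc : IsIndecomposable c) : IsIndecomposable (f.map n c) where
  ne_idIter m h b e := hc.ne_idIter m h (g.map m b) (by rw [← g.map_idIter, e, hfg])
  eq_or_eq k h x y e e' := by
    have e1 : C.dom h (g.map n x) = C.cod h (g.map n y) := by rw [← g.map_dom, ← g.map_cod, e]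
    refine (hc.eq_or_eq k h (g.map n x) (g.map n y) e1 ?_).imp ?_ ?_
    · rw [← g.map_cmp h x y e e1, e', hfg]
    · rintro rfl
      exact (hgf n x).symm
    · rintro rfl
      exact (hgf n y).symm

/-- This describes generators by the `ω`-category structure alone, so isomorphisms preserve them. -/
theorem isIndecomposable_iff {T : POpe.{u}} {n : ℕ} (c : StarCell T n) :
    IsIndecomposable (C := starCat T) c ↔ c ∈ gens T n := by
  constructor
  · intro hc
    rcases star_cases c with ⟨hn, he⟩ | ⟨x, rfl⟩ | ⟨k, h, x, y, e, hxy, hx, hy⟩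
    · obtain ⟨x, hx, -⟩ := exists_idIter_of_empty (Nat.sub_le n 1) c fun l hl => by
        rcases (show n ≤ l by omega).eq_or_lt with rfl | hl'
        · exact he
        · exact fam_empty c hl'
      exact (hc.ne_idIter (n - 1) (by omega) x hx.symm).elim
    · exact ⟨x, rfl⟩
    · rcases hc.eq_or_eq k h x y e hxy.symm with rfl | rfl
      · exact (lt_irrefl _ hx).elim
      · exact (lt_irrefl _ hy).elim
  · rintro ⟨x, rfl⟩
    refine ⟨fun m h b e => ?_, fun k h a b e hab => ?_⟩
    · have hx : x ∈ fam (genCell x) n := self_mem_genFam x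
      rw [← e, star_idIter_fam, fam_empty b h] at hx
      exact hx
    · have hU : (fam a).union (fam b) = genFam x := congrArg fam hab
      have hx : x ∈ (fam a).union (fam b) n := hU ▸ self_mem_genFam x
      refine hx.imp (fun hx => fam_injective (funext fun l => ?_))
        (fun hx => fam_injective (funext fun l => ?_))
      · refine subset_antisymm ?_ (genFam_subset (fam_isCell a).toClosed hx l)
        rw [fam_genCell, ← hU]
        exact Set.subset_union_left
      · refine subset_antisymm ?_ (genFam_subset (fam_isCell b).toClosed hx l)
        rw [fam_genCell, ← hU]
        exact Set.subset_union_right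

theorem sendsGenerators_of_inverse {Q P : POpe.{u}} {f : starFunctor.obj Q ⟶ starFunctor.obj P}
    {g : starFunctor.obj P ⟶ starFunctor.obj Q} (hfg : f ≫ g = 𝟙 _) (hgf : g ≫ f = 𝟙 _) :
    SendsGenerators (gens Q) (gens P) f := by
  intro n c hc
  refine ⟨n, le_rfl, OmegaFunctor.map f n c, ?_, (OmegaData.idIter_self _ _).symm⟩
  refine (isIndecomposable_iff _).1 (IsIndecomposable.map (f := f) (g := g)
    (fun n c => ?_) (fun n d => ?_) ((isIndecomposable_iff _).2 hc))
  · exact congrArg (fun k : OmegaFunctor (starCat Q) (starCat Q) => k.map n c) hfg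
  · exact congrArg (fun k : OmegaFunctor (starCat P) (starCat P) => k.map n d) hgf

/-- Both the isomorphism and its inverse lift to contractions, and faithfulness makes the lifts
mutually inverse. -/
theorem exists_mapIso_eq {Q P : POpe.{u}} (f : starFunctor.obj Q ≅ starFunctor.obj P) :
    ∃ h : Q ≅ P, starFunctor.mapIso h = f := by
  obtain ⟨h, hh⟩ := exists_map_eq_of_sendsGenerators f.hom
    (sendsGenerators_of_inverse f.hom_inv_id f.inv_hom_id)
  obtain ⟨k, hk⟩ := exists_map_eq_of_sendsGenerators f.inv
    (sendsGenerators_of_inverse f.inv_hom_id f.hom_inv_id)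
  refine ⟨⟨h, k, starFunctor.map_injective ?_, starFunctor.map_injective ?_⟩, Iso.ext hh⟩
  · rw [starFunctor.map_comp, hh, hk, f.hom_inv_id, starFunctor.map_id]
  · rw [starFunctor.map_comp, hh, hk, f.inv_hom_id, starFunctor.map_id]

theorem starFunctor_reflectsIsomorphisms : starFunctor.{u}.ReflectsIsomorphisms where
  reflects h _ := by
    obtain ⟨k, hk⟩ := exists_mapIso_eq (asIso (starFunctor.map h))
    have : k.hom = h := starFunctor.map_injective (congrArg Iso.hom hk)
    exact this ▸ k.isIso_hom

end PositiveOpetopes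

/-! ### The theorem -/

theorem mainTheorem7 :
    ∃ (F : POpe.{u} ⥤ OmegaCat.{u})
      (e : ∀ (T : POpe.{u}) (n : ℕ), (F.obj T).cell n ≃ StarCell T n),
      IsStar F e ∧
      (∀ T : POpe.{u}, IsPositiveToOnePolygraph (F.obj T) (starGenerators e T)) ∧
      F.Faithful ∧
      F.ReflectsIsomorphisms ∧
      (∀ (Q P : POpe.{u}) (f : F.obj Q ⟶ F.obj P),
        SendsGenerators (starGenerators e Q) (starGenerators e P) f →
          ∃ h : Q ⟶ P, F.map h = f) ∧
      (∀ (Q P : POpe.{u}) (f : F.obj Q ≅ F.obj P), ∃ h : Q ≅ P, F.mapIso h = f) := by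
  -- The bijections are identities because the cells of `starCat T` are `StarCell T` by definition.
  refine ⟨starFunctor, fun T n => Equiv.refl (StarCell T n), starFunctor_isStar, fun T => ?_,
    starFunctor_faithful, starFunctor_reflectsIsomorphisms, fun Q P f hf => ?_,
    fun Q P f => exists_mapIso_eq f⟩
  · rw [starGenerators_eq]
    exact star_isPositiveToOnePolygraph T
  · rw [starGenerators_eq, starGenerators_eq] at hf
    exact exists_map_eq_of_sendsGenerators f hf
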